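/- Knot diagrams and shadows are drawn on the sphere and considered up to orientation-preserving isotopy of the sphere. A \emph{shadow} is a diagram in which no crossing is resolved (it is not specified which strand is on top). For $a_1,\dots,a_n\in\mathbb{N}=\{0,1,2,\dots\}$ define the tangle shadow $[(a_1),\dots,(a_n)]$ recursively: $[\;]$ consists of two vertical arcs, and $[(a_1),\dots,(a_n)]$ is obtained from $[(a_1),\dots,(a_{n-1})]$ by reflecting over the diagonal through the north-west and south-east corners and then adding $a_n$ unresolved crossings (twists of the two right-hand strands) on the right. The same symbol denotes the closed shadow obtained by connecting the two top ends with each other and the two bottom ends with each other. A \emph{rational knot shadow} is a closed shadow of this form that has exactly one component. An \emph{odd-even shadow} is a closed shadow $[(a_1),\dots,(a_n)]$, $n\ge1$, such that exactly one of the numbers $a_i$ is odd and this happens for $i=1$ or $i=n$. Write $P\stackrel{1}{\Rightarrow}Q$ if $Q$ is obtained from $P$ by zero or more \emph{pseudo Reidemeister I moves}, each of which deletes an unresolved loop, that is, a crossing two neighbouring ends of which are joined by an edge bounding an otherwise empty face. The knotting-unknotting game on a knot shadow: two players, the Knotter and the Unknotter, alternately choose an unresolved crossing and resolve it in one of the two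 possible ways, until every crossing is resolved. The Unknotter wins if the resulting knot diagram is a diagram of the unknot (related to the crossingless diagram by Reidemeister moves); otherwise the Knotter wins. \textbf{Theorem.} Let $T$ be a rational knot shadow with at least one crossing. \begin{enumerate} \item If $T\stackrel{1}{\Rightarrow}O$ for some odd-even shadow $O$, then the Unknotter has a winning strategy on $T$, no matter which player moves first. \item Otherwise, if $T$ has an even number of crossings, then the player who moves second has a winning strategy (whether this is the Knotter or the Unknotter), and if $T$ has an odd number of crossings, then the player who moves first has a winning strategy (whether this is the Knotter or the Unknotter). \end{enumerate} -/

import Mathlib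

/-! Knot diagrams on the sphere are encoded combinatorially (planar diagram codes). -/

/-- A 4-valent diagram code: crossings `V`, edges `E`, and for each crossing `v` the edges
`att v 0, att v 1, att v 2, att v 3` met in counterclockwise order around `v`.  The half-edges
`i` and `i + 2` at a crossing belong to the same strand.  No over/under information is present.
An edge that meets no crossing is a free circle. -/
structure Shadow where
  V : Type
  E : Type
  att : V → ZMod 4 → E

namespace Shadow

/-- Every edge has exactly two ends at crossings, or none (a free circle). -/
def WellFormed (S : Shadow) : Prop :=
  ∀ x : S.E, Nat.card {d : S.V × ZMod 4 // S.att d.1 d.2 = x} = 2 ∨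
    Nat.card {d : S.V × ZMod 4 // S.att d.1 d.2 = x} = 0

/-- `x` and `y` are the two edges at some crossing in `A` that lie opposite to each other. -/
def Opposite (S : Shadow) (A : Set S.V) (x y : S.E) : Prop :=
  ∃ v ∈ A, ∃ i : ZMod 4, x = S.att v i ∧ y = S.att v (i + 2)

/-- The link has exactly one component: it is nonempty, and any two edges are joined by going
straight through crossings. -/
def SingleComponent (S : Shadow) : Prop :=
  Nonempty S.E ∧ ∀ x y : S.E, Relation.EqvGen (S.Opposite Set.univ) x y

/-- Walking along the boundary of a face: leave `v` along half-edge `i`, arrive at `w` by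
half-edge `j`, and continue along half-edge `j + 1`. -/
def FaceStep (S : Shadow) (d d' : S.V × ZMod 4) : Prop :=
  ∃ (w : S.V) (j : ZMod 4), (w, j) ≠ d ∧ S.att w j = S.att d.1 d.2 ∧ d' = (w, j + 1)

/-- The faces: cycles of half-edges under `FaceStep`. -/
def Face (S : Shadow) : Type := Quot S.FaceStep

/-- Euler's formula `|V| - |E| + |F| = 2`, which for a connected code says that it lies on the
sphere; the crossingless circle is planar by convention. -/
def Planar (S : Shadow) : Prop :=
  IsEmpty S.V ∨ Nat.card S.V + Nat.card S.Face = Nat.card S.E + 2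

/-- The code of a shadow of a knot, drawn on the sphere. -/
structure IsKnotShadow (S : Shadow) : Prop where
  finite : Finite S.V
  wellFormed : S.WellFormed
  singleComponent : S.SingleComponent
  planar : S.Planar

/-- Equality up to (orientation preserving) isotopy of the sphere: a relabelling of crossings
and edges, and a rotation of the numbering at each crossing. -/
def Iso (S T : Shadow) : Prop :=
  ∃ (f : S.V ≃ T.V) (g : S.E ≃ T.E) (r : S.V → ZMod 4),
    ∀ v i, T.att (f v) (i + r v) = g (S.att v i)

/-- Remove the crossings in `A`, letting the strands run straight through: edges lying opposite
at a removed crossing are joined into one. -/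
def erase (S : Shadow) (A : Set S.V) : Shadow where
  V := {v : S.V // v ∉ A}
  E := Quot (S.Opposite A)
  att v i := Quot.mk _ (S.att v.1 i)

/-- Two neighbouring half-edges at `v` are joined: `v` is the crossing of a loop bounding an
empty face. -/
def IsLoop (S : Shadow) (v : S.V) : Prop :=
  ∃ i : ZMod 4, S.att v i = S.att v (i + 1)

/-- Pseudo Reidemeister I move: delete an unresolved loop of a knot shadow. -/
def PseudoR1 (S T : Shadow) : Prop :=
  S.IsKnotShadow ∧ T.IsKnotShadow ∧ ∃ v : S.V, S.IsLoop v ∧ (S.erase {v}).Iso T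

/-- `S` becomes `T`, up to isotopy, by zero or more pseudo Reidemeister I moves. -/
def ReducesR1 (S T : Shadow) : Prop :=
  Relation.ReflTransGen (fun P Q => P.PseudoR1 Q ∨ P.Iso Q) S T

end Shadow

/-- The strand (one of two) at a crossing to which the half-edge `i` belongs. -/
def strand : ZMod 4 →+* ZMod 2 := ZMod.castHom (by norm_num) (ZMod 2)

/-- A diagram: a shadow together with the choice, at each crossing, of the over-strand. -/
structure Diagram where
  shadow : Shadow
  top : shadow.V → ZMod 2

namespace Diagram

/-- Equality of diagrams up to isotopy of the sphere. -/
def Iso (D D' : Diagram) : Prop :=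
  ∃ (f : D.shadow.V ≃ D'.shadow.V) (g : D.shadow.E ≃ D'.shadow.E) (r : D.shadow.V → ZMod 4),
    (∀ v i, D'.shadow.att (f v) (i + r v) = g (D.shadow.att v i)) ∧
    ∀ v, D'.top (f v) = D.top v + strand (r v)

/-- Remove the crossings in `A`, letting the strands run straight through. -/
def erase (D : Diagram) (A : Set D.shadow.V) : Diagram where
  shadow := D.shadow.erase A
  top v := D.top v.1

/-- Reidemeister I: `D'` is `D` with a loop deleted. -/
def R1 (D D' : Diagram) : Prop :=
  ∃ v : D.shadow.V, D.shadow.IsLoop v ∧ (D.erase {v}).Iso D'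

/-- Reidemeister II: `D` has a bigon face with corners `v` and `w`, and one of the two strands
bounding it is over the other at both corners; `D'` is `D` with both crossings removed. -/
def R2 (D D' : Diagram) : Prop :=
  ∃ (v w : D.shadow.V) (i j : ZMod 4), v ≠ w ∧
    D.shadow.att v i = D.shadow.att w (j + 1) ∧
    D.shadow.att v (i + 1) = D.shadow.att w j ∧
    (D.top v = strand i ↔ D.top w = strand (j + 1)) ∧
    (D.erase {v, w}).Iso D'

/-- Reidemeister III: `p`, `q`, `r` are the corners of a triangular face in counterclockwise
order, and the strand along the side `pq` is over the other two strands.  It is moved across the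
crossing `r`.  This keeps all crossings, and exchanges, on each of the three strands, the order in
which the two corners on it are met. `att'` describes the edges after the move. -/
def R3 (D D' : Diagram) : Prop :=
  ∃ (p q r : D.shadow.V) (i j k : ZMod 4) (att' : D.shadow.V → ZMod 4 → D.shadow.E),
    p ≠ q ∧ q ≠ r ∧ r ≠ p ∧
    D.shadow.att p i = D.shadow.att q (j + 1) ∧
    D.shadow.att q j = D.shadow.att r (k + 1) ∧
    D.shadow.att r k = D.shadow.att p (i + 1) ∧
    D.top p = strand i ∧ D.top q = strand (j + 1) ∧
    -- the strand through `p` and `q`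
    att' p (i + 2) = D.shadow.att q (j + 1) ∧ att' p i = D.shadow.att q (j + 3) ∧
    att' q (j + 1) = D.shadow.att p (i + 2) ∧ att' q (j + 3) = D.shadow.att p i ∧
    -- the strand through `q` and `r`
    att' q (j + 2) = D.shadow.att r (k + 1) ∧ att' q j = D.shadow.att r (k + 3) ∧
    att' r (k + 1) = D.shadow.att q (j + 2) ∧ att' r (k + 3) = D.shadow.att q j ∧
    -- the strand through `r` and `p`
    att' r (k + 2) = D.shadow.att p (i + 1) ∧ att' r k = D.shadow.att p (i + 3) ∧
    att' p (i + 1) = D.shadow.att r (k + 2) ∧ att' p (i + 3) = D.shadow.att r k ∧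
    -- everything else is unchanged
    (∀ v, v ≠ p → v ≠ q → v ≠ r → att' v = D.shadow.att v) ∧
    Iso ⟨⟨D.shadow.V, D.shadow.E, att'⟩, D.top⟩ D'

/-- One isotopy or Reidemeister move between knot diagrams on the sphere. -/
def Move (D D' : Diagram) : Prop :=
  D.shadow.IsKnotShadow ∧ D'.shadow.IsKnotShadow ∧
    (D.Iso D' ∨ D.R1 D' ∨ D.R2 D' ∨ D.R3 D')

/-- The crossingless diagram of the unknot. -/
def circle : Diagram where
  shadow := { V := Empty, E := Unit, att := fun v _ => v.elim }
  top := fun v => v.elim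

/-- `D` represents the unknot: moves and inverse moves turn it into the circle. -/
def IsUnknot (D : Diagram) : Prop := Relation.EqvGen Move D circle

end Diagram

/-! The knotting-unknotting game. -/

inductive Player
  | unknotter
  | knotter

/-- The opponent. -/
def Player.other : Player → Player
  | .unknotter => .knotter
  | .knotter => .unknotter

/-- The player who has won once the diagram is fully resolved. -/
def Player.WonBy : Player → Diagram → Prop
  | .unknotter, D => D.IsUnknot
  | .knotter, D => ¬ D.IsUnknot

namespace Shadow

/-- A pseudodiagram over the shadow `S`: each crossing is unresolved (`none`) or has a chosen
over-strand. -/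
abbrev Position (S : Shadow) : Type := S.V → Option (ZMod 2)

/-- `τ` arises from `σ` by resolving one unresolved crossing. -/
def IsOption {S : Shadow} (σ τ : S.Position) : Prop :=
  ∃ v, σ v = none ∧ τ v ≠ none ∧ ∀ w, w ≠ v → τ w = σ w

/-- `CanWin p m σ`: player `p` has a winning strategy from position `σ` when `m` is to move. -/
inductive CanWin {S : Shadow} (p : Player) : Player → S.Position → Prop
  | finished (m : Player) (σ : S.Position) (o : S.V → ZMod 2)
      (ho : ∀ v, σ v = some (o v)) (hwin : p.WonBy ⟨S, o⟩) : CanWin p m σ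
  | ownMove (σ τ : S.Position) (h : IsOption σ τ) (hτ : CanWin p p.other τ) : CanWin p p σ
  | otherMove (σ : S.Position) (hσ : ∃ v, σ v = none)
      (h : ∀ τ, IsOption σ τ → CanWin p p τ) : CanWin p p.other σ

/-- The starting position: no crossing is resolved. -/
def start (S : Shadow) : S.Position := fun _ => none

/-- Outcome U: the Unknotter wins whoever moves first. -/
def UnknotterWins (S : Shadow) : Prop := ∀ m : Player, CanWin .unknotter m S.start

/-- Outcome 1: whoever moves first wins. -/
def FirstPlayerWins (S : Shadow) : Prop := ∀ p : Player, CanWin p p S.start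

/-- Outcome 2: whoever moves second wins. -/
def SecondPlayerWins (S : Shadow) : Prop := ∀ p : Player, CanWin p p.other S.start

end Shadow

/-! Rational shadows. -/

/-- The shadow of a tangle with four endpoints, lying on the given edges. -/
structure TangleShadow where
  V : Type
  E : Type
  att : V → ZMod 4 → E
  nw : E
  ne : E
  sw : E
  se : E

namespace TangleShadow

/-- The starting tangle: two vertical arcs, the left one `false` and the right one `true`. -/
def base : TangleShadow where
  V := Empty
  E := Bool
  att := fun v _ => v.elim
  nw := false
  ne := true
  sw := false
  se := true

/-- Reflection over the diagonal through the northwest and southeast corners. -/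
def reflect (t : TangleShadow) : TangleShadow where
  V := t.V
  E := t.E
  att v i := t.att v (-i)
  nw := t.nw
  ne := t.sw
  sw := t.ne
  se := t.se

/-- Add one crossing to the right.  The half-edges `0, 1, 2, 3` of the new crossing `none` point
northeast, northwest, southwest and southeast. -/
def twist (t : TangleShadow) : TangleShadow where
  V := Option t.V
  E := t.E ⊕ Bool
  att
    | some v, i => Sum.inl (t.att v i)
    | none, i =>
      if i = 0 then Sum.inr true
      else if i = 1 then Sum.inl t.ne
      else if i = 2 then Sum.inl t.se
      else Sum.inr false
  nw := Sum.inl t.nw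
  ne := Sum.inr true
  sw := Sum.inl t.sw
  se := Sum.inr false

/-- `x` and `y` carry the two top ends, or the two bottom ends. -/
def Joined (t : TangleShadow) (x y : t.E) : Prop :=
  (x = t.nw ∧ y = t.ne) ∨ (x = t.sw ∧ y = t.se)

/-- Connect the top two ends, and the bottom two ends. -/
def close (t : TangleShadow) : Shadow where
  V := t.V
  E := Quot t.Joined
  att v i := Quot.mk _ (t.att v i)

/-- The rational tangle shadow `[(a₁), …, (aₙ)]`: starting from `base`, for each `aᵢ` in turn,
reflect and then add `aᵢ` crossings to the right. -/
def rational (a : List ℕ) : TangleShadow :=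
  a.foldl (fun t k => twist^[k] t.reflect) base

end TangleShadow

/-- The closure of the rational tangle shadow `[(a₁), …, (aₙ)]`. -/
def rationalShadow (a : List ℕ) : Shadow := (TangleShadow.rational a).close

namespace Shadow

/-- Rational shadows, up to isotopy of the sphere. -/
def IsRational (S : Shadow) : Prop := ∃ a : List ℕ, (rationalShadow a).Iso S

/-- Odd-even shadows, up to isotopy of the sphere: of the form `[(a₁), …, (aₙ)]` where exactly one
`aᵢ` is odd, and its index `i` is `1` or `n`. -/
def IsOddEven (S : Shadow) : Prop :=
  ∃ a : List ℕ, (rationalShadow a).Iso S ∧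
    ∃ i : Fin a.length, (i.val = 0 ∨ i.val + 1 = a.length) ∧
      Odd (a.get i) ∧ ∀ j : Fin a.length, j ≠ i → Even (a.get j)

end Shadow

/-! The resolving game on a set of crossings with an arbitrary goal. -/

/-! Both players rely on pairing strategies. For the Unknotter, two crossings at the corners of a
bigon disappear by a Reidemeister II move once they are resolved suitably, so a move at one of them
can be answered at the other. A loop disappears by Reidemeister I however it is resolved, so it is
an irrelevant crossing. Irrelevant crossings can be used to pass, and therefore every strategy is
constructed for the game with an arbitrary number of them added (`WinAll`). Peeling a rational
tangle from its inner end always exhibits a loop, a bigon, or a rewriting without effect, so the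
Unknotter wins whenever moving last (`unknottable_last`).

On an odd-even shadow the Unknotter also wins when not moving last (`unknottable_of_oddEven`). The
number of crossings is odd, and, after harmless rewritings and apart from trivial base cases, every
crossing has a bigon partner: in its own row, or, for a lone outermost crossing, in the next row
through the closing arcs. Removing both leaves an odd-even shadow again. Pseudo Reidemeister I moves
only delete irrelevant crossings, so the conclusion extends to every shadow that reduces to an
odd-even one.

For the Knotter the obstruction is Fox colouring. A resolved rational tangle has an integral
colouring with horizontal and vertical differences `p` and `q`; they start as `(1, 0)`, a crossing
replaces `p` by `p + q` or `p - q`, and reflection exchanges them (`exists_coloring`). Modulo `p`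
the colouring descends to the closure. Since the unknot has only constant colourings
(`Diagram.IsUnknot.rigid`) and `p`, `q` are coprime, an unknotted closure has `p = ±1`
(`natAbs_slope_eq_one`). So it suffices that the Knotter can avoid `p = ±1`, which is a game on
words in two letters, twist and reflection (`Knottable`). There adjacent twists with opposite signs
cancel, so two crossings may be taken from any row, and short rows at the ends can be absorbed. For
a normal form (outer rows at least `2`, inner rows at least `1`, `p` odd, not odd-even) this leads
by induction to one of the lists `[2, 2]`, `[3, 1, 3]`, `[2, 1, 1, 2]`, `[2, 2, 1, 2, 2]`, which are
solved by exhaustive search (`knottable_of_normal`).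

Finally, every rational knot shadow with a crossing either reduces to an odd-even shadow or is
`Knottable` (`Twists.settled`). In the second case each player wins when moving last, and the parity
of the number of crossings says who that is. -/

namespace ResolvingGame

/-- A position: each crossing is unresolved or has a chosen over-strand. -/
abbrev Pos (V : Type) : Type := V → Option (ZMod 2)

/-- `τ` arises from `σ` by resolving one crossing. -/
def Resolves {V : Type} (σ τ : Pos V) : Prop :=
  ∃ v, σ v = none ∧ τ v ≠ none ∧ ∀ w, w ≠ v → τ w = σ w

/-- `Win G b σ`: from `σ` a fixed player can force a final position satisfying `G`; the flag `b`
says whether it is that player's turn. -/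
inductive Win {V : Type} (G : (V → ZMod 2) → Prop) : Bool → Pos V → Prop
  | done (b : Bool) (σ : Pos V) (o : V → ZMod 2) (ho : ∀ v, σ v = some (o v)) (hG : G o) :
      Win G b σ
  | own (σ τ : Pos V) (h : Resolves σ τ) (hτ : Win G false τ) : Win G true σ
  | opp (σ : Pos V) (hσ : ∃ v, σ v = none) (h : ∀ τ, Resolves σ τ → Win G true τ) : Win G false σ

theorem resolves_update {V : Type} [DecidableEq V] {σ : Pos V} {v : V} (h : σ v = none)
    (a : ZMod 2) : Resolves σ (Function.update σ v (some a)) :=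
  ⟨v, h, by simp, fun w hw => by simp [hw]⟩

theorem Resolves.eq_update {V : Type} [DecidableEq V] {σ τ : Pos V} (h : Resolves σ τ) :
    ∃ v a, σ v = none ∧ τ = Function.update σ v (some a) := by
  obtain ⟨v, hv, hτ, hw⟩ := h
  obtain ⟨a, ha⟩ := Option.ne_none_iff_exists'.mp hτ
  refine ⟨v, a, hv, funext fun w => ?_⟩
  by_cases h : w = v
  · subst h; simp [ha]
  · simp [h, hw w h]

theorem Resolves.ncard {V : Type} [Finite V] {σ τ : Pos V} (h : Resolves σ τ) :
    {v | σ v = none}.ncard = {v | τ v = none}.ncard + 1 := by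
  obtain ⟨v, hv, hτ, hw⟩ := h
  have : {v | σ v = none} = insert v {v | τ v = none} := by
    ext w
    by_cases h : w = v
    · subst h; simp [hv]
    · simp [h, hw w h]
  rw [this, Set.ncard_insert_of_notMem (by simpa using hτ) (Set.toFinite _)]

/-- If every outcome satisfies the goal, the game is won from every position. -/
theorem Win.of_forall {V : Type} [Finite V] {G : (V → ZMod 2) → Prop} (hG : ∀ o, G o)
    (b : Bool) (σ : Pos V) : Win G b σ := by
  classical
  induction h : {v | σ v = none}.ncard generalizing b σ with
  | zero =>
    have h' : ∀ v, ∃ a, σ v = some a := fun v => by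
      have : {v | σ v = none} = ∅ := (Set.ncard_eq_zero (Set.toFinite _)).mp h
      exact Option.ne_none_iff_exists'.mp fun hv => by
        have : v ∈ ({v | σ v = none} : Set V) := hv
        simp_all
    choose o ho using h'
    exact .done b σ o ho (hG o)
  | succ n ih =>
    obtain ⟨v, hv⟩ : ({v | σ v = none} : Set V).Nonempty := by
      rw [Set.nonempty_iff_ne_empty]; rintro h0; simp [h0] at h
    have key : ∀ τ, Resolves σ τ → ∀ b, Win G b τ := fun τ hτ b =>
      ih b τ (by have := hτ.ncard; omega)
    cases b
    · exact .opp σ ⟨v, hv⟩ fun τ hτ => key τ hτ true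
    · exact .own σ _ (resolves_update hv 0) (key _ (resolves_update hv 0) false)

/-- Crossings outside the range of `k` that are already resolved may be forgotten. -/
theorem Win.sim {V V' : Type} {G : (V → ZMod 2) → Prop} {G' : (V' → ZMod 2) → Prop}
    {k : V' → V} (hk : Function.Injective k) (s : V' → ZMod 2) {b : Bool} {σ' : Pos V'}
    (h : Win G' b σ') : ∀ σ : Pos V, (∀ v, σ' v = (σ (k v)).map (· + s v)) →
    (∀ v, v ∉ Set.range k → σ v ≠ none) →
    (∀ o : V → ZMod 2, (∀ v, v ∉ Set.range k → σ v = some (o v)) →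
      G' (fun v => o (k v) + s v) → G o) → Win G b σ := by
  classical
  induction h with
  | done b σ' o' ho hG' =>
    intro σ hσ hr hG
    have h' : ∀ v, ∃ a, σ v = some a := fun v => by
      apply Option.ne_none_iff_exists'.mp
      by_cases hv : v ∈ Set.range k
      · obtain ⟨u, rfl⟩ := hv
        intro h0
        have := hσ u
        simp [h0, ho] at this
      · exact hr v hv
    choose o ho' using h'
    refine .done b σ o ho' (hG o (fun v _ => ho' v) ?_)
    convert hG' using 1
    funext v
    have := hσ v
    simp [ho, ho'] at this
    exact this.symm
  | own σ' τ' h hτ ih =>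
    intro σ hσ hr hG
    obtain ⟨v, a, hv, rfl⟩ := h.eq_update
    have hσv : σ (k v) = none := by
      have := hσ v
      rw [hv] at this
      simpa using this.symm
    -- Subtracting `s v` undoes the shift, so that the smaller game sees exactly the value `a`.
    refine .own σ _ (resolves_update hσv (a - s v)) (ih _ ?_ ?_ ?_)
    · intro u
      by_cases hu : u = v
      · subst hu; simp
      · simp [hu, hk.ne hu, hσ]
    · intro u hu
      have : u ≠ k v := fun h => hu ⟨v, h.symm⟩
      simpa [this] using hr u hu
    · intro o ho
      refine hG o fun u hu => ?_
      have : u ≠ k v := fun h => hu ⟨v, h.symm⟩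
      simpa [this] using ho u hu
  | opp σ' hex h ih =>
    intro σ hσ hr hG
    obtain ⟨v, hv⟩ := hex
    refine .opp σ ⟨k v, ?_⟩ fun τ hτ => ?_
    · have := hσ v
      rw [hv] at this
      simpa using this.symm
    · obtain ⟨w, hw, hτw, hoth⟩ := hτ
      have hwr : w ∈ Set.range k := by
        by_contra hc; exact hr w hc hw
      obtain ⟨u, rfl⟩ := hwr
      have hne : ∀ v, v ∉ Set.range k → v ≠ k u := fun v hv h => hv ⟨u, h.symm⟩
      -- The position of the smaller game is read off from `τ`.
      refine ih (fun v => (τ (k v)).map (· + s v)) ⟨u, by simp [hσ, hw], by simpa using hτw, ?_⟩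
        τ (fun _ => rfl) ?_ ?_
      · intro x hx
        simp [hσ, hoth (k x) (hk.ne hx)]
      · intro v hv
        rw [hoth v (hne v hv)]; exact hr v hv
      · intro o ho
        refine hG o fun v hv => ?_
        rw [← hoth v (hne v hv)]; exact ho v hv

/-- If the player moves last, a pair of crossings on which every move can be answered may be added
to the game. -/
theorem Win.pair {V V' : Type} [Finite V'] {G : (V → ZMod 2) → Prop} {G' : (V' → ZMod 2) → Prop}
    {k : V' → V} (hk : Function.Injective k) (s : V' → ZMod 2) {x y : V} (hxy : x ≠ y)
    (hr : Set.range k = {x, y}ᶜ)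
    (h₁ : ∀ a, ∃ c, ∀ o : V → ZMod 2, o x = a → o y = c → G' (fun v => o (k v) + s v) → G o)
    (h₂ : ∀ a, ∃ c, ∀ o : V → ZMod 2, o y = a → o x = c → G' (fun v => o (k v) + s v) → G o)
    {b : Bool} {σ' : Pos V'} (h : Win G' b σ') :
    (b = true ↔ Odd {v | σ' v = none}.ncard) →
    ∀ σ : Pos V, (∀ v, σ' v = (σ (k v)).map (· + s v)) → σ x = none → σ y = none →
    Win G b σ := by
  classical
  have hmem : ∀ v, v ∉ Set.range k ↔ v = x ∨ v = y := fun v => by simp [hr]; tauto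
  have hkx : ∀ v, k v ≠ x := fun v h => (hmem x).mpr (Or.inl rfl) ⟨v, h⟩
  have hky : ∀ v, k v ≠ y := fun v h => (hmem y).mpr (Or.inr rfl) ⟨v, h⟩
  -- the reply to a move outside the smaller game
  have reply : ∀ (σ' : Pos V') (σ : Pos V), Win G' false σ' →
      (∀ v, σ' v = (σ (k v)).map (· + s v)) → σ x = none → σ y = none →
      ∀ w a, (w = x ∨ w = y) → Win G true (Function.update σ w (some a)) := by
    intro σ' σ hW hσ hx hy w a hw
    rcases hw with rfl | rfl
    · obtain ⟨c, hc⟩ := h₁ a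
      refine .own _ (Function.update (Function.update σ w (some a)) y (some c))
        (resolves_update (by simp [hxy.symm, hy]) c) ?_
      refine hW.sim hk s _ ?_ ?_ ?_
      · intro v; simp [hkx, hky, hσ]
      · intro v hv
        rcases (hmem v).mp hv with rfl | rfl <;> simp [hxy]
      · intro o ho
        have e₁ := ho w ((hmem w).mpr (Or.inl rfl))
        have e₂ := ho y ((hmem y).mpr (Or.inr rfl))
        simp [hxy] at e₁ e₂
        exact hc o e₁.symm e₂.symm
    · obtain ⟨c, hc⟩ := h₂ a
      refine .own _ (Function.update (Function.update σ w (some a)) x (some c))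
        (resolves_update (by simp [hxy, hx]) c) ?_
      refine hW.sim hk s _ ?_ ?_ ?_
      · intro v; simp [hkx, hky, hσ]
      · intro v hv
        rcases (hmem v).mp hv with rfl | rfl <;> simp [hxy.symm]
      · intro o ho
        have e₁ := ho w ((hmem w).mpr (Or.inr rfl))
        have e₂ := ho x ((hmem x).mpr (Or.inl rfl))
        simp [hxy.symm] at e₁ e₂
        exact hc o e₁.symm e₂.symm
  induction h with
  | done b σ' o' ho hG' =>
    intro hb σ hσ hx hy
    -- The smaller game is over, so by parity it is the opponent who has to open the pair.
    obtain rfl : b = false := by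
      have : {v | σ' v = none} = ∅ := by ext v; simp [ho]
      rw [this] at hb
      simpa using hb
    have hd : Win G' false σ' := .done _ σ' o' ho hG'
    refine .opp σ ⟨x, hx⟩ fun τ hτ => ?_
    obtain ⟨w, a, hw, rfl⟩ := hτ.eq_update
    refine reply σ' σ hd hσ hx hy w a ?_
    rw [← hmem]
    rintro ⟨v, rfl⟩
    have := hσ v
    simp [hw, ho] at this
  | own σ' τ' h hτ ih =>
    intro hb σ hσ hx hy
    have hcard := h.ncard
    obtain ⟨v, a, hv, rfl⟩ := h.eq_update
    have hσv : σ (k v) = none := by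
      have := hσ v
      rw [hv] at this
      simpa using this.symm
    have hodd := hb.mp rfl
    refine .own σ _ (resolves_update hσv (a - s v)) (ih ?_ _ ?_ ?_ ?_)
    · rw [hcard, Nat.odd_add_one, Nat.not_odd_iff_even] at hodd
      simpa using hodd
    · intro u
      by_cases hu : u = v
      · subst hu; simp
      · simp [hu, hk.ne hu, hσ]
    · simp [(hkx v).symm, hx]
    · simp [(hky v).symm, hy]
  | opp σ' hex h ih =>
    intro hb σ hσ hx hy
    refine .opp σ ⟨x, hx⟩ fun τ hτ => ?_
    obtain ⟨w, a, hw, rfl⟩ := hτ.eq_update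
    by_cases hwr : w ∈ Set.range k
    · obtain ⟨u, rfl⟩ := hwr
      have hσu : σ' u = none := by simp [hσ, hw]
      have hres := resolves_update hσu (a + s u)
      have hcard := hres.ncard
      refine ih _ hres ?_ _ ?_ ?_ ?_
      · have heven : ¬ Odd {v | σ' v = none}.ncard := fun h => by simpa using hb.mpr h
        rw [hcard, Nat.odd_add_one, not_not] at heven
        simpa using heven
      · intro v
        by_cases hv : v = u
        · subst hv; simp
        · simp [hv, hk.ne hv, hσ]
      · simp [(hkx u).symm, hx]
      · simp [(hky u).symm, hy]
    -- A move on the pair leaves the smaller game untouched, with the opponent to move there.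
    · exact reply σ' σ (.opp σ' hex h) hσ hx hy w a ((hmem w).mp hwr)

/-- The game on `V` with goal `G` is won in the presence of any number of irrelevant crossings,
provided that the player moves last (`ε` even), or does not move last (`ε` odd). -/
def WinAll (ε : ℕ) (V : Type) (G : (V → ZMod 2) → Prop) : Prop :=
  ∀ (D : Type) [Finite D] (b : Bool), (b = true ↔ Odd (Nat.card V + Nat.card D + ε)) →
    Win (V := V ⊕ D) (fun o => G (o ∘ Sum.inl)) b (fun _ => none)

/-- Taking the empty type of irrelevant crossings recovers the plain game. -/
theorem WinAll.win {ε : ℕ} {V : Type} {G : (V → ZMod 2) → Prop} (h : WinAll ε V G) (b : Bool)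
    (hb : b = true ↔ Odd (Nat.card V + ε)) : Win G b (fun _ => none) := by
  have := h Empty b (by simpa using hb)
  refine this.sim (k := Sum.elim id Empty.elim) ?_ (fun _ => 0) _ (by simp) ?_ ?_
  · rintro (x | x) (y | y) h
    · simpa using h
    · exact y.elim
    · exact x.elim
    · exact x.elim
  · intro v hv
    exact absurd ⟨Sum.inl v, rfl⟩ hv
  · intro o _ h
    convert h using 1
    funext v
    simp

theorem WinAll.of_forall {ε : ℕ} {V : Type} [Finite V] {G : (V → ZMod 2) → Prop}
    (h : ∀ o, G o) : WinAll ε V G :=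
  fun _ _ b _ => Win.of_forall (fun o => h (o ∘ Sum.inl)) b _

theorem card_eq_of_range_compl {V V' : Type} [Finite V] {k : V' → V} (hk : Function.Injective k)
    {A : Set V} (hr : Set.range k = Aᶜ) : Nat.card V = Nat.card V' + A.ncard := by
  have h1 := Set.ncard_add_ncard_compl A
  rw [← hr, ← Set.image_univ, Set.ncard_image_of_injective _ hk, Set.ncard_univ] at h1
  omega

/-- Used for isotopies: `k` renames the crossings, and `s` accounts for renumbered half-edges, which
may exchange the names of the two strands. -/
theorem WinAll.transport {ε : ℕ} {V V' : Type} {G : (V → ZMod 2) → Prop}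
    {G' : (V' → ZMod 2) → Prop} {k : V' → V} (hk : Function.Bijective k) (s : V' → ZMod 2)
    (hG : ∀ o : V → ZMod 2, G' (fun v => o (k v) + s v) → G o) (h : WinAll ε V' G') :
    WinAll ε V G := by
  intro D _ b hb
  rw [← Nat.card_eq_of_bijective k hk] at hb
  refine (h D b hb).sim (k := Sum.map k id) (Sum.map_injective.mpr ⟨hk.1, Function.injective_id⟩)
    (Sum.elim s fun _ => 0) _ (by simp) ?_ ?_
  · intro v hv
    exact absurd (Sum.map_surjective.mpr ⟨hk.2, Function.surjective_id⟩ v) hv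
  · intro o _ h
    exact hG _ h

/-- An irrelevant crossing may be added to the game. -/
theorem WinAll.dummy {ε : ℕ} {V V' : Type} [Finite V] {G : (V → ZMod 2) → Prop}
    {G' : (V' → ZMod 2) → Prop} {k : V' → V} (hk : Function.Injective k) {x : V}
    (hr : Set.range k = {x}ᶜ) (s : V' → ZMod 2)
    (hG : ∀ o : V → ZMod 2, G' (fun v => o (k v) + s v) → G o) (h : WinAll ε V' G') :
    WinAll ε V G := by
  intro D _ b hb
  have hx : ∀ v, k v ≠ x := fun v h => by
    have : k v ∈ ({x}ᶜ : Set V) := hr ▸ ⟨v, rfl⟩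
    exact this h
  have hcard := card_eq_of_range_compl hk hr
  rw [Set.ncard_singleton] at hcard
  -- `x` joins the irrelevant crossings of the smaller game, as the element `none` of `Option D`.
  refine (h (Option D) b ?_).sim
    (k := Sum.elim (fun v => Sum.inl (k v)) (fun d => d.elim (Sum.inl x) Sum.inr)) ?_
    (Sum.elim s fun _ => 0) _ (by simp) ?_ ?_
  · rw [hb, hcard, Finite.card_option]
    ring_nf
  · rintro (v | _ | d) (w | _ | d') h
    all_goals simp_all
    · exact hk h
    · exact (hx w rfl).elim
  · intro v hv
    refine absurd ?_ hv
    rcases v with v | d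
    · by_cases hv : v = x
      · exact ⟨Sum.inr none, by simp [hv]⟩
      · obtain ⟨u, rfl⟩ : v ∈ Set.range k := by rw [hr]; simpa using hv
        exact ⟨Sum.inl u, rfl⟩
    · exact ⟨Sum.inr (some d), rfl⟩
  · intro o _ h
    exact hG _ h

/-- For the player who moves last, a pair of crossings may be added to the game if each move on it
can be answered. -/
theorem WinAll.pair {V V' : Type} [Finite V] {G : (V → ZMod 2) → Prop}
    {G' : (V' → ZMod 2) → Prop} {k : V' → V} (hk : Function.Injective k) {x y : V} (hxy : x ≠ y)
    (hr : Set.range k = {x, y}ᶜ) (s : V' → ZMod 2)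
    (hG : ∀ o : V → ZMod 2, o x ≠ o y → G' (fun v => o (k v) + s v) → G o) (h : WinAll 0 V' G') :
    WinAll 0 V G := by
  intro D _ b hb
  have hcard := card_eq_of_range_compl hk hr
  rw [Set.ncard_pair hxy] at hcard
  have : Finite V' := Finite.of_injective k hk
  have hne : ∀ a : ZMod 2, a ≠ a + 1 := by decide
  refine (h D b ?_).pair (k := Sum.map k id) (x := Sum.inl x) (y := Sum.inl y)
    (Sum.map_injective.mpr ⟨hk, Function.injective_id⟩) (Sum.elim s fun _ => 0) (by simpa using hxy)
    ?_ ?_ ?_ ?_ _ (by simp) rfl rfl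
  · rw [hb, hcard]
    simp only [Nat.odd_iff]; omega
  · ext v
    rcases v with v | d
    · have : v ∈ Set.range k ↔ v ∈ ({x, y}ᶜ : Set V) := by rw [hr]
      simpa using this
    · simp
  · intro a
    refine ⟨a + 1, fun o h1 h2 h => hG _ ?_ h⟩
    simp [h1, h2]
  · intro a
    refine ⟨a + 1, fun o h1 h2 h => hG _ ?_ h⟩
    simp [h1, h2]
  · rw [hb, hcard]
    have : {v : V' ⊕ D | (none : Option (ZMod 2)) = none} = Set.univ := by ext; simp
    rw [this, Set.ncard_univ, Nat.card_sum]
    simp only [Nat.odd_iff]; omega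

/-- An odd number of crossings is won by the player who does not move last if every first move of
the opponent has an answer leading to such a game again. -/
theorem WinAll.answer {V : Type} [Finite V] {G : (V → ZMod 2) → Prop} (hV : Odd (Nat.card V))
    (h : ∀ (x : V) (a : ZMod 2), ∃ (y : V) (c : ZMod 2) (V' : Type) (G' : (V' → ZMod 2) → Prop)
      (k : V' → V) (s : V' → ZMod 2), x ≠ y ∧ Function.Injective k ∧ Set.range k = {x, y}ᶜ ∧
      WinAll 1 V' G' ∧
      ∀ o : V → ZMod 2, o x = a → o y = c → G' (fun v => o (k v) + s v) → G o) :
    WinAll 1 V G := by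
  classical
  -- With an even number of irrelevant crossings the total is odd and the opponent begins. A move in
  -- `V` is answered according to `h`; a move on an irrelevant crossing is answered on another one,
  -- which exists because their number is even.
  have even : ∀ (n : ℕ) (D : Type) [Finite D], Nat.card D = 2 * n →
      Win (V := V ⊕ D) (fun o => G (o ∘ Sum.inl)) false (fun _ => none) := by
    intro n
    induction n using Nat.strong_induction_on with
    | _ n ih =>
      intro D _ hD
      have hne : Nonempty V := by
        by_contra hc
        rw [not_nonempty_iff] at hc
        simp at hV
      refine .opp _ ⟨Sum.inl hne.some, rfl⟩ fun τ hτ => ?_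
      obtain ⟨w, a, hw, rfl⟩ := hτ.eq_update
      rcases w with x | δ
      · obtain ⟨y, c, V', G', k, s, hxy, hk, hr, hW, hG⟩ := h x a
        have hmem : ∀ v, v ∉ Set.range k ↔ v = x ∨ v = y := fun v => by simp [hr]; tauto
        have hkx : ∀ v, k v ≠ x := fun v h => (hmem x).mpr (Or.inl rfl) ⟨v, h⟩
        have hky : ∀ v, k v ≠ y := fun v h => (hmem y).mpr (Or.inr rfl) ⟨v, h⟩
        have hcard := card_eq_of_range_compl hk hr
        rw [Set.ncard_pair hxy] at hcard
        refine .own _ _ (resolves_update (v := Sum.inl y) (by simp [hxy.symm]) c) ?_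
        refine (hW D false ?_).sim (k := Sum.map k id)
          (Sum.map_injective.mpr ⟨hk, Function.injective_id⟩) (Sum.elim s fun _ => 0) _ ?_ ?_ ?_
        · simp only [Bool.false_eq_true, false_iff, Nat.not_odd_iff_even]
          rw [Nat.odd_iff] at hV
          rw [Nat.even_iff]; omega
        · rintro (v | v)
          · simp [hkx, hky]
          · simp
        · rintro (v | v) hv
          · have : v ∉ Set.range k := fun ⟨u, hu⟩ => hv ⟨Sum.inl u, by simp [hu]⟩
            rcases (hmem v).mp this with rfl | rfl <;> simp [hxy]
          · exact absurd ⟨Sum.inr v, rfl⟩ hv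
        · intro o ho h'
          have e₁ := ho (Sum.inl x) (by
            rintro ⟨v | v, hv⟩ <;> simp at hv
            exact hkx v hv)
          have e₂ := ho (Sum.inl y) (by
            rintro ⟨v | v, hv⟩ <;> simp at hv
            exact hky v hv)
          simp [hxy] at e₁ e₂
          exact hG _ e₁.symm e₂.symm h'
      · obtain ⟨δ', hδ'⟩ : ∃ δ', δ' ≠ δ := by
          by_contra hc
          push Not at hc
          have : Subsingleton D := ⟨fun a b => by rw [hc a, hc b]⟩
          have := Finite.card_le_one_iff_subsingleton.mpr this
          have hpos : 0 < Nat.card D := Nat.card_pos_iff.mpr ⟨⟨δ⟩, inferInstance⟩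
          omega
        have hpos : 0 < Nat.card D := Nat.card_pos_iff.mpr ⟨⟨δ⟩, inferInstance⟩
        refine .own _ _ (resolves_update (v := Sum.inr δ') (by simp [hδ']) 0) ?_
        have hinj : Function.Injective (Subtype.val : {d : D // d ≠ δ ∧ d ≠ δ'} → D) :=
          Subtype.val_injective
        have hrange : Set.range (Subtype.val : {d : D // d ≠ δ ∧ d ≠ δ'} → D) = {δ, δ'}ᶜ := by
          ext; simp
        have hcard := card_eq_of_range_compl hinj hrange
        rw [Set.ncard_pair hδ'.symm] at hcard
        refine (ih (n - 1) (by omega) {d : D // d ≠ δ ∧ d ≠ δ'} (by omega)).sim (k := Sum.map id Subtype.val)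
          (Sum.map_injective.mpr ⟨Function.injective_id, hinj⟩) (fun _ => 0) _ ?_ ?_ ?_
        · rintro (v | v)
          · simp
          · simp [v.2.1, v.2.2]
        · rintro (v | v) hv
          · exact absurd ⟨Sum.inl v, rfl⟩ hv
          · by_cases h1 : v = δ'
            · simp [h1]
            · by_cases h2 : v = δ
              · simp [h2, hδ'.symm]
              · exact absurd ⟨Sum.inr ⟨v, h2, h1⟩, rfl⟩ hv
        · intro o _ h'
          convert h' using 1
          funext v
          simp
  intro D _ b hb
  rcases Nat.even_or_odd (Nat.card D) with hD | hD
  · obtain rfl : b = false := by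
      rw [← Bool.not_eq_true, hb, Nat.not_odd_iff_even]
      rw [Nat.odd_iff] at hV; rw [Nat.even_iff] at *; omega
    obtain ⟨n, hn⟩ := hD
    exact even n D (by omega)
  · obtain rfl : b = true := by
      rw [hb]
      simp only [Nat.odd_iff] at *; omega
    have hne : Nonempty D := by
      by_contra hc
      rw [not_nonempty_iff] at hc
      simp at hD
    obtain ⟨δ⟩ := hne
    -- With an odd number of irrelevant crossings the player passes on one of them and reaches the
    -- even case.
    refine .own _ _ (resolves_update (v := Sum.inr δ) rfl 0) ?_
    have hinj : Function.Injective (Subtype.val : {d : D // d ≠ δ} → D) := Subtype.val_injective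
    have hrange : Set.range (Subtype.val : {d : D // d ≠ δ} → D) = {δ}ᶜ := by ext; simp
    have hcard := card_eq_of_range_compl hinj hrange
    rw [Set.ncard_singleton] at hcard
    obtain ⟨n, hn⟩ := hD
    refine (even n {d : D // d ≠ δ} (by omega)).sim (k := Sum.map id Subtype.val)
      (Sum.map_injective.mpr ⟨Function.injective_id, hinj⟩) (fun _ => 0) _ ?_ ?_ ?_
    · rintro (v | v)
      · simp
      · simp [v.2]
    · rintro (v | v) hv
      · exact absurd ⟨Sum.inl v, rfl⟩ hv
      · by_cases h2 : v = δ
        · simp [h2]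
        · exact absurd ⟨Sum.inr ⟨v, h2⟩, rfl⟩ hv
    · intro o _ h'
      convert h' using 1
      funext v
      simp

end ResolvingGame

/-! ### From the abstract game to strategies on shadows -/

namespace Shadow

open ResolvingGame

theorem CanWin.of_win {S : Shadow} {p : Player} {b : Bool} {σ : S.Position}
    (h : Win (fun o => p.WonBy ⟨S, o⟩) b σ) : CanWin p (if b then p else p.other) σ := by
  induction h with
  | done b σ o ho hG => exact .finished _ σ o ho hG
  | own σ τ h _ ih => exact .ownMove σ τ h ih
  | opp σ hσ _ ih => exact .otherMove σ hσ ih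

end Shadow

/-! Removing crossings from shadows and tangle shadows. -/

namespace Shadow

/-- `S'` is, up to isotopy, `S` with the crossings in `A` removed. -/
structure Erasure (S : Shadow) (A : Set S.V) (S' : Shadow) where
  /-- the crossings that are kept -/
  k : S'.V → S.V
  /-- the edge that an edge becomes part of -/
  g : S.E → S'.E
  /-- the rotation of the numbering at each crossing -/
  r : S'.V → ZMod 4
  k_injective : Function.Injective k
  range_k : Set.range k = Aᶜ
  g_surjective : Function.Surjective g
  g_eq_of_opposite : ∀ x y, S.Opposite A x y → g x = g y
  eqvGen_of_g_eq : ∀ x y, g x = g y → Relation.EqvGen (S.Opposite A) x y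
  att_eq : ∀ v i, g (S.att (k v) i) = S'.att v (i + r v)

/-- The shadow reflected in the plane. -/
def mirror (S : Shadow) : Shadow where
  V := S.V
  E := S.E
  att v i := S.att v (-i)

theorem mirror_mirror (S : Shadow) : S.mirror.mirror = S := by
  simp [mirror]

theorem opposite_mono {S : Shadow} {A B : Set S.V} (h : A ⊆ B) {x y : S.E}
    (hxy : S.Opposite A x y) : S.Opposite B x y := by
  obtain ⟨v, hv, i, h1, h2⟩ := hxy
  exact ⟨v, h hv, i, h1, h2⟩

theorem eq_of_eqvGen_opposite_empty {S : Shadow} {x y : S.E}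
    (h : Relation.EqvGen (S.Opposite ∅) x y) : x = y := by
  induction h with
  | rel x y h => obtain ⟨v, hv, _⟩ := h; exact hv.elim
  | refl x => rfl
  | symm x y _ ih => exact ih.symm
  | trans x y z _ _ ih1 ih2 => exact ih1.trans ih2

theorem opposite_mirror {S : Shadow} {A : Set S.V} {x y : S.E} :
    S.mirror.Opposite A x y ↔ S.Opposite A x y := by
  have h2 : (-2 : ZMod 4) = 2 := by decide
  constructor
  · rintro ⟨v, hv, i, h1, h3⟩
    refine ⟨v, hv, -i, h1, ?_⟩
    rw [h3]
    simp only [mirror, neg_add, h2]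
  · rintro ⟨v, hv, i, h1, h3⟩
    refine ⟨v, hv, -i, ?_, ?_⟩
    · simp only [mirror, neg_neg, h1]
    · simp only [mirror, neg_add, h2, neg_neg, h3]

namespace Erasure

variable {S S' S'' : Shadow} {A : Set S.V} {B : Set S'.V}

theorem k_notMem (e : Erasure S A S') (v : S'.V) : e.k v ∉ A := by
  have : e.k v ∈ Aᶜ := e.range_k ▸ ⟨v, rfl⟩
  exact this

/-- Removing no crossing changes nothing. -/
def refl (S : Shadow) : Erasure S ∅ S where
  k := id
  g := id
  r _ := 0
  k_injective := Function.injective_id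
  range_k := by simp
  g_surjective := Function.surjective_id
  g_eq_of_opposite := by rintro x y ⟨v, hv, _⟩; exact hv.elim
  eqvGen_of_g_eq := by rintro x y h; obtain rfl : x = y := h; exact .refl _
  att_eq := by simp

/-- A removal described by a choice of an edge in each class. -/
def ofSection (k : S'.V → S.V) (g : S.E → S'.E) (r : S'.V → ZMod 4) (f : S'.E → S.E)
    (hk : Function.Injective k) (hr : ∀ v, v ∈ Set.range k ↔ v ∉ A) (hf : ∀ y, g (f y) = y)
    (hg : ∀ v ∈ A, ∀ i, g (S.att v i) = g (S.att v (i + 2)))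
    (hfg : ∀ x, Relation.EqvGen (S.Opposite A) x (f (g x)))
    (hatt : ∀ v i, g (S.att (k v) i) = S'.att v (i + r v)) : Erasure S A S' where
  k := k
  g := g
  r := r
  k_injective := hk
  range_k := Set.ext hr
  g_surjective y := ⟨f y, hf y⟩
  g_eq_of_opposite := by
    rintro x y ⟨v, hv, i, rfl, rfl⟩
    exact hg v hv i
  eqvGen_of_g_eq x y h := .trans _ _ _ (hfg x) (h ▸ .symm _ _ (hfg y))
  att_eq := hatt

/-- An isotopy as the removal of no crossing. -/
def ofEquiv (k : S'.V ≃ S.V) (g : S.E ≃ S'.E) (r : S'.V → ZMod 4)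
    (hatt : ∀ v i, g (S.att (k v) i) = S'.att v (i + r v)) : Erasure S ∅ S' :=
  ofSection k g r g.symm k.injective (fun v => by simp) (by simp)
    (fun v hv => hv.elim) (fun x => by rw [g.symm_apply_apply]; exact .refl _) hatt

/-- The composition of two removals. -/
def comp (e : Erasure S A S') (e' : Erasure S' B S'') (C : Set S.V) (hC : C = A ∪ e.k '' B) :
    Erasure S C S'' where
  k := e.k ∘ e'.k
  g := e'.g ∘ e.g
  r v := e.r (e'.k v) + e'.r v
  k_injective := e.k_injective.comp e'.k_injective
  range_k := by
    rw [Set.range_comp, e'.range_k, hC, Set.compl_union, ← e.range_k]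
    ext v
    constructor
    · rintro ⟨u, hu, rfl⟩
      refine ⟨⟨u, rfl⟩, ?_⟩
      rintro ⟨w, hw, h⟩
      exact hu (e.k_injective h ▸ hw)
    · rintro ⟨⟨u, rfl⟩, hu⟩
      exact ⟨u, fun h => hu ⟨u, h, rfl⟩, rfl⟩
  g_surjective := e'.g_surjective.comp e.g_surjective
  g_eq_of_opposite := by
    subst hC
    rintro x y ⟨v, hv | ⟨u, hu, rfl⟩, i, rfl, rfl⟩
    · simp only [Function.comp]
      rw [e.g_eq_of_opposite _ _ ⟨v, hv, i, rfl, rfl⟩]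
    · simp only [Function.comp, e.att_eq]
      refine e'.g_eq_of_opposite _ _ ⟨u, hu, i + e.r u, rfl, ?_⟩
      congr 1; ring
  eqvGen_of_g_eq := by
    subst hC
    intro x y h
    have lift : ∀ x y, e.g x = e.g y → Relation.EqvGen (S.Opposite (A ∪ e.k '' B)) x y :=
      fun x y h => (e.eqvGen_of_g_eq x y h).mono fun _ _ h =>
        opposite_mono Set.subset_union_left h
    -- An identification made by the second removal comes from opposite edges of `S` at a crossing
    -- in `e.k '' B`, up to identifications made by the first removal.
    have key : ∀ u v, Relation.EqvGen (S'.Opposite B) u v → ∀ x y, e.g x = u → e.g y = v →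
        Relation.EqvGen (S.Opposite (A ∪ e.k '' B)) x y := by
      intro u v huv
      induction huv with
      | rel u v h =>
        intro x y hx hy
        obtain ⟨w, hw, i, rfl, rfl⟩ := h
        have h1 := e.att_eq w (i - e.r w)
        have h2 := e.att_eq w (i - e.r w + 2)
        rw [sub_add_cancel] at h1
        rw [show i - e.r w + 2 + e.r w = i + 2 by ring] at h2
        refine .trans _ _ _ (lift _ _ (hx.trans h1.symm)) (.trans _ _ _ (.rel _ _ ?_)
          (lift _ _ (h2.trans hy.symm)))
        exact ⟨_, Or.inr ⟨w, hw, rfl⟩, _, rfl, rfl⟩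
      | refl u => exact fun x y hx hy => lift _ _ (hx.trans hy.symm)
      | symm u v _ ih => exact fun x y hx hy => .symm _ _ (ih y x hy hx)
      | trans u v w _ _ ih1 ih2 =>
        intro x y hx hy
        obtain ⟨z, hz⟩ := e.g_surjective v
        exact .trans _ _ _ (ih1 x z hx hz) (ih2 z y hz hy)
    exact key _ _ (e'.eqvGen_of_g_eq _ _ h) x y rfl rfl
  att_eq v i := by
    simp only [Function.comp, e.att_eq, e'.att_eq, add_assoc]

/-- Following a removal by an isotopy. -/
def trans (e : Erasure S A S') (e' : Erasure S' ∅ S'') : Erasure S A S'' :=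
  e.comp e' A (by simp)

/-- Reflecting a removal in the plane. -/
def mirror (e : Erasure S A S') : Erasure S.mirror A S'.mirror where
  k := e.k
  g := e.g
  r v := -e.r v
  k_injective := e.k_injective
  range_k := e.range_k
  g_surjective := e.g_surjective
  g_eq_of_opposite x y h := e.g_eq_of_opposite x y (opposite_mirror.mp h)
  eqvGen_of_g_eq x y h :=
    (e.eqvGen_of_g_eq x y h).mono fun _ _ h => opposite_mirror.mpr h
  att_eq v i := by
    refine (e.att_eq v (-i)).trans ?_
    simp only [Shadow.mirror]
    congr 1; ring

/-- Going straight through a kept crossing remains such a step, and at a removed crossing the two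
opposite edges have become one. -/
theorem singleComponent (e : Erasure S A S') (h : S.SingleComponent) : S'.SingleComponent := by
  obtain ⟨⟨x₀⟩, h⟩ := h
  refine ⟨⟨e.g x₀⟩, fun x y => ?_⟩
  obtain ⟨x, rfl⟩ := e.g_surjective x
  obtain ⟨y, rfl⟩ := e.g_surjective y
  induction h x y with
  | rel x y h =>
    obtain ⟨v, -, i, rfl, rfl⟩ := h
    by_cases hv : v ∈ A
    · rw [e.g_eq_of_opposite _ _ ⟨v, hv, i, rfl, rfl⟩]
      exact .refl _
    · obtain ⟨u, rfl⟩ : v ∈ Set.range e.k := by rw [e.range_k]; exact hv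
      refine .rel _ _ ⟨u, Set.mem_univ _, i + e.r u, e.att_eq u i, ?_⟩
      rw [e.att_eq]; congr 1; ring
  | refl x => exact .refl _
  | symm x y _ ih => exact .symm _ _ ih
  | trans x y z _ _ ih1 ih2 => exact .trans _ _ _ ih1 ih2

/-- The diagram obtained by removing crossings. -/
def diagram (e : Erasure S A S') (o : S.V → ZMod 2) : Diagram :=
  ⟨S', fun v => o (e.k v) + strand (e.r v)⟩

/-- The kept crossings. -/
noncomputable def equivKept (e : Erasure S A S') : {v : S.V // v ∉ A} ≃ S'.V :=
  ((Equiv.ofInjective e.k e.k_injective).trans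
    (Equiv.setCongr e.range_k)).symm

theorem k_equivKept (e : Erasure S A S') (v : {v : S.V // v ∉ A}) : e.k (e.equivKept v) = v := by
  obtain ⟨u, rfl⟩ := e.equivKept.symm.surjective v
  rw [Equiv.apply_symm_apply]
  rfl

/-- Reidemeister moves are stated with the literal `erase`; this allows any convenient model of the
result in their place. -/
theorem erase_diagram_iso (e : Erasure S A S') (o : S.V → ZMod 2) :
    (Diagram.erase ⟨S, o⟩ A).Iso (e.diagram o) := by
  have hg : ∀ x y, S.Opposite A x y → e.g x = e.g y := e.g_eq_of_opposite
  let g : Quot (S.Opposite A) → S'.E := Quot.lift e.g hg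
  have hbij : Function.Bijective g := by
    constructor
    · rintro ⟨x⟩ ⟨y⟩ h
      exact Quot.eqvGen_sound (e.eqvGen_of_g_eq x y h)
    · intro y
      obtain ⟨x, rfl⟩ := e.g_surjective y
      exact ⟨Quot.mk _ x, rfl⟩
  refine ⟨e.equivKept, Equiv.ofBijective g hbij, fun v => e.r (e.equivKept v), ?_, ?_⟩
  · intro v i
    have h := e.att_eq (e.equivKept v) i
    rw [show e.k (e.equivKept v) = v.1 from e.k_equivKept v] at h
    exact h.symm
  · intro v
    exact congrArg (fun u => o u + strand (e.r (e.equivKept v))) (e.k_equivKept v)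

theorem erase_iso (e : Erasure S A S') : (S.erase A).Iso S' := by
  obtain ⟨f, g, r, h, -⟩ := e.erase_diagram_iso fun _ => 0
  exact ⟨f, g, r, h⟩

theorem iso (e : Erasure S ∅ S') : S.Iso S' := by
  have hk : Function.Bijective e.k :=
    ⟨e.k_injective, Set.range_eq_univ.mp (by rw [e.range_k, Set.compl_empty])⟩
  have hg : Function.Bijective e.g := by
    exact ⟨fun x y h => eq_of_eqvGen_opposite_empty (e.eqvGen_of_g_eq x y h), e.g_surjective⟩
  let f := Equiv.ofBijective e.k hk
  refine ⟨f.symm, Equiv.ofBijective e.g hg, fun v => e.r (f.symm v), fun v i => ?_⟩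
  have h := e.att_eq (f.symm v) i
  rw [show e.k (f.symm v) = v from f.apply_symm_apply v] at h
  exact h.symm

/-- An isotopy as the removal of no crossing. -/
theorem nonempty_of_iso (h : S.Iso S') : Nonempty (Erasure S ∅ S') := by
  obtain ⟨f, g, r, h⟩ := h
  exact ⟨ofEquiv f.symm g (fun v => r (f.symm v)) fun v i => by rw [← h, f.apply_symm_apply]⟩

end Erasure

end Shadow

/-! Removing crossings from tangle shadows. -/

namespace TangleShadow

/-- The crossings and edges of a tangle. -/
abbrev toShadow (t : TangleShadow) : Shadow := ⟨t.V, t.E, t.att⟩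

/-- `t'` is, up to isotopy, `t` with the crossings in `A` removed. -/
structure Erasure (t : TangleShadow) (A : Set t.V) (t' : TangleShadow) extends
    Shadow.Erasure t.toShadow A t'.toShadow where
  g_nw : g t.nw = t'.nw
  g_ne : g t.ne = t'.ne
  g_sw : g t.sw = t'.sw
  g_se : g t.se = t'.se

theorem reflect_reflect (t : TangleShadow) : t.reflect.reflect = t := by
  simp [reflect]

/-- The added crossing is kept, so no identification involves the new edges. -/
theorem opposite_twist {t : TangleShadow} {A : Set t.V} {x y : t.twist.E} :
    t.twist.toShadow.Opposite (some '' A) x y ↔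
      ∃ x' y', x = Sum.inl x' ∧ y = Sum.inl y' ∧ t.toShadow.Opposite A x' y' := by
  constructor
  · rintro ⟨_, ⟨v, hv, rfl⟩, i, rfl, rfl⟩
    exact ⟨_, _, rfl, rfl, v, hv, i, rfl, rfl⟩
  · rintro ⟨_, _, rfl, rfl, v, hv, i, rfl, rfl⟩
    exact ⟨some v, ⟨v, hv, rfl⟩, i, rfl, rfl⟩

namespace Erasure

variable {t t' t'' : TangleShadow} {A : Set t.V}

/-- Reflecting a removal. -/
def reflect (e : Erasure t A t') : Erasure t.reflect A t'.reflect where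
  toErasure := e.toErasure.mirror
  g_nw := e.g_nw
  g_ne := e.g_sw
  g_sw := e.g_ne
  g_se := e.g_se

/-- Adding a crossing to the right before removing crossings. -/
def twist (e : Erasure t A t') : Erasure t.twist (some '' A) t'.twist where
  k := Option.map e.k
  g := Sum.map e.g id
  r v := v.elim 0 e.r
  k_injective := Option.map_injective e.k_injective
  range_k := by
    ext v
    rcases v with _ | v
    · exact ⟨fun _ ⟨_, _, h⟩ => (by cases h), fun _ => ⟨none, rfl⟩⟩
    · constructor
      · rintro ⟨_ | u, hu⟩
        · cases hu
        · rintro ⟨w, hw, hwv⟩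
          cases hwv
          exact e.k_notMem u (Option.some.inj hu ▸ hw)
      · intro hv
        obtain ⟨u, hu⟩ : v ∈ Set.range e.k := by
          rw [e.range_k]; exact fun hc => hv ⟨v, hc, rfl⟩
        exact ⟨some u, congrArg some hu⟩
  g_surjective := Sum.map_surjective.mpr ⟨e.g_surjective, Function.surjective_id⟩
  g_eq_of_opposite := by
    intro x y h
    obtain ⟨x', y', rfl, rfl, h'⟩ := opposite_twist.mp h
    exact congrArg Sum.inl (e.g_eq_of_opposite _ _ h')
  eqvGen_of_g_eq := by
    rintro (x | x) (y | y) h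
    · have key := e.eqvGen_of_g_eq x y (Sum.inl_injective h)
      clear h
      induction key with
      | rel x y h => exact .rel _ _ (opposite_twist.mpr ⟨_, _, rfl, rfl, h⟩)
      | refl x => exact .refl _
      | symm x y _ ih => exact .symm _ _ ih
      | trans x y z _ _ ih1 ih2 => exact .trans _ _ _ ih1 ih2
    · cases h
    · cases h
    · cases h; exact .refl _
  att_eq := by
    rintro (_ | v) i
    · change Sum.map e.g id (t.twist.att none i) = t'.twist.att none (i + 0)
      rw [add_zero]
      simp only [TangleShadow.twist]
      split_ifs
      · rfl
      · exact congrArg Sum.inl e.g_ne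
      · exact congrArg Sum.inl e.g_se
      · rfl
    · exact congrArg Sum.inl (e.att_eq v i)
  g_nw := congrArg Sum.inl e.g_nw
  g_ne := rfl
  g_sw := congrArg Sum.inl e.g_sw
  g_se := rfl

/-- Closing a tangle after removing crossings. -/
def close (e : Erasure t A t') : Shadow.Erasure t.close A t'.close where
  k := e.k
  g := Quot.map e.g (by
    rintro x y (⟨rfl, rfl⟩ | ⟨rfl, rfl⟩)
    · exact Or.inl ⟨e.g_nw, e.g_ne⟩
    · exact Or.inr ⟨e.g_sw, e.g_se⟩)
  r := e.r
  k_injective := e.k_injective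
  range_k := e.range_k
  g_surjective := by
    rintro ⟨y⟩
    obtain ⟨x, rfl⟩ := e.g_surjective y
    exact ⟨Quot.mk _ x, rfl⟩
  g_eq_of_opposite := by
    rintro _ _ ⟨v, hv, i, rfl, rfl⟩
    exact congrArg (Quot.mk _) (e.g_eq_of_opposite _ _ ⟨v, hv, i, rfl, rfl⟩)
  eqvGen_of_g_eq := by
    have lift : ∀ x y, e.g x = e.g y →
        Relation.EqvGen (t.close.Opposite A) (Quot.mk _ x) (Quot.mk _ y) := by
      intro x y h
      have := e.eqvGen_of_g_eq x y h
      clear h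
      induction this with
      | rel x y h =>
        obtain ⟨v, hv, i, rfl, rfl⟩ := h
        exact .rel _ _ ⟨v, hv, i, rfl, rfl⟩
      | refl x => exact .refl _
      | symm x y _ ih => exact .symm _ _ ih
      | trans x y z _ _ ih1 ih2 => exact .trans _ _ _ ih1 ih2
    have key : ∀ u v, Relation.EqvGen t'.Joined u v → ∀ x y, e.g x = u → e.g y = v →
        Relation.EqvGen (t.close.Opposite A) (Quot.mk _ x) (Quot.mk _ y) := by
      intro u v huv
      induction huv with
      | rel u v h =>
        intro x y hx hy
        rcases h with ⟨rfl, rfl⟩ | ⟨rfl, rfl⟩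
        · refine .trans _ _ _ (lift _ _ (hx.trans e.g_nw.symm)) ?_
          rw [show (Quot.mk t.Joined t.nw) = Quot.mk _ t.ne from
            Quot.sound (Or.inl ⟨rfl, rfl⟩)]
          exact lift _ _ (e.g_ne.trans hy.symm)
        · refine .trans _ _ _ (lift _ _ (hx.trans e.g_sw.symm)) ?_
          rw [show (Quot.mk t.Joined t.sw) = Quot.mk _ t.se from
            Quot.sound (Or.inr ⟨rfl, rfl⟩)]
          exact lift _ _ (e.g_se.trans hy.symm)
      | refl u => exact fun x y hx hy => lift _ _ (hx.trans hy.symm)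
      | symm u v _ ih => exact fun x y hx hy => .symm _ _ (ih y x hy hx)
      | trans u v w _ _ ih1 ih2 =>
        intro x y hx hy
        obtain ⟨z, hz⟩ := e.g_surjective v
        exact .trans _ _ _ (ih1 x z hx hz) (ih2 z y hz hy)
    rintro ⟨x⟩ ⟨y⟩ h
    exact key _ _ (Quot.eqvGen_exact h) x y rfl rfl
  att_eq v i := congrArg (Quot.mk _) (e.att_eq v i)

end Erasure

/-- The tangle closed up by one more crossing, `none`. -/
abbrev cap (t : TangleShadow) : Shadow where
  V := Option t.V
  E := t.E
  att
    | some v, i => t.att v i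
    | none, i => if i = 0 then t.nw else if i = 1 then t.ne else if i = 2 then t.se else t.sw

/-- Exchanging the north-east and south-west ends reverses the cyclic order at the capping crossing.
Thus capping, unlike closing, is compatible with reflection, which makes induction on the operations
possible. -/
theorem cap_reflect (t : TangleShadow) : t.reflect.cap = t.cap.mirror := by
  simp only [cap, reflect, Shadow.mirror, Shadow.mk.injEq, heq_eq_eq, true_and]
  funext v i
  rcases v with _ | v
  · have h : i = 0 ∨ i = 1 ∨ i = 2 ∨ i = 3 := by revert i; decide
    rcases h with rfl | rfl | rfl | rfl <;> rfl
  · rfl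

theorem range_some_some {V : Type} (v : Option (Option V)) :
    v ∈ Set.range (fun v => some (some v)) ↔ v ∉ ({none, some none} : Set (Option (Option V))) := by
  rcases v with _ | _ | v <;> simp

theorem range_some_iff {V : Type} (v : Option V) :
    v ∈ Set.range some ↔ v ∉ ({none} : Set (Option V)) := by
  rcases v with _ | v <;> simp

/-- Reduces statements about the half-edges at a crossing to four cases that mostly hold by
evaluation. -/
theorem forall_zmod_four {P : ZMod 4 → Prop} (h0 : P 0) (h1 : P 1) (h2 : P 2) (h3 : P 3)
    (i : ZMod 4) : P i := by
  have h : i = 0 ∨ i = 1 ∨ i = 2 ∨ i = 3 := by revert i; decide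
  rcases h with rfl | rfl | rfl | rfl <;> assumption

/-- Closing a tangle after adding a crossing to the right. -/
def closeTwist (t : TangleShadow) : Shadow.Erasure t.twist.close ∅ t.cap :=
  .ofSection id
    (Quot.lift (Sum.elim id fun b => if b then t.nw else t.sw) (by
      rintro x y (⟨rfl, rfl⟩ | ⟨rfl, rfl⟩) <;> rfl))
    (fun _ => 0) (fun x => Quot.mk _ (Sum.inl x)) Function.injective_id
    (fun v => ⟨fun _ h => h, fun _ => ⟨v, rfl⟩⟩) (fun _ => rfl) (fun _ h => h.elim)
    (by
      have h1 : Quot.mk t.twist.Joined (Sum.inl t.nw) = Quot.mk _ (Sum.inr true) :=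
        Quot.sound (Or.inl ⟨rfl, rfl⟩)
      have h2 : Quot.mk t.twist.Joined (Sum.inl t.sw) = Quot.mk _ (Sum.inr false) :=
        Quot.sound (Or.inr ⟨rfl, rfl⟩)
      rintro ⟨x | _ | _⟩
      · exact .refl _
      · exact h2 ▸ .refl _
      · exact h1 ▸ .refl _)
    (by
      rintro (_ | v) i
      · revert i; exact forall_zmod_four rfl rfl rfl rfl
      · exact congrArg (t.att v) (add_zero i).symm)

/-- A crossing on the right hand arc of the starting tangle is a loop, which may be removed. -/
def curlBase : Erasure base.twist {none} base where
  toErasure := .ofSection (fun v => v.elim) (Sum.elim id fun _ => true) (fun _ => 0) Sum.inl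
    (fun v => v.elim)
    (fun v => match v with
      | none => ⟨fun ⟨v, _⟩ => v.elim, fun h => (h rfl).elim⟩
      | some v => v.elim)
    (fun _ => rfl)
    (by
      rintro v rfl
      exact forall_zmod_four rfl rfl rfl rfl)
    (fun x => match x with
      | Sum.inl _ => .refl _
      | Sum.inr false => .rel _ _ ⟨none, rfl, 3, rfl, rfl⟩
      | Sum.inr true => .rel _ _ ⟨none, rfl, 0, rfl, rfl⟩)
    (fun v => v.elim)
  g_nw := rfl
  g_ne := rfl
  g_sw := rfl
  g_se := rfl

/-- Two consecutive crossings may be removed. -/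
def untwistTwice (t : TangleShadow) : Erasure t.twist.twist {none, some none} t where
  toErasure := .ofSection (fun v => some (some v))
    -- One crossing exchanges the two right-hand strands, the second exchanges them back.
    (Sum.elim (Sum.elim id fun b => if b then t.se else t.ne) fun b => if b then t.ne else t.se)
    (fun _ => 0) (fun x => Sum.inl (Sum.inl x))
    (fun _ _ h => Option.some.inj (Option.some.inj h)) range_some_some (fun _ => rfl)
    (by rintro v (rfl | rfl) <;> exact forall_zmod_four rfl rfl rfl rfl)
    (fun x => match x with
      | Sum.inl (Sum.inl _) => .refl _
      | Sum.inl (Sum.inr false) => .rel _ _ ⟨some none, Or.inr rfl, 3, rfl, rfl⟩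
      | Sum.inl (Sum.inr true) => .rel _ _ ⟨some none, Or.inr rfl, 0, rfl, rfl⟩
      | Sum.inr false => .trans _ (Sum.inl (Sum.inr true)) _
          (.rel _ _ ⟨none, Or.inl rfl, 3, rfl, rfl⟩)
          (.rel _ _ ⟨some none, Or.inr rfl, 0, rfl, rfl⟩)
      | Sum.inr true => .trans _ (Sum.inl (Sum.inr false)) _
          (.rel _ _ ⟨none, Or.inl rfl, 0, rfl, rfl⟩)
          (.rel _ _ ⟨some none, Or.inr rfl, 3, rfl, rfl⟩))
    (fun v i => congrArg (t.att v) (add_zero i).symm)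
  g_nw := rfl
  g_ne := rfl
  g_sw := rfl
  g_se := rfl

/-- A tangle consisting of a single crossing is symmetric. -/
def reflectCrossing : Erasure base.reflect.twist.reflect ∅ base.reflect.twist where
  toErasure := .ofEquiv (Equiv.refl (Option Empty))
    -- The reflection amounts to a half turn of the crossing, in which the edges at its north-east
    -- and south-west half-edges trade places.
    (Equiv.swap (Sum.inl true) (Sum.inr true) : Bool ⊕ Bool ≃ Bool ⊕ Bool) (fun _ => 2)
    (fun v => match v with
      | none => forall_zmod_four rfl rfl rfl rfl
      | some v => v.elim)
  g_nw := rfl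
  g_ne := rfl
  g_sw := rfl
  g_se := rfl

/-- The tangle with the two ends on the right exchanged. -/
abbrev swapRight (t : TangleShadow) : TangleShadow := { t with ne := t.se, se := t.ne }

/-- Removing the last crossing exchanges the ends on the right. -/
def untwist (t : TangleShadow) : Erasure t.twist {none} t.swapRight where
  toErasure := .ofSection some (Sum.elim id fun b => if b then t.se else t.ne) (fun _ => 0)
    Sum.inl (Option.some_injective _) range_some_iff (fun _ => rfl)
    (by rintro v rfl; exact forall_zmod_four rfl rfl rfl rfl)
    (fun x => match x with
      | Sum.inl _ => .refl _
      | Sum.inr false => .rel _ _ ⟨none, rfl, 3, rfl, rfl⟩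
      | Sum.inr true => .rel _ _ ⟨none, rfl, 0, rfl, rfl⟩)
    (fun v i => congrArg (t.att v) (add_zero i).symm)
  g_nw := rfl
  g_ne := rfl
  g_sw := rfl
  g_se := rfl

/-- Exchanging two ends that are going to be connected does not matter. -/
def closeSwapRight (t : TangleShadow) :
    Shadow.Erasure t.swapRight.reflect.close ∅ t.reflect.close :=
  .ofSection id
    (Quot.lift (Quot.mk t.reflect.Joined) (by
      rintro x y (⟨rfl, rfl⟩ | ⟨rfl, rfl⟩)
      · exact Quot.sound (Or.inl ⟨rfl, rfl⟩)
      · exact (Quot.sound (r := t.reflect.Joined) (Or.inr ⟨rfl, rfl⟩)).symm))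
    (fun _ => 0)
    (Quot.lift (Quot.mk t.swapRight.reflect.Joined) (by
      rintro x y (⟨rfl, rfl⟩ | ⟨rfl, rfl⟩)
      · exact Quot.sound (Or.inl ⟨rfl, rfl⟩)
      · exact (Quot.sound (r := t.swapRight.reflect.Joined) (Or.inr ⟨rfl, rfl⟩)).symm))
    Function.injective_id (fun v => ⟨fun _ h => h, fun _ => ⟨v, rfl⟩⟩)
    (by rintro ⟨x⟩; rfl) (fun _ h => h.elim) (by rintro ⟨x⟩; exact .refl _)
    (fun v i => congrArg (fun i => Quot.mk _ (t.att v (-i))) (add_zero i).symm)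

/-- In the closure of a reflected tangle the last crossing can be removed. -/
def closeReflectTwist (t : TangleShadow) :
    Shadow.Erasure t.twist.reflect.close {none} t.reflect.close :=
  t.untwist.reflect.close.trans t.closeSwapRight

theorem isLoop_closeReflectTwist (t : TangleShadow) : t.twist.reflect.close.IsLoop none :=
  ⟨0, (Quot.sound (Or.inr ⟨rfl, rfl⟩) : Quot.mk t.twist.reflect.Joined (Sum.inr true) =
    Quot.mk _ (Sum.inr false))⟩

/-- The last crossing can be cancelled with the capping crossing. -/
def capTwistTwice (t : TangleShadow) :
    Shadow.Erasure t.twist.twist.cap {none, some none} t.cap :=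
  -- The capping crossing and the last twist disappear; the twist before them takes over as capping
  -- crossing.
  .ofSection (fun v => some (some v))
    (Sum.elim (Sum.elim id fun b => if b then t.nw else t.sw) fun b => if b then t.sw else t.nw)
    (fun _ => 0) (fun x => Sum.inl (Sum.inl x))
    (fun _ _ h => Option.some.inj (Option.some.inj h)) range_some_some (fun _ => rfl)
    (by rintro v (rfl | rfl) <;> exact forall_zmod_four rfl rfl rfl rfl)
    (fun x => match x with
      | Sum.inl (Sum.inl _) => .refl _
      | Sum.inl (Sum.inr false) => .trans _ (Sum.inr true) _
          (.rel _ _ ⟨some none, Or.inr rfl, 2, rfl, rfl⟩)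
          (.rel _ _ ⟨none, Or.inl rfl, 1, rfl, rfl⟩)
      | Sum.inl (Sum.inr true) => .trans _ (Sum.inr false) _
          (.rel _ _ ⟨some none, Or.inr rfl, 1, rfl, rfl⟩)
          (.rel _ _ ⟨none, Or.inl rfl, 2, rfl, rfl⟩)
      | Sum.inr false => .rel _ _ ⟨none, Or.inl rfl, 2, rfl, rfl⟩
      | Sum.inr true => .rel _ _ ⟨none, Or.inl rfl, 1, rfl, rfl⟩)
    (fun v => match v with
      | none => forall_zmod_four rfl rfl rfl rfl
      | some v => fun i => congrArg (t.att v) (add_zero i).symm)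

end TangleShadow

/-! Codes of rational shadows are planar and well-formed. -/

/-- Exactly two elements are mapped to `x`. -/
def TwoEnds {D E : Type} (e : D → E) (x : E) : Prop :=
  ∃ a b, a ≠ b ∧ e a = x ∧ e b = x ∧ ∀ c, e c = x → c = a ∨ c = b

theorem card_fiber_eq_two {D E : Type} {e : D → E} {x : E} :
    Nat.card {d // e d = x} = 2 ↔ TwoEnds e x := by
  rw [Nat.card_eq_two_iff]
  constructor
  · rintro ⟨⟨a, ha⟩, ⟨b, hb⟩, hab, h⟩
    refine ⟨a, b, fun h => hab (Subtype.ext h), ha, hb, fun c hc => ?_⟩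
    have : (⟨c, hc⟩ : {d // e d = x}) ∈ (Set.univ : Set {d // e d = x}) := Set.mem_univ _
    rw [← h] at this
    simpa using this
  · rintro ⟨a, b, hab, ha, hb, h⟩
    refine ⟨⟨a, ha⟩, ⟨b, hb⟩, fun h => hab (congrArg Subtype.val h), ?_⟩
    ext ⟨c, hc⟩
    simpa using h c hc

theorem TwoEnds.other {D E : Type} {e : D → E} {x : E} (h : TwoEnds e x) {a : D} (ha : e a = x) :
    ∃ b, b ≠ a ∧ e b = x ∧ ∀ c, e c = x → c = a ∨ c = b := by
  obtain ⟨p, q, hpq, hp, hq, h⟩ := h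
  rcases h a ha with rfl | rfl
  · exact ⟨q, hpq.symm, hq, h⟩
  · exact ⟨p, hpq, hp, fun c hc => (h c hc).symm⟩

theorem TwoEnds.eq_of_ne {D E : Type} {e : D → E} {x : E} (h : TwoEnds e x) {a b c : D}
    (ha : e a = x) (hb : e b = x) (hc : e c = x) (hba : b ≠ a) (hca : c ≠ a) : c = b := by
  obtain ⟨d, -, -, h⟩ := h.other ha
  rw [(h b hb).resolve_left hba, (h c hc).resolve_left hca]

/-- Connecting two ends keeps every edge with two ends or none. -/
theorem twoEnds_join {D E E' : Type} {e : D → E} (h : ∀ x, TwoEnds e x ∨ ∀ d, e d ≠ x) {p q : D}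
    (hpq : p ≠ q) {f : E → E'} (hs : Function.Surjective f)
    (hf : ∀ x y, f x = f y → x = y ∨ x = e p ∧ y = e q ∨ x = e q ∧ y = e p)
    (hfpq : f (e p) = f (e q)) (z : E') :
    TwoEnds (fun d : {d // d ≠ p ∧ d ≠ q} => f (e d)) z ∨
      ∀ d : {d // d ≠ p ∧ d ≠ q}, f (e d) ≠ z := by
  obtain ⟨x, rfl⟩ := hs z
  have twop : TwoEnds e (e p) := (h _).resolve_right fun h => h p rfl
  have twoq : TwoEnds e (e q) := (h _).resolve_right fun h => h q rfl
  by_cases hx : x = e p ∨ x = e q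
  · have hfx : f x = f (e p) := by rcases hx with rfl | rfl <;> simp [hfpq]
    rw [hfx]
    have hcase : ∀ y, f y = f (e p) → y = e p ∨ y = e q := by
      intro y hy
      rcases hf _ _ hy with h | ⟨h, -⟩ | ⟨h, -⟩ <;> simp [h]
    by_cases hpe : e p = e q
    · right
      rintro ⟨d, hdp, hdq⟩ hd
      have hd' : e d = e p := by rcases hcase _ hd with h | h <;> simp [h, hpe]
      exact hdq (twop.eq_of_ne rfl hpe.symm hd' hpq.symm hdp)
    · left
      obtain ⟨p', hp'p, hp', hp''⟩ := twop.other rfl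
      obtain ⟨q', hq'q, hq', hq''⟩ := twoq.other rfl
      have hp'q : p' ≠ q := by rintro rfl; exact hpe hp'.symm
      have hq'p : q' ≠ p := by rintro rfl; exact hpe hq'
      have hne : p' ≠ q' := by rintro rfl; exact hpe (hp'.symm.trans hq')
      refine ⟨⟨p', hp'p, hp'q⟩, ⟨q', hq'p, hq'q⟩, fun h => hne (congrArg Subtype.val h),
        by simp [hp'], by simp [hq', hfpq], ?_⟩
      rintro ⟨d, hdp, hdq⟩ hd
      rcases hcase _ hd with hd | hd
      · exact Or.inl (Subtype.ext ((hp'' d hd).resolve_left hdp))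
      · exact Or.inr (Subtype.ext ((hq'' d hd).resolve_left hdq))
  · push Not at hx
    have hcase : ∀ y, f y = f x → y = x := by
      intro y hy
      rcases hf _ _ hy with h | ⟨-, h⟩ | ⟨-, h⟩
      · exact h
      · exact (hx.2 h).elim
      · exact (hx.1 h).elim
    rcases h x with ⟨a, b, hab, ha, hb, hc⟩ | hno
    · left
      have hne : ∀ d, e d = x → d ≠ p ∧ d ≠ q := fun d hd =>
        ⟨by rintro rfl; exact hx.1 hd.symm, by rintro rfl; exact hx.2 hd.symm⟩
      refine ⟨⟨a, hne a ha⟩, ⟨b, hne b hb⟩, fun h => hab (congrArg Subtype.val h), by simp [ha],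
        by simp [hb], ?_⟩
      rintro ⟨d, hd⟩ hfd
      rcases hc d (hcase _ hfd) with rfl | rfl <;> simp
    · exact Or.inr fun d hd => hno d (hcase _ hd)

theorem quot_pair_exact {E : Type} {r : E → E → Prop} {a b : E} (hr : ∀ x y, r x y → x = a ∧ y = b)
    {x y : E} (h : Quot.mk r x = Quot.mk r y) : x = y ∨ x = a ∧ y = b ∨ x = b ∧ y = a := by
  have := Quot.eqvGen_exact h
  clear h
  induction this with
  | rel x y h => exact Or.inr (Or.inl (hr x y h))
  | refl x => exact Or.inl rfl
  | symm x y _ ih => tauto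
  | trans x y z _ _ ih1 ih2 =>
    rcases ih1 with rfl | ⟨rfl, rfl⟩ | ⟨rfl, rfl⟩
    · exact ih2
    · rcases ih2 with rfl | ⟨rfl, rfl⟩ | ⟨_, rfl⟩ <;> simp
    · rcases ih2 with rfl | ⟨_, rfl⟩ | ⟨rfl, rfl⟩ <;> simp

/-! ### Half-edges, edges and faces -/

namespace Shadow

/-- The edge to which a half-edge belongs. -/
abbrev edge (S : Shadow) (d : S.V × ZMod 4) : S.E := S.att d.1 d.2

/-- Every edge has exactly two ends at crossings. -/
def Full (S : Shadow) : Prop := ∀ x, TwoEnds S.edge x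

/-- Finiteness matters because `Nat.card` of an infinite fibre would be `0` as well. -/
theorem wellFormed_iff {S : Shadow} [Finite S.V] :
    S.WellFormed ↔ ∀ x, TwoEnds S.edge x ∨ ∀ d, S.edge d ≠ x := by
  refine forall_congr' fun x => or_congr card_fiber_eq_two ?_
  rw [Finite.card_eq_zero_iff]
  exact ⟨fun h d hd => h.elim ⟨d, hd⟩, fun h => ⟨fun d => h d.1 d.2⟩⟩

/-- Half-edges are counted in two ways: four at each crossing, two on each edge. -/
theorem Full.card_edges {S : Shadow} [Finite S.V] (h : S.Full) : Nat.card S.E = 2 * Nat.card S.V := by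
  have hs : Function.Surjective S.edge := fun x => by
    obtain ⟨a, -, -, ha, -⟩ := h x
    exact ⟨a, ha⟩
  have : Finite S.E := Finite.of_surjective _ hs
  have := Fintype.ofFinite S.E
  have h1 := Nat.card_congr (Equiv.sigmaFiberEquiv S.edge)
  rw [Nat.card_sigma, Finset.sum_congr rfl fun x _ => card_fiber_eq_two.mpr (h x)] at h1
  simp only [Finset.sum_const, Finset.card_univ, smul_eq_mul, Nat.card_prod] at h1
  rw [← Nat.card_eq_fintype_card, Nat.card_zmod] at h1
  omega

theorem Full.wellFormed {S : Shadow} [Finite S.V] (h : S.Full) : S.WellFormed :=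
  wellFormed_iff.mpr fun x => Or.inl (h x)

theorem Full.planar {S : Shadow} [Finite S.V] (h : S.Full)
    (hF : Nat.card S.Face = Nat.card S.V + 2) : S.Planar := by
  right; rw [h.card_edges]; omega

/-- Edges that lie opposite at a crossing both have an end there; so once there is a crossing, a
single component leaves no room for a free circle. -/
theorem exists_end_of_singleComponent {S : Shadow} (h : S.SingleComponent) [Nonempty S.V] (x : S.E) :
    ∃ d, S.edge d = x := by
  obtain ⟨v⟩ := ‹Nonempty S.V›
  have key : ∀ x y, Relation.EqvGen (S.Opposite Set.univ) x y →
      ((∃ d, S.edge d = x) ↔ ∃ d, S.edge d = y) := by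
    intro x y h
    induction h with
    | rel x y h =>
      obtain ⟨v, -, i, rfl, rfl⟩ := h
      exact ⟨fun _ => ⟨(v, i + 2), rfl⟩, fun _ => ⟨(v, i), rfl⟩⟩
    | refl x => rfl
    | symm x y _ ih => exact ih.symm
    | trans x y z _ _ ih1 ih2 => exact ih1.trans ih2
  exact (key _ _ (h.2 x (S.att v 0))).mpr ⟨(v, 0), rfl⟩

theorem full_of_wellFormed {S : Shadow} [Finite S.V] [Nonempty S.V] (hw : S.WellFormed)
    (h : S.SingleComponent) : S.Full := fun x => by
  obtain ⟨d, hd⟩ := exists_end_of_singleComponent h x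
  exact (wellFormed_iff.mp hw x).resolve_right fun hn => hn d hd

instance (S : Shadow) [Finite S.V] : Finite S.Face := inferInstanceAs (Finite (Quot S.FaceStep))

/-- The half-edge following `d` counterclockwise. -/
abbrev next {S : Shadow} (d : S.V × ZMod 4) : S.V × ZMod 4 := (d.1, d.2 + 1)

theorem faceStep_iff {S : Shadow} {d d' : S.V × ZMod 4} :
    S.FaceStep d d' ↔ ∃ c, c ≠ d ∧ S.edge c = S.edge d ∧ d' = next c :=
  ⟨fun ⟨w, j, h1, h2, h3⟩ => ⟨(w, j), h1, h2, h3⟩, fun ⟨(w, j), h1, h2, h3⟩ => ⟨w, j, h1, h2, h3⟩⟩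

/-- The face to the right of a half-edge. -/
abbrev face (S : Shadow) (d : S.V × ZMod 4) : S.Face := Quot.mk _ d

theorem face_eq {S : Shadow} {c d : S.V × ZMod 4} (h : c ≠ d) (he : S.edge c = S.edge d) :
    S.face d = S.face (next c) :=
  Quot.sound (faceStep_iff.mpr ⟨c, h, he, rfl⟩)

theorem Full.mirror {S : Shadow} (h : S.Full) : S.mirror.Full := fun x => by
  obtain ⟨a, b, hab, ha, hb, hc⟩ := h x
  refine ⟨(a.1, -a.2), (b.1, -b.2), ?_, ?_, ?_, ?_⟩
  · exact fun h => hab (Prod.ext (Prod.ext_iff.mp h).1 (neg_injective (Prod.ext_iff.mp h).2))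
  · simpa [edge, Shadow.mirror] using ha
  · simpa [edge, Shadow.mirror] using hb
  · rintro ⟨v, i⟩ hd
    rcases hc (v, -i) hd with h | h
    · left; rw [← h]; simp
    · right; rw [← h]; simp

/-- Reflection in the plane does not change the faces. -/
theorem card_face_mirror (S : Shadow) : Nat.card S.mirror.Face = Nat.card S.Face := by
  have h1 : ∀ c d : S.V × ZMod 4, S.mirror.FaceStep c d →
      S.FaceStep (d.1, 1 - d.2) (c.1, 1 - c.2) := by
    rintro ⟨v, i⟩ _ ⟨w, j, hne, he, rfl⟩
    refine ⟨v, -i, fun h => hne ?_, ?_, ?_⟩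
    · obtain ⟨h1, h2⟩ := Prod.ext_iff.mp h
      refine Prod.ext h1.symm (neg_injective ?_)
      simpa using h2.symm
    · simpa [Shadow.mirror] using he.symm
    · exact Prod.ext rfl (by simp; ring)
  have h2 : ∀ c d : S.V × ZMod 4, S.FaceStep c d →
      S.mirror.FaceStep (d.1, 1 - d.2) (c.1, 1 - c.2) := by
    rintro ⟨v, i⟩ _ ⟨w, j, hne, he, rfl⟩
    refine ⟨v, -i, fun h => hne ?_, ?_, ?_⟩
    · obtain ⟨h1, h2⟩ := Prod.ext_iff.mp h
      refine Prod.ext h1.symm (neg_injective ?_)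
      simpa using h2.symm
    · simpa [Shadow.mirror] using he.symm
    · exact Prod.ext rfl (by simp; ring)
  refine Nat.card_congr
    ⟨Quot.lift (fun d => S.face (d.1, 1 - d.2)) fun c d h => (Quot.sound (h1 c d h)).symm,
      Quot.lift (fun d => S.mirror.face (d.1, 1 - d.2)) fun c d h => (Quot.sound (h2 c d h)).symm,
      ?_, ?_⟩
  · rintro ⟨d⟩
    exact congrArg (S.mirror.face) (Prod.ext rfl (by simp))
  · rintro ⟨d⟩
    exact congrArg S.face (Prod.ext rfl (by simp))

end Shadow

/-! ### Faces under isotopy and under removal of a loop -/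

namespace Shadow

namespace Erasure

variable {S S' : Shadow} {A : Set S.V}

/-- The half-edge of `S` that becomes a given half-edge of `S'`. -/
def dart (e : Erasure S A S') (d : S'.V × ZMod 4) : S.V × ZMod 4 := (e.k d.1, d.2 - e.r d.1)

theorem dart_injective (e : Erasure S A S') : Function.Injective e.dart := by
  rintro ⟨v, i⟩ ⟨w, j⟩ h
  obtain ⟨h1, h2⟩ := Prod.ext_iff.mp h
  obtain rfl : v = w := e.k_injective h1
  exact Prod.ext rfl (sub_left_injective h2)

theorem g_edge_dart (e : Erasure S A S') (d : S'.V × ZMod 4) : e.g (S.edge (e.dart d)) = S'.edge d := by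
  simp [edge, dart, e.att_eq]

theorem dart_next (e : Erasure S A S') (d : S'.V × ZMod 4) : e.dart (next d) = next (e.dart d) :=
  Prod.ext rfl (by simp [dart]; ring)

theorem exists_dart (e : Erasure S A S') {d : S.V × ZMod 4} (h : d.1 ∉ A) : ∃ c, e.dart c = d := by
  obtain ⟨u, hu⟩ : d.1 ∈ Set.range e.k := by rw [e.range_k]; exact h
  exact ⟨(u, d.2 + e.r u), Prod.ext hu (by simp [dart])⟩

theorem g_injective (e : Erasure S ∅ S') : Function.Injective e.g := fun x y h =>
  eq_of_eqvGen_opposite_empty (e.eqvGen_of_g_eq x y h)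

theorem edge_dart_eq_iff (e : Erasure S ∅ S') (c d : S'.V × ZMod 4) :
    S.edge (e.dart c) = S.edge (e.dart d) ↔ S'.edge c = S'.edge d := by
  rw [← e.g_edge_dart, ← e.g_edge_dart, e.g_injective.eq_iff]

theorem finite (e : Erasure S A S') [Finite S.V] : Finite S'.V :=
  Finite.of_injective e.k e.k_injective

theorem isKnotShadow (e : Erasure S ∅ S') (h : S.IsKnotShadow) : S'.IsKnotShadow := by
  have := h.finite
  have hfin := e.finite
  have hk : Function.Bijective e.k :=
    ⟨e.k_injective, Set.range_eq_univ.mp (by rw [e.range_k, Set.compl_empty])⟩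
  refine ⟨hfin, ?_, e.singleComponent h.singleComponent, ?_⟩
  · rw [wellFormed_iff]
    intro x
    obtain ⟨x, rfl⟩ := e.g_surjective x
    rcases wellFormed_iff.mp h.wellFormed x with ⟨a, b, hab, ha, hb, hc⟩ | hno
    · left
      obtain ⟨a, rfl⟩ := e.exists_dart (d := a) (Set.notMem_empty _)
      obtain ⟨b, rfl⟩ := e.exists_dart (d := b) (Set.notMem_empty _)
      refine ⟨a, b, fun h => hab (h ▸ rfl), by rw [← e.g_edge_dart, ha],
        by rw [← e.g_edge_dart, hb], fun c hc' => ?_⟩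
      rw [← e.g_edge_dart] at hc'
      exact (hc _ (e.g_injective hc')).imp (fun h => e.dart_injective h)
        (fun h => e.dart_injective h)
    · right
      intro d hd
      rw [← e.g_edge_dart] at hd
      exact hno _ (e.g_injective hd)
  · rcases h.planar with hV | hF
    · exact Or.inl ⟨fun v => hV.elim (e.k v)⟩
    · right
      rw [Nat.card_eq_of_bijective e.k hk,
        ← Nat.card_eq_of_bijective e.g ⟨e.g_injective, e.g_surjective⟩, ← hF]
      congr 1
      refine Nat.card_eq_of_bijective (Quot.lift (fun d => S.face (e.dart d)) ?_ : S'.Face → S.Face)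
        ⟨?_, ?_⟩
      · intro c d hcd
        obtain ⟨c', h1, h2, rfl⟩ := faceStep_iff.mp hcd
        rw [e.dart_next]
        exact face_eq (fun h => h1 (e.dart_injective h)) ((e.edge_dart_eq_iff _ _).mpr h2)
      · have key : ∀ c d, Relation.EqvGen S.FaceStep c d → ∀ c' d', e.dart c' = c → e.dart d' = d →
            S'.face c' = S'.face d' := by
          intro c d h
          induction h with
          | rel c d h =>
            rintro c' d' rfl rfl
            obtain ⟨a, h1, h2, h3⟩ := faceStep_iff.mp h
            obtain ⟨a, rfl⟩ := e.exists_dart (d := a) (Set.notMem_empty _)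
            rw [← e.dart_next] at h3
            rw [e.dart_injective h3]
            exact face_eq (fun h => h1 (h ▸ rfl)) ((e.edge_dart_eq_iff _ _).mp h2)
          | refl c => intro c' d' h1 h2; rw [e.dart_injective (h1.trans h2.symm)]
          | symm c d _ ih => intro c' d' h1 h2; exact (ih d' c' h2 h1).symm
          | trans c d a _ _ ih1 ih2 =>
            intro c' a' h1 h2
            obtain ⟨d', hd'⟩ := e.exists_dart (d := d) (Set.notMem_empty _)
            exact (ih1 c' d' h1 hd').trans (ih2 d' a' hd' h2)
        rintro ⟨c⟩ ⟨d⟩ h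
        exact key _ _ (Quot.eqvGen_exact h) c d rfl rfl
      · rintro ⟨d⟩
        obtain ⟨c, rfl⟩ := e.exists_dart (d := d) (Set.notMem_empty _)
        exact ⟨S'.face c, rfl⟩

/-- Removing a loop removes one face. -/
theorem card_face_of_isLoop {v : S.V} (e : Erasure S {v} S') [Finite S.V] [Nonempty S'.V]
    (hS : S.Full) (hc : S.SingleComponent) (hv : S.IsLoop v) :
    Nat.card S.Face = Nat.card S'.Face + 1 := by
  have := e.finite
  obtain ⟨i, hi⟩ := hv
  -- the four half-edges at `v`
  obtain ⟨D0, D1, D2, D3, hv0, hv1, hv2, hv3, n01, n02, n03, n12, n13, n23, s0, s1, s2, s3, hD, h01,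
      o02, o13⟩ : ∃ D0 D1 D2 D3 : S.V × ZMod 4, D0.1 = v ∧ D1.1 = v ∧ D2.1 = v ∧ D3.1 = v ∧
      D0 ≠ D1 ∧ D0 ≠ D2 ∧ D0 ≠ D3 ∧ D1 ≠ D2 ∧ D1 ≠ D3 ∧ D2 ≠ D3 ∧
      next D0 = D1 ∧ next D1 = D2 ∧ next D2 = D3 ∧ next D3 = D0 ∧
      (∀ d : S.V × ZMod 4, d.1 = v → d = D0 ∨ d = D1 ∨ d = D2 ∨ d = D3) ∧
      S.edge D0 = S.edge D1 ∧
      S.Opposite {v} (S.edge D0) (S.edge D2) ∧ S.Opposite {v} (S.edge D1) (S.edge D3) := by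
    have hz : ∀ j : ZMod 4, (j ≠ j + 1 ∧ j ≠ j + 2 ∧ j ≠ j + 3 ∧ j + 1 ≠ j + 2 ∧ j + 1 ≠ j + 3 ∧
        j + 2 ≠ j + 3) ∧ j + 1 + 1 = j + 2 ∧ j + 2 + 1 = j + 3 ∧ j + 3 + 1 = j ∧
        (∀ l, l = j ∨ l = j + 1 ∨ l = j + 2 ∨ l = j + 3) ∧ j + 1 + 2 = j + 3 := by decide
    obtain ⟨⟨m1, m2, m3, m4, m5, m6⟩, a1, a2, a3, hl, a4⟩ := hz i
    refine ⟨(v, i), (v, i + 1), (v, i + 2), (v, i + 3), rfl, rfl, rfl, rfl,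
      fun h => m1 (Prod.ext_iff.mp h).2, fun h => m2 (Prod.ext_iff.mp h).2,
      fun h => m3 (Prod.ext_iff.mp h).2, fun h => m4 (Prod.ext_iff.mp h).2,
      fun h => m5 (Prod.ext_iff.mp h).2, fun h => m6 (Prod.ext_iff.mp h).2,
      rfl, Prod.ext rfl a1, Prod.ext rfl a2, Prod.ext rfl a3, ?_, hi,
      ⟨v, rfl, i, rfl, rfl⟩, ⟨v, rfl, i + 1, rfl, by rw [a4]⟩⟩
    rintro ⟨w, l⟩ rfl
    rcases hl l with rfl | rfl | rfl | rfl <;> simp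
  clear hi
  have hkv : ∀ d, (e.dart d).1 ≠ v := fun d h => e.k_notMem d.1 h
  have loopEnds : ∀ d, S.edge d = S.edge D0 → d = D0 ∨ d = D1 := by
    intro d hd
    by_cases h : d = D0
    · exact Or.inl h
    · exact Or.inr ((hS _).eq_of_ne rfl h01.symm hd n01.symm h)
  have hx0 : S.edge D2 ≠ S.edge D0 := fun h => by
    rcases loopEnds D2 h with h | h
    exacts [n02 h.symm, n12 h.symm]
  have hy0 : S.edge D3 ≠ S.edge D0 := fun h => by
    rcases loopEnds D3 h with h | h
    exacts [n03 h.symm, n13 h.symm]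
  have oppCase : ∀ x y, S.Opposite {v} x y → (x = S.edge D0 ∨ x = S.edge D2 ∨ x = S.edge D3) ∧
      (y = S.edge D0 ∨ y = S.edge D2 ∨ y = S.edge D3) := by
    rintro _ _ ⟨w, rfl, j, rfl, rfl⟩
    have : ∀ j, S.att w j = S.edge D0 ∨ S.att w j = S.edge D2 ∨ S.att w j = S.edge D3 := by
      intro j
      change S.edge (w, j) = _ ∨ S.edge (w, j) = _ ∨ S.edge (w, j) = _
      rcases hD (w, j) rfl with h | h | h | h <;> rw [h] <;> simp [h01]
    exact ⟨this _, this _⟩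
  -- the two remaining edges at `v` are different
  have hxy : S.edge D2 ≠ S.edge D3 := by
    intro h
    have hends : ∀ d, S.edge d = S.edge D2 → d = D2 ∨ d = D3 := by
      intro d hd
      by_cases h' : d = D2
      · exact Or.inl h'
      · exact Or.inr ((hS _).eq_of_ne rfl h.symm hd n23.symm h')
    have hcl : ∀ d, (S.edge d = S.edge D0 ∨ S.edge d = S.edge D2) ↔ d.1 = v := by
      intro d
      constructor
      · rintro (h | h)
        · rcases loopEnds d h with rfl | rfl <;> assumption
        · rcases hends d h with rfl | rfl <;> assumption
      · intro hd
        rcases hD d hd with rfl | rfl | rfl | rfl <;> simp [h01, h]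
    have key : ∀ x y, Relation.EqvGen (S.Opposite Set.univ) x y →
        ((x = S.edge D0 ∨ x = S.edge D2) ↔ (y = S.edge D0 ∨ y = S.edge D2)) := by
      intro x y h
      induction h with
      | rel x y h =>
        obtain ⟨w, -, j, rfl, rfl⟩ := h
        rw [hcl (w, j), hcl (w, j + 2)]
      | refl x => rfl
      | symm x y _ ih => exact ih.symm
      | trans x y z _ _ ih1 ih2 => exact ih1.trans ih2
    obtain ⟨u⟩ := ‹Nonempty S'.V›
    exact hkv (u, 0) ((hcl _).mp ((key _ _ (hc.2 (S.edge D0) (S.edge (e.dart (u, 0))))).mp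
      (Or.inl rfl)))
  -- their other ends
  have other : ∀ d d' : S.V × ZMod 4, S.edge d ≠ S.edge D0 → S.edge d ≠ S.edge d' →
      (∀ c : S.V × ZMod 4, c.1 = v → c = D0 ∨ c = D1 ∨ c = d ∨ c = d') →
      ∃ c, S.edge (e.dart c) = S.edge d ∧ ∀ a, S.edge a = S.edge d → a = d ∨ a = e.dart c := by
    intro d d' h0 hd' hall
    obtain ⟨b, hbd, hb, hb'⟩ := (hS (S.edge d)).other (a := d) rfl
    obtain ⟨c, rfl⟩ := e.exists_dart (d := b) (by
      intro hbv
      rcases hall b hbv with rfl | rfl | rfl | rfl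
      · exact h0 hb.symm
      · exact h0 (hb.symm.trans h01.symm)
      · exact hbd rfl
      · exact hd' hb.symm)
    exact ⟨c, hb, hb'⟩
  obtain ⟨cx, hcx, hcx'⟩ := other D2 D3 hx0 hxy hD
  obtain ⟨cy, hcy, hcy'⟩ := other D3 D2 hy0 hxy.symm fun c hc => by
    rcases hD c hc with h | h | h | h <;> simp [h]
  have hcxy : cx ≠ cy := by rintro rfl; exact hxy (hcx.symm.trans hcy)
  have hg23 : e.g (S.edge D2) = e.g (S.edge D3) := by
    rw [← e.g_eq_of_opposite _ _ o02, ← e.g_eq_of_opposite _ _ o13, h01]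
  have hecxy : S'.edge cx = S'.edge cy := by
    rw [← e.g_edge_dart, ← e.g_edge_dart, hcx, hcy, hg23]
  -- equality of edges after the removal
  have hgeq : ∀ x y, e.g x = e.g y → x = y ∨
      (x = S.edge D0 ∨ x = S.edge D2 ∨ x = S.edge D3) ∧
      (y = S.edge D0 ∨ y = S.edge D2 ∨ y = S.edge D3) := by
    intro x y h
    have := e.eqvGen_of_g_eq x y h
    clear h
    induction this with
    | rel x y h => exact Or.inr (oppCase x y h)
    | refl x => exact Or.inl rfl
    | symm x y _ ih => exact ih.imp Eq.symm And.symm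
    | trans x y z _ _ ih1 ih2 =>
      rcases ih1 with rfl | h1
      · exact ih2
      · rcases ih2 with rfl | h2
        · exact Or.inr h1
        · exact Or.inr ⟨h1.1, h2.2⟩
  have dartEnd : ∀ c, (S.edge (e.dart c) = S.edge D0 ∨ S.edge (e.dart c) = S.edge D2 ∨
      S.edge (e.dart c) = S.edge D3) → c = cx ∨ c = cy := by
    rintro c (h | h | h)
    · rcases loopEnds _ h with h | h
      · exact (hkv c (h ▸ hv0)).elim
      · exact (hkv c (h ▸ hv1)).elim
    · exact Or.inl (e.dart_injective ((hcx' _ h).resolve_left fun h => hkv c (h ▸ hv2)))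
    · exact Or.inr (e.dart_injective ((hcy' _ h).resolve_left fun h => hkv c (h ▸ hv3)))
  classical
  -- steps along the loop
  have f0 : S.face D0 = S.face D2 := by rw [← s1]; exact face_eq n01.symm h01.symm
  have f2 : S.face D2 = S.face (next (e.dart cx)) :=
    face_eq (fun h => hkv cx (h ▸ hv2)) hcx
  have f3 : S.face D3 = S.face (next (e.dart cy)) :=
    face_eq (fun h => hkv cy (h ▸ hv3)) hcy
  have fx : S.face (e.dart cx) = S.face D3 := by
    rw [← s2]; exact face_eq (fun h => hkv cx (h ▸ hv2)) hcx.symm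
  have fy : S.face (e.dart cy) = S.face D0 := by
    rw [← s3]; exact face_eq (fun h => hkv cy (h ▸ hv3)) hcy.symm
  have fx' : S'.face cx = S'.face (next cy) := face_eq hcxy.symm hecxy.symm
  have fy' : S'.face cy = S'.face (next cx) := face_eq hcxy hecxy
  let back : S'.Face → S.Face := Quot.lift (fun d => S.face (e.dart d)) (by
    intro c d hcd
    obtain ⟨c', h1, h2, rfl⟩ := faceStep_iff.mp hcd
    rw [e.dart_next]
    rw [← e.g_edge_dart, ← e.g_edge_dart] at h2
    rcases hgeq _ _ h2 with h | ⟨ha, hb⟩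
    · exact face_eq (fun h => h1 (e.dart_injective h)) h
    · rcases dartEnd _ ha with rfl | rfl <;> rcases dartEnd _ hb with rfl | rfl
      · exact (h1 rfl).elim
      · rw [fy, f0, f2]
      · rw [fx, f3]
      · exact (h1 rfl).elim)
  -- `D1` is a face of its own, the inside of the loop, and goes to `none`. The other half-edges at
  -- `v` go to the face that their walk enters on leaving `v`.
  let φ : S.V × ZMod 4 → Option S'.Face := fun d =>
    if h : ∃ c, e.dart c = d then some (S'.face h.choose)
    else if d = D1 then none
    else if d = D3 then some (S'.face (next cy))
    else some (S'.face (next cx))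
  have φdart : ∀ c, φ (e.dart c) = some (S'.face c) := by
    intro c
    have h : ∃ c', e.dart c' = e.dart c := ⟨c, rfl⟩
    simp only [φ, dif_pos h]
    rw [e.dart_injective h.choose_spec]
  have hnot : ∀ d : S.V × ZMod 4, d.1 = v → ¬ ∃ c, e.dart c = d := by
    rintro d hd ⟨c, rfl⟩; exact hkv c hd
  have φ0 : φ D0 = some (S'.face (next cx)) := by
    simp only [φ]; rw [dif_neg (hnot D0 hv0), if_neg n01, if_neg n03]
  have φ1 : φ D1 = none := by
    simp only [φ]; rw [dif_neg (hnot D1 hv1), if_pos trivial]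
  have φ2 : φ D2 = some (S'.face (next cx)) := by
    simp only [φ]; rw [dif_neg (hnot D2 hv2), if_neg n12.symm, if_neg n23]
  have φ3 : φ D3 = some (S'.face (next cy)) := by
    simp only [φ]; rw [dif_neg (hnot D3 hv3), if_neg n13.symm, if_pos trivial]
  have φstep : ∀ c d, S.FaceStep c d → φ c = φ d := by
    intro c d hcd
    obtain ⟨c', h1, h2, rfl⟩ := faceStep_iff.mp hcd
    by_cases hcv : c.1 = v
    · rcases hD c hcv with rfl | rfl | rfl | rfl
      · rw [(loopEnds c' h2).resolve_left h1, s1, φ0, φ2]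
      · rw [(loopEnds c' (h2.trans h01.symm)).resolve_right h1, s0]
      · rw [(hcx' c' h2).resolve_left h1, ← e.dart_next, φdart, φ2]
      · rw [(hcy' c' h2).resolve_left h1, ← e.dart_next, φdart, φ3]
    · obtain ⟨c, rfl⟩ := e.exists_dart (d := c) hcv
      by_cases hcv' : c'.1 = v
      · rcases hD c' hcv' with rfl | rfl | rfl | rfl
        · rcases loopEnds _ h2.symm with h | h
          · exact (hcv (h ▸ hv0)).elim
          · exact (hcv (h ▸ hv1)).elim
        · rcases loopEnds _ (h2.symm.trans h01.symm) with h | h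
          · exact (hcv (h ▸ hv0)).elim
          · exact (hcv (h ▸ hv1)).elim
        · rw [(hcx' _ h2.symm).resolve_left h1.symm, φdart, s2, φ3, fx']
        · rw [(hcy' _ h2.symm).resolve_left h1.symm, φdart, s3, φ0, fy']
      · obtain ⟨c', rfl⟩ := e.exists_dart (d := c') hcv'
        rw [← e.dart_next, φdart, φdart]
        refine congrArg some (face_eq (fun h => h1 (h ▸ rfl)) ?_)
        rw [← e.g_edge_dart, ← e.g_edge_dart, h2]
  rw [← Finite.card_option]
  refine Nat.card_congr ⟨Quot.lift φ φstep, fun o => o.elim (S.face D1) back, ?_, ?_⟩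
  · rintro ⟨d⟩
    change (φ d).elim (S.face D1) back = S.face d
    by_cases hdv : d.1 = v
    · rcases hD d hdv with rfl | rfl | rfl | rfl
      · rw [φ0]; change S.face (e.dart (next cx)) = _; rw [e.dart_next, f0, f2]
      · rw [φ1]; rfl
      · rw [φ2]; change S.face (e.dart (next cx)) = _; rw [e.dart_next, f2]
      · rw [φ3]; change S.face (e.dart (next cy)) = _; rw [e.dart_next, f3]
    · obtain ⟨c, rfl⟩ := e.exists_dart (d := d) hdv
      rw [φdart]; rfl
  · rintro (_ | d)
    · exact φ1
    · obtain ⟨d, rfl⟩ := Quot.exists_rep d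
      exact φdart d

end Erasure

end Shadow

namespace TangleShadow

/-! The capped tangle. -/

/-- The half-edge at which an end of the capped tangle lies after adding a crossing. -/
def capDart (t : TangleShadow) : t.cap.V × ZMod 4 → t.twist.cap.V × ZMod 4
  | (some v, i) => (some (some v), i)
  | (none, i) => if i = 1 ∨ i = 2 then (some none, i) else (none, i)

theorem edge_capDart (t : TangleShadow) (d : t.cap.V × ZMod 4) :
    t.twist.cap.edge (t.capDart d) = Sum.inl (t.cap.edge d) := by
  rcases d with ⟨_ | v, i⟩
  · revert i; exact forall_zmod_four rfl rfl rfl rfl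
  · rfl

theorem capDart_injective (t : TangleShadow) : Function.Injective t.capDart := by
  rintro ⟨_ | v, i⟩ ⟨_ | w, j⟩ h
  · have : i = j := by
      simp only [capDart] at h
      split_ifs at h <;> exact (Prod.ext_iff.mp h).2
    rw [this]
  · simp only [capDart] at h
    split_ifs at h <;> cases (Prod.ext_iff.mp h).1
  · simp only [capDart] at h
    split_ifs at h <;> cases (Prod.ext_iff.mp h).1
  · cases h; rfl

theorem exists_capDart (t : TangleShadow) {d : t.twist.cap.V × ZMod 4} {x : t.E}
    (h : t.twist.cap.edge d = Sum.inl x) : ∃ c, t.capDart c = d := by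
  rcases d with ⟨_ | _ | v, i⟩
  · revert i
    refine forall_zmod_four (fun _ => ⟨(none, 0), rfl⟩) (fun h => ?_) (fun h => ?_)
      (fun _ => ⟨(none, 3), rfl⟩)
    · cases h
    · cases h
  · revert i
    refine forall_zmod_four (fun h => ?_) (fun _ => ⟨(none, 1), rfl⟩) (fun _ => ⟨(none, 2), rfl⟩)
      (fun h => ?_)
    · cases h
    · cases h
  · exact ⟨(some v, i), rfl⟩

theorem edge_cap_twist_inr (t : TangleShadow) {d : t.twist.cap.V × ZMod 4} {b : Bool}
    (h : t.twist.cap.edge d = Sum.inr b) :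
    d = (none, if b then 1 else 2) ∨ d = (some none, if b then 0 else 3) := by
  rcases d with ⟨_ | _ | v, i⟩
  · revert i
    refine forall_zmod_four (fun h => ?_) (fun h => ?_) (fun h => ?_) (fun h => ?_)
    · cases h
    · cases h; exact Or.inl rfl
    · cases h; exact Or.inl rfl
    · cases h
  · revert i
    refine forall_zmod_four (fun h => ?_) (fun h => ?_) (fun h => ?_) (fun h => ?_)
    · cases h; exact Or.inr rfl
    · cases h
    · cases h
    · cases h; exact Or.inr rfl
  · cases h

/-- Old edges keep their two half-edges, relocated by `capDart`; each new edge runs from the added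
crossing to the capping crossing. -/
theorem cap_twist_full {t : TangleShadow} (h : t.cap.Full) : t.twist.cap.Full := by
  rintro (x | b)
  · obtain ⟨a, b, hab, ha, hb, hc⟩ := h x
    refine ⟨t.capDart a, t.capDart b, fun h => hab (t.capDart_injective h), ?_, ?_, ?_⟩
    · rw [edge_capDart, ha]
    · rw [edge_capDart, hb]
    · intro c hcx
      obtain ⟨c, rfl⟩ := t.exists_capDart hcx
      rw [edge_capDart] at hcx
      exact (hc c (Sum.inl_injective hcx)).imp (congrArg _) (congrArg _)
  · refine ⟨(none, if b then 1 else 2), (some none, if b then 0 else 3), fun h => ?_, ?_, ?_,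
      fun c => t.edge_cap_twist_inr⟩
    · cases (Prod.ext_iff.mp h).1
    · cases b <;> rfl
    · cases b <;> rfl

theorem cap_base_full : base.cap.Full := by
  rintro (_ | _)
  · refine ⟨(none, 0), (none, 3), fun h => absurd (Prod.ext_iff.mp h).2 (by decide : (0 : ZMod 4) ≠ 3), rfl, rfl, ?_⟩
    rintro ⟨_ | v, i⟩
    · revert i
      refine forall_zmod_four (fun h => Or.inl rfl) (fun h => ?_) (fun h => ?_) (fun h => Or.inr rfl)
      · cases h
      · cases h
    · exact v.elim
  · refine ⟨(none, 1), (none, 2), fun h => absurd (Prod.ext_iff.mp h).2 (by decide : (1 : ZMod 4) ≠ 2), rfl, rfl, ?_⟩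
    rintro ⟨_ | v, i⟩
    · revert i
      refine forall_zmod_four (fun h => ?_) (fun h => Or.inl rfl) (fun h => Or.inr rfl) (fun h => ?_)
      · cases h
      · cases h
    · exact v.elim

/-- The capped starting tangle is a figure eight, with two loops and one face around them. -/
theorem card_face_cap_base : Nat.card base.cap.Face = 3 := by
  have h : ∀ i : ZMod 4, ∀ c, c ≠ ((none, i) : base.cap.V × ZMod 4) →
      base.cap.edge c = base.cap.edge (none, i) → c = (none, 3 - i) := by
    intro i
    have key : ∀ j, j ≠ i → base.cap.edge (none, j) = base.cap.edge (none, i) → j = 3 - i := by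
      revert i
      change ∀ i j : ZMod 4, j ≠ i →
        (if j = 0 then false else if j = 1 then true else if j = 2 then true else false) =
        (if i = 0 then false else if i = 1 then true else if i = 2 then true else false) → j = 3 - i
      decide
    rintro ⟨_ | v, j⟩ hne he
    · exact congrArg (Prod.mk none) (key j (fun h => hne (congrArg _ h)) he)
    · exact v.elim
  let q : ZMod 4 → Fin 3 := fun i => if i = 0 then 0 else if i = 2 then 1 else 2
  have hq : ∀ i : ZMod 4, q i = q (3 - i + 1) := by decide
  have e1 : base.cap.face (none, 1) = base.cap.face (none, 3) :=
    Shadow.face_eq (S := base.cap) (c := (none, 2)) (d := (none, 1))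
      (fun h => absurd (Prod.ext_iff.mp h).2 (by decide : (2 : ZMod 4) ≠ 1)) rfl
  have : Nat.card base.cap.Face = Nat.card (Fin 3) := by
    refine Nat.card_congr ⟨Quot.lift (fun d => q d.2) ?_,
      fun n => base.cap.face (none, if n = 0 then 0 else if n = 1 then 2 else 3), ?_, ?_⟩
    · rintro ⟨_ | v, i⟩ d hd
      · obtain ⟨c, h1, h2, rfl⟩ := Shadow.faceStep_iff.mp hd
        rw [h i c h1 h2]
        exact hq i
      · exact v.elim
    · rintro ⟨⟨_ | v, i⟩⟩
      · revert i; exact forall_zmod_four rfl e1.symm rfl rfl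
      · exact v.elim
    · change ∀ n : Fin 3, q (if n = 0 then 0 else if n = 1 then 2 else 3) = n
      decide
  rw [this, Nat.card_fin]

/-- Adding a crossing to a capped tangle adds a face. -/
theorem card_face_cap_twist (t : TangleShadow) [Finite t.V] :
    Nat.card t.twist.cap.Face = Nat.card t.cap.Face + 1 := by
  have : Finite t.cap.V := inferInstanceAs (Finite (Option t.V))
  have : Finite t.twist.cap.V := inferInstanceAs (Finite (Option (Option t.V)))
  let F := t.cap.face
  let F' := t.twist.cap.face
  -- `none` stands for the new bigon between the added crossing and the capping crossing, whose
  -- half-edges are `(some none, 0)` and `(none, 2)`. All other faces correspond to old ones.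
  let φ : t.twist.cap.V × ZMod 4 → Option t.cap.Face := fun d => match d with
    | (some (some v), i) => some (F (some v, i))
    | (some none, i) => if i = 0 then none else some (F (none, i))
    | (none, i) => if i = 2 then none else some (F (none, i))
  let ψ : t.cap.V × ZMod 4 → t.twist.cap.Face := fun d => match d with
    | (some v, i) => F' (some (some v), i)
    | (none, i) => if i = 2 then F' (some none, 2) else F' (none, i)
  have e1 : F' (none, 1) = F' (some none, 1) :=
    Shadow.face_eq (S := t.twist.cap) (c := (some none, 0)) (d := (none, 1))
      (fun h => by cases (Prod.ext_iff.mp h).1) rfl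
  have e2 : F' (some none, 0) = F' (none, 2) :=
    Shadow.face_eq (S := t.twist.cap) (c := (none, 1)) (d := (some none, 0))
      (fun h => by cases (Prod.ext_iff.mp h).1) rfl
  have e3 : F' (some none, 3) = F' (none, 3) :=
    Shadow.face_eq (S := t.twist.cap) (c := (none, 2)) (d := (some none, 3))
      (fun h => by cases (Prod.ext_iff.mp h).1) rfl
  have φdart : ∀ d, φ (t.capDart d) = some (F d) := by
    rintro ⟨_ | v, i⟩
    · revert i; exact forall_zmod_four rfl rfl rfl rfl
    · rfl
  have φnext : ∀ d, φ (Shadow.next (t.capDart d)) = some (F (Shadow.next d)) := by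
    rintro ⟨_ | v, i⟩
    · revert i; exact forall_zmod_four rfl rfl rfl rfl
    · rfl
  have ψdart : ∀ d, ψ d = F' (t.capDart d) := by
    rintro ⟨_ | v, i⟩
    · revert i; exact forall_zmod_four rfl e1 rfl rfl
    · rfl
  have ψnext : ∀ d, ψ (Shadow.next d) = F' (Shadow.next (t.capDart d)) := by
    rintro ⟨_ | v, i⟩
    · revert i; exact forall_zmod_four rfl rfl e3.symm rfl
    · rfl
  have φstep : ∀ c d, t.twist.cap.FaceStep c d → φ c = φ d := by
    intro c d h
    obtain ⟨c', h1, h2, rfl⟩ := Shadow.faceStep_iff.mp h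
    rcases hx : t.twist.cap.edge c with x | b
    · obtain ⟨a, rfl⟩ := t.exists_capDart hx
      obtain ⟨a', rfl⟩ := t.exists_capDart (h2.trans hx)
      rw [φdart, φnext]
      refine congrArg some (Shadow.face_eq (fun h => h1 (h ▸ rfl)) ?_)
      rw [edge_capDart, edge_capDart] at h2
      exact Sum.inl_injective h2
    · rcases t.edge_cap_twist_inr hx with rfl | rfl <;>
        rcases t.edge_cap_twist_inr (h2.trans hx) with rfl | rfl
      · exact (h1 rfl).elim
      · cases b <;> rfl
      · cases b <;> rfl
      · exact (h1 rfl).elim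
  have ψstep : ∀ c d, t.cap.FaceStep c d → ψ c = ψ d := by
    intro c d h
    obtain ⟨c', h1, h2, rfl⟩ := Shadow.faceStep_iff.mp h
    rw [ψdart, ψnext]
    refine Shadow.face_eq (fun h => h1 (t.capDart_injective h)) ?_
    rw [edge_capDart, edge_capDart, h2]
  rw [← Finite.card_option]
  refine Nat.card_congr ⟨Quot.lift φ φstep, fun o => o.elim (F' (some none, 0)) (Quot.lift ψ ψstep),
    ?_, ?_⟩
  · rintro ⟨⟨_ | _ | v, i⟩⟩
    · revert i; exact forall_zmod_four rfl rfl e2 rfl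
    · revert i; exact forall_zmod_four rfl e1 rfl e3.symm
    · rfl
  · rintro (_ | d)
    · rfl
    · obtain ⟨⟨_ | v, i⟩, rfl⟩ := Quot.exists_rep d
      · revert i; exact forall_zmod_four rfl rfl rfl rfl
      · rfl

end TangleShadow

theorem TwoEnds.comp_bijective {D D' E : Type} {e : D → E} {x : E} {φ : D' → D}
    (hφ : Function.Bijective φ) (h : TwoEnds e x ∨ ∀ d, e d ≠ x) :
    TwoEnds (fun d => e (φ d)) x ∨ ∀ d, e (φ d) ≠ x := by
  rcases h with ⟨a, b, hab, ha, hb, hc⟩ | h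
  · left
    obtain ⟨a, rfl⟩ := hφ.2 a
    obtain ⟨b, rfl⟩ := hφ.2 b
    exact ⟨a, b, fun h => hab (h ▸ rfl), ha, hb,
      fun c hcx => (hc _ hcx).imp (fun h => hφ.1 h) (fun h => hφ.1 h)⟩
  · exact Or.inr fun d => h _

namespace Shadow

theorem Erasure.k_bijective {S S' : Shadow} (e : Erasure S ∅ S') : Function.Bijective e.k :=
  ⟨e.k_injective, fun v => by
    have : v ∈ Set.range e.k := by rw [e.range_k]; exact fun h => h
    exact this⟩

/-- The inverse of a renumbering. -/
noncomputable def Erasure.symm {S S' : Shadow} (e : Erasure S ∅ S') : Erasure S' ∅ S :=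
  .ofEquiv (Equiv.ofBijective e.k e.k_bijective).symm
    (Equiv.ofBijective e.g ⟨e.g_injective, e.g_surjective⟩).symm
    (fun v => -e.r ((Equiv.ofBijective e.k e.k_bijective).symm v)) (by
    intro v i
    rw [Equiv.symm_apply_eq]
    have hk := (Equiv.ofBijective e.k e.k_bijective).apply_symm_apply v
    set u := (Equiv.ofBijective e.k e.k_bijective).symm v
    have := e.att_eq u (i + -e.r u)
    rw [show e.k u = v from hk, neg_add_cancel_right] at this
    exact this.symm)

end Shadow

/-! ### Closures of rational tangles lie on the sphere -/

namespace TangleShadow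

/-- The closure arises from the capped tangle by dropping the capping crossing and joining its
half-edges `0`, `1` and `3`, `2`; `twoEnds_join` is applied once to each pair. -/
theorem close_wellFormed {t : TangleShadow} [Finite t.V] (h : t.cap.Full) : t.close.WellFormed := by
  have : Finite t.close.V := ‹Finite t.V›
  rw [Shadow.wellFormed_iff]
  let r : t.E → t.E → Prop := fun x y => x = t.nw ∧ y = t.ne
  have hpq : ((none, 0) : t.cap.V × ZMod 4) ≠ (none, 1) := fun h =>
    absurd (Prod.ext_iff.mp h).2 (by decide : (0 : ZMod 4) ≠ 1)
  have h1 := twoEnds_join (fun x => Or.inl (h x)) hpq (f := Quot.mk r) Quot.exists_rep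
    (fun x y h => quot_pair_exact (fun _ _ h => h) h) (Quot.sound ⟨rfl, rfl⟩)
  let p : {d : t.cap.V × ZMod 4 // d ≠ (none, 0) ∧ d ≠ (none, 1)} :=
    ⟨(none, 3), fun h => absurd (Prod.ext_iff.mp h).2 (by decide : (3 : ZMod 4) ≠ 0),
      fun h => absurd (Prod.ext_iff.mp h).2 (by decide : (3 : ZMod 4) ≠ 1)⟩
  let q : {d : t.cap.V × ZMod 4 // d ≠ (none, 0) ∧ d ≠ (none, 1)} :=
    ⟨(none, 2), fun h => absurd (Prod.ext_iff.mp h).2 (by decide : (2 : ZMod 4) ≠ 0),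
      fun h => absurd (Prod.ext_iff.mp h).2 (by decide : (2 : ZMod 4) ≠ 1)⟩
  have hpq' : p ≠ q := fun h =>
    absurd (Prod.ext_iff.mp (congrArg Subtype.val h)).2 (by decide : (3 : ZMod 4) ≠ 2)
  have exact' : ∀ x y, Relation.EqvGen t.Joined x y → Quot.mk r x = Quot.mk r y ∨
      Quot.mk r x = Quot.mk r t.sw ∧ Quot.mk r y = Quot.mk r t.se ∨
      Quot.mk r x = Quot.mk r t.se ∧ Quot.mk r y = Quot.mk r t.sw := by
    intro x y h
    induction h with
    | rel x y h =>
      rcases h with h | ⟨rfl, rfl⟩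
      · exact Or.inl (Quot.sound h)
      · exact Or.inr (Or.inl ⟨rfl, rfl⟩)
    | refl x => exact Or.inl rfl
    | symm x y _ ih => tauto
    | trans x y z _ _ ih1 ih2 =>
      rcases ih1 with h | ⟨h1, h2⟩ | ⟨h1, h2⟩ <;> rcases ih2 with h' | ⟨h1', h2'⟩ | ⟨h1', h2'⟩
      · exact Or.inl (h.trans h')
      · exact Or.inr (Or.inl ⟨h.trans h1', h2'⟩)
      · exact Or.inr (Or.inr ⟨h.trans h1', h2'⟩)
      · exact Or.inr (Or.inl ⟨h1, h'.symm.trans h2⟩)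
      · exact Or.inr (Or.inl ⟨h1, h2'⟩)
      · exact Or.inl (h1.trans h2'.symm)
      · exact Or.inr (Or.inr ⟨h1, h'.symm.trans h2⟩)
      · exact Or.inl (h1.trans h2'.symm)
      · exact Or.inr (Or.inr ⟨h1, h2'⟩)
  have h2 := twoEnds_join h1 hpq'
    (f := Quot.map (rb := t.Joined) id fun x y h => Or.inl h)
    (by rintro ⟨x⟩; exact ⟨Quot.mk _ x, rfl⟩)
    (by rintro ⟨x⟩ ⟨y⟩ h; exact exact' x y (Quot.eqvGen_exact h))
    (Quot.sound (r := t.Joined) (Or.inr ⟨rfl, rfl⟩))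
  let φ : t.V × ZMod 4 → {d // d ≠ p ∧ d ≠ q} := fun d =>
    ⟨⟨(some d.1, d.2), fun h => (by cases (Prod.ext_iff.mp h).1),
      fun h => (by cases (Prod.ext_iff.mp h).1)⟩,
      fun h => (by cases (Prod.ext_iff.mp (congrArg Subtype.val h)).1),
      fun h => (by cases (Prod.ext_iff.mp (congrArg Subtype.val h)).1)⟩
  have hφ : Function.Bijective φ := by
    constructor
    · intro a b h
      have := Prod.ext_iff.mp (congrArg (fun x => x.1.1) h)
      exact Prod.ext (Option.some.inj this.1) this.2
    · rintro ⟨⟨⟨_ | v, i⟩, h1, h2⟩, h3, h4⟩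
      · exfalso
        revert i
        exact forall_zmod_four (fun h => (h rfl).elim) (fun _ h => (h rfl).elim)
          (fun _ _ _ h => h rfl) (fun _ _ h => (h rfl).elim)
      · exact ⟨(v, i), rfl⟩
  intro x
  have := TwoEnds.comp_bijective hφ (h2 x)
  exact this

/-- The tangle shadow obtained by adding crossings to the right (`true`) and reflecting (`false`),
the last operation coming first. -/
def build : List Bool → TangleShadow
  | [] => base
  | true :: w => (build w).twist
  | false :: w => (build w).reflect

theorem build_finite : ∀ w, Finite (build w).V
  | [] => inferInstanceAs (Finite Empty)
  | true :: w => have := build_finite w; inferInstanceAs (Finite (Option (build w).V))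
  | false :: w => build_finite w

instance (w : List Bool) : Finite (build w).V := build_finite w
instance (w : List Bool) : Finite (build w).close.V := build_finite w
instance (w : List Bool) : Finite (build w).cap.V := inferInstanceAs (Finite (Option (build w).V))

theorem build_cap_full : ∀ w, (build w).cap.Full
  | [] => cap_base_full
  | true :: w => cap_twist_full (build_cap_full w)
  | false :: w => by
    have := (build_cap_full w).mirror
    rw [← cap_reflect] at this
    exact this

/-- The capped tangle has one crossing more than the tangle itself, and Euler's formula asks for two
faces more than crossings. -/
theorem build_card_face : ∀ w, Nat.card (build w).cap.Face = Nat.card (build w).V + 3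
  | [] => by
    have : Nat.card (build []).V = 0 := Nat.card_of_isEmpty (α := Empty)
    rw [this]
    exact card_face_cap_base
  | true :: w => by
    have h1 : Nat.card (build (true :: w)).V = Nat.card (build w).V + 1 :=
      Finite.card_option (α := (build w).V)
    rw [h1, Nat.add_right_comm, ← build_card_face w]
    exact card_face_cap_twist (build w)
  | false :: w => by
    have : Nat.card (build w).reflect.cap.Face = Nat.card (build w).V + 3 := by
      rw [cap_reflect, Shadow.card_face_mirror, build_card_face w]
    exact this

theorem cap_isKnotShadow (w : List Bool) (h : (build w).cap.SingleComponent) :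
    (build w).cap.IsKnotShadow where
  finite := inferInstance
  wellFormed := (build_cap_full w).wellFormed
  singleComponent := h
  planar := (build_cap_full w).planar (by
    rw [build_card_face]
    have : Nat.card (build w).cap.V = Nat.card (build w).V + 1 :=
      Finite.card_option (α := (build w).V)
    rw [this])

theorem build_eq_of_isEmpty : ∀ w, IsEmpty (build w).V → build w = base ∨ build w = base.reflect
  | [], _ => Or.inl rfl
  | true :: _, h => (h.false none).elim
  | false :: w, h => by
    rcases build_eq_of_isEmpty w h with h | h
    · right; rw [build, h]
    · left; rw [build, h, reflect_reflect]

/-- Two horizontal arcs close up to two circles. -/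
theorem not_singleComponent_base_reflect : ¬ base.reflect.close.SingleComponent := by
  intro h
  let f : base.reflect.close.E → Bool := Quot.lift id (by rintro x y (⟨rfl, rfl⟩ | ⟨rfl, rfl⟩) <;> rfl)
  have key : ∀ x y, Relation.EqvGen (base.reflect.close.Opposite Set.univ) x y → x = y := by
    intro x y h
    induction h with
    | rel x y h => exact h.choose.elim
    | refl x => rfl
    | symm x y _ ih => exact ih.symm
    | trans x y z _ _ ih1 ih2 => exact ih1.trans ih2
  have := congrArg f (key _ _ (h.2 (Quot.mk _ true) (Quot.mk _ false)))
  cases this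

/-- Closures of the tangles considered here lie on the sphere. -/
theorem close_isKnotShadow (w : List Bool) (h : (build w).close.SingleComponent) :
    (build w).close.IsKnotShadow := by
  induction hn : w.length using Nat.strong_induction_on generalizing w with | _ n ih
  have of_planar (hp : (build w).close.Planar) : (build w).close.IsKnotShadow :=
    ⟨inferInstance, close_wellFormed (build_cap_full w), h, hp⟩
  -- When the last operation is a twist, the closure is a capped tangle, whose faces have been
  -- counted.
  have htwist : ∀ v, (build v).twist.close.SingleComponent → (build v).twist.close.IsKnotShadow :=
    fun v h => (build v).closeTwist.symm.isKnotShadow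
      (cap_isKnotShadow v ((build v).closeTwist.singleComponent h))
  match w, ih, hn, h, of_planar with
  | [], _, _, _, of_planar => exact of_planar (Or.inl (inferInstanceAs (IsEmpty Empty)))
  | [false], _, _, _, of_planar => exact of_planar (Or.inl (inferInstanceAs (IsEmpty Empty)))
  | true :: w, ih, hn, h, of_planar => exact htwist w h
  | false :: false :: w, ih, hn, h, of_planar =>
    have e : build (false :: false :: w) = build w := reflect_reflect _
    rw [e] at h ⊢
    exact ih w.length (by simp at hn; omega) w h rfl
  -- Here the last crossing is a loop of the closure; removing it leaves a shorter word, one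
  -- crossing and one face fewer.
  | false :: true :: w, ih, hn, h, of_planar =>
    have sc := (build w).closeReflectTwist.singleComponent h
    have hS' := ih (false :: w).length (by simp at hn ⊢; omega) (false :: w) sc rfl
    rcases isEmpty_or_nonempty (build w).V with hV | hV
    -- The face count for a loop needs another crossing. Without one, either there are two
    -- components or the single crossing is symmetric under reflection.
    · rcases build_eq_of_isEmpty w hV with hw | hw
      · rw [hw] at sc
        exact (not_singleComponent_base_reflect sc).elim
      · have h' : base.reflect.twist.reflect.close.SingleComponent := hw ▸ h
        have := reflectCrossing.close.symm.isKnotShadow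
          (htwist [false] (reflectCrossing.close.singleComponent h'))
        change (build w).twist.reflect.close.IsKnotShadow
        rw [hw]; exact this
    · have : Nonempty (build (false :: w)).close.V := hV
      have : Nonempty (build (false :: true :: w)).close.V := ⟨(none : Option (build w).V)⟩
      have hf := Shadow.full_of_wellFormed (close_wellFormed (build_cap_full _)) h
      have hf' := Shadow.full_of_wellFormed hS'.wellFormed sc
      refine of_planar (hf.planar ?_)
      have : Finite (build w).twist.reflect.close.V :=
        inferInstanceAs (Finite (build (false :: true :: w)).close.V)
      have : Nonempty (build w).reflect.close.V := hV
      have h1 := (build w).closeReflectTwist.card_face_of_isLoop hf h (isLoop_closeReflectTwist _)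
      have h2 : Nat.card (build (false :: true :: w)).close.V = Nat.card (build (false :: w)).close.V + 1 :=
        Finite.card_option (α := (build w).V)
      have h3 := hf'.card_edges
      have h4 := hS'.planar.resolve_left (not_isEmpty_iff.mpr hV)
      change Nat.card (build w).twist.reflect.close.Face = _
      rw [h1, h2]
      rw [h3] at h4
      change Nat.card (build (false :: w)).close.Face + 1 = _
      omega

end TangleShadow

/-! Colourings of diagrams. -/

theorem strand_eq_iff {i j : ZMod 4} : strand i = strand j ↔ i = j ∨ i = j + 2 := by
  have : ∀ i j : ZMod 4, (ZMod.cast i : ZMod 2) = ZMod.cast j ↔ i = j ∨ i = j + 2 := by decide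
  exact this i j

theorem strand_eq_or (i : ZMod 4) (a : ZMod 2) : strand i = a ∨ strand (i + 1) = a := by
  have : ∀ (i : ZMod 4) (a : ZMod 2), (ZMod.cast i : ZMod 2) = a ∨ ZMod.cast (i + 1) = a := by decide
  exact this i a

theorem strand_add_one (i : ZMod 4) : strand (i + 1) = strand i + 1 := by
  rw [map_add, map_one]

theorem strand_add_two (i : ZMod 4) : strand (i + 2) = strand i := strand_eq_iff.mpr (Or.inr rfl)

theorem strand_neg (i : ZMod 4) : strand (-i) = strand i := by
  rw [map_neg, ZMod.neg_eq_self_mod_two]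

/-- The relation between the colours around a crossing whose upper strand is that of `i`. -/
def ColorAt {A : Type} [AddCommGroup A] (a : ZMod 4 → A) (i : ZMod 4) : Prop :=
  a (i + 2) = a i ∧ a (i + 3) = 2 • a i - a (i + 1)

/-- The relation looks the same from either end of the upper strand, because `2a - (2a - b) = b`. -/
theorem ColorAt.of_strand_eq {A : Type} [AddCommGroup A] {a : ZMod 4 → A} {i j : ZMod 4}
    (h : ColorAt a i) (hij : strand j = strand i) : ColorAt a j := by
  rcases strand_eq_iff.mp hij with rfl | rfl
  · exact h
  · obtain ⟨h1, h2⟩ := h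
    have e1 : i + 2 + 2 = i := by rw [add_assoc]; exact add_zero i
    have e2 : i + 2 + 3 = i + 1 := by rw [add_assoc]; rfl
    have e3 : i + 2 + 1 = i + 3 := by rw [add_assoc]; rfl
    rw [ColorAt, e1, e2, e3, h1, h2]
    exact ⟨rfl, (sub_sub_cancel _ _).symm⟩

namespace Diagram

/-- A colouring of the edges of `D` by elements of `A`. -/
def IsColoring (D : Diagram) {A : Type} [AddCommGroup A] (f : D.shadow.E → A) : Prop :=
  ∀ v i, strand i = D.top v → ColorAt (fun j => f (D.shadow.att v j)) i

/-- All colourings of `D` are constant. -/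
def Rigid (D : Diagram) (A : Type) [AddCommGroup A] : Prop :=
  ∀ f : D.shadow.E → A, D.IsColoring f → ∀ x y, f x = f y

theorem IsColoring.at_of {D : Diagram} {A : Type} [AddCommGroup A] {f : D.shadow.E → A}
    {v : D.shadow.V} {i : ZMod 4} (hi : strand i = D.top v)
    (h : ColorAt (fun j => f (D.shadow.att v j)) i) (j : ZMod 4) (hj : strand j = D.top v) :
    ColorAt (fun j => f (D.shadow.att v j)) j :=
  h.of_strand_eq (hj.trans hi.symm)

theorem Iso.symm {D D' : Diagram} (h : D.Iso D') : D'.Iso D := by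
  obtain ⟨f, g, r, h1, h2⟩ := h
  refine ⟨f.symm, g.symm, fun v => -r (f.symm v), fun v i => ?_, fun v => ?_⟩
  · rw [Equiv.eq_symm_apply, ← h1, neg_add_cancel_right, f.apply_symm_apply]
  · have := h2 (f.symm v)
    rw [f.apply_symm_apply] at this
    rw [this, map_neg, add_neg_cancel_right]

theorem Iso.shadow {D D' : Diagram} (h : D.Iso D') : D.shadow.Iso D'.shadow := by
  obtain ⟨f, g, r, h1, -⟩ := h
  exact ⟨f, g, r, h1⟩

variable {A : Type} [AddCommGroup A]

theorem Iso.rigid {D D' : Diagram} (h : D.Iso D') (hD : D.Rigid A) : D'.Rigid A := by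
  obtain ⟨f, g, r, h1, h2⟩ := h
  intro c hc x y
  have : D.IsColoring (fun z => c (g z)) := by
    intro v i hi
    have := hc (f v) (i + r v) (by rw [h2, map_add, hi])
    simp only [ColorAt] at this ⊢
    simp only [← h1]
    simp only [add_right_comm i _ (r v)]
    exact this
  have := hD _ this (g.symm x) (g.symm y)
  simpa using this

theorem Iso.rigid_iff {D D' : Diagram} (h : D.Iso D') : D.Rigid A ↔ D'.Rigid A :=
  ⟨h.rigid, h.symm.rigid⟩

/-- A colouring of the remaining crossings that is constant along the strands of the erased ones
descends. -/
theorem exists_isColoring_erase {D : Diagram} {B : Set D.shadow.V} {f : D.shadow.E → A}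
    (h1 : ∀ v ∉ B, ∀ i, strand i = D.top v → ColorAt (fun j => f (D.shadow.att v j)) i)
    (h2 : ∀ v ∈ B, ∀ i, f (D.shadow.att v (i + 2)) = f (D.shadow.att v i)) :
    ∃ f' : (D.erase B).shadow.E → A, (D.erase B).IsColoring f' ∧ ∀ x, f' (Quot.mk _ x) = f x := by
  refine ⟨Quot.lift f ?_, fun v i hi => h1 v.1 v.2 i hi, fun _ => rfl⟩
  rintro _ _ ⟨v, hv, i, rfl, rfl⟩
  exact (h2 v hv i).symm

theorem _root_.forall_of_two {A : Type} {f : ZMod 4 → A} {i : ZMod 4} (h0 : f (i + 2) = f i)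
    (h1 : f (i + 3) = f (i + 1)) (j : ZMod 4) : f (j + 2) = f j := by
  have : ∀ i j : ZMod 4, j = i ∧ j + 2 = i + 2 ∨ j = i + 2 ∧ j + 2 = i ∨
    j = i + 1 ∧ j + 2 = i + 3 ∨ j = i + 3 ∧ j + 2 = i + 1 := by decide
  rcases this i j with ⟨e1, e2⟩ | ⟨e1, e2⟩ | ⟨e1, e2⟩ | ⟨e1, e2⟩ <;> rw [e2, e1] <;>
    first | assumption | exact Eq.symm ‹_›

/-- At a loop the crossing relation forces all four colours to agree, whichever strand is on top, so
colourings with and without the crossing correspond. -/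
theorem rigid_erase_loop {D : Diagram} {v : D.shadow.V} (h : D.shadow.IsLoop v) :
    D.Rigid A ↔ (D.erase {v}).Rigid A := by
  obtain ⟨i, hi⟩ := h
  constructor
  · intro hD f' hf'
    have hopp : ∀ j, f' (Quot.mk _ (D.shadow.att v (j + 2))) = f' (Quot.mk _ (D.shadow.att v j)) :=
      fun j => congrArg f' (Quot.sound ⟨v, rfl, j, rfl, rfl⟩).symm
    have : D.IsColoring (fun x => f' (Quot.mk _ x)) := by
      intro w j hj
      by_cases hw : w = v
      · subst hw
        have key : ∀ j, f' (Quot.mk _ (D.shadow.att w j)) = f' (Quot.mk _ (D.shadow.att w i)) := by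
          intro j
          have h1 := hopp i
          have h2 := hopp (i + 1)
          rw [← hi, show i + 1 + 2 = i + 3 by rw [add_assoc]; rfl] at h2
          have : ∀ i j : ZMod 4, j = i ∨ j = i + 1 ∨ j = i + 2 ∨ j = i + 3 := by decide
          rcases this i j with rfl | rfl | rfl | rfl
          · rfl
          · rw [hi]
          · exact h1
          · exact h2
        simp only [ColorAt, key, true_and]
        rw [two_smul, add_sub_cancel_right]
      · exact hf' ⟨w, hw⟩ j hj
    rintro ⟨x⟩ ⟨y⟩
    exact hD _ this x y
  · intro hD f hf
    have key : ∀ j, f (D.shadow.att v (j + 2)) = f (D.shadow.att v j) := by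
      refine forall_of_two (f := fun j => f (D.shadow.att v j)) (i := i) ?_ ?_
      · rcases strand_eq_or i (D.top v) with h | h
        · exact (hf v i h).1
        · have h1 := (hf v (i + 1) h).1
          have h2 := (hf v (i + 1) h).2
          rw [show i + 1 + 3 = i by rw [add_assoc]; exact add_zero i,
            show i + 1 + 1 = i + 2 by rw [add_assoc]; rfl] at h2
          simp only [hi, two_smul] at h2
          have h3 := sub_eq_iff_eq_add.mp h2.symm
          rw [hi]
          exact (add_left_cancel h3).symm
      · rcases strand_eq_or i (D.top v) with h | h
        · have h2 := (hf v i h).2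
          simp only at h2 ⊢
          rw [h2, ← hi, two_smul, add_sub_cancel_right]
        · have h1 := (hf v (i + 1) h).1
          rw [show i + 1 + 2 = i + 3 by rw [add_assoc]; rfl] at h1
          exact h1
    obtain ⟨f', h1, h2⟩ := exists_isColoring_erase (B := {v}) (fun w _ => hf w)
      (by rintro w rfl; exact key)
    intro x y
    rw [← h2, ← h2]
    exact hD f' h1 _ _

end Diagram

theorem Shadow.WellFormed.end_eq {S : Shadow} [Finite S.V] (h : S.WellFormed) {a b : S.V × ZMod 4}
    (hab : a ≠ b) (he : S.edge a = S.edge b) {c : S.V × ZMod 4} (hc : S.edge c = S.edge a) :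
    c = a ∨ c = b := by
  by_contra! hn
  exact hn.2 (((wellFormed_iff.mp h _).resolve_right fun h => h a rfl).eq_of_ne rfl he.symm hc hab.symm hn.1)

namespace Diagram

variable {A : Type} [AddCommGroup A]

theorem isColoring_update_of_notMem {D : Diagram} {f f' : D.shadow.E → A} {v : D.shadow.V}
    (h : ∀ j, f' (D.shadow.att v j) = f (D.shadow.att v j)) {i : ZMod 4}
    (hi : ColorAt (fun j => f (D.shadow.att v j)) i) : ColorAt (fun j => f' (D.shadow.att v j)) i := by
  simpa only [ColorAt, h] using hi

theorem zmod_four_ne (i : ZMod 4) : i + 1 ≠ i ∧ i + 2 ≠ i ∧ i + 3 ≠ i ∧ i + 2 ≠ i + 1 ∧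
    i + 3 ≠ i + 1 ∧ i + 3 ≠ i + 2 := by
  revert i; decide

-- The strand of the half-edge `i` at `v` is on top. Colourings before and after differ only on the
-- lower edge `y` inside the bigon: passing under a strand of colour `c` replaces a colour `b` by
-- `2c - b`, and passing under it again restores `b`.
open Classical in
theorem rigid_erase_bigon_aux {D : Diagram} [Finite D.shadow.V] (hw : D.shadow.WellFormed)
    {v w : D.shadow.V} {i j : ZMod 4} (hvw : v ≠ w)
    (hx : D.shadow.att v i = D.shadow.att w (j + 1))
    (hy : D.shadow.att v (i + 1) = D.shadow.att w j)
    (htv : strand i = D.top v) (htw : strand (j + 1) = D.top w) :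
    D.Rigid A ↔ (D.erase {v, w}).Rigid A := by
  set y := D.shadow.att v (i + 1) with hydef
  have hend : ∀ u l, D.shadow.att u l = y → u = v ∧ l = i + 1 ∨ u = w ∧ l = j := by
    intro u l h
    rcases hw.end_eq (a := (v, i + 1)) (b := (w, j)) (fun h => hvw (Prod.ext_iff.mp h).1) hy
      (c := (u, l)) h with h | h
    · exact Or.inl (Prod.ext_iff.mp h)
    · exact Or.inr (Prod.ext_iff.mp h)
  have nv : ∀ l, l ≠ i + 1 → D.shadow.att v l ≠ y := fun l hl h => by
    rcases hend v l h with h | h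
    · exact hl h.2
    · exact hvw h.1
  have nw : ∀ l, l ≠ j → D.shadow.att w l ≠ y := fun l hl h => by
    rcases hend w l h with h | h
    · exact hvw h.1.symm
    · exact hl h.2
  obtain ⟨i1, i2, i3, i21, i31, i32⟩ := zmod_four_ne i
  obtain ⟨j1, j2, j3, j21, j31, j32⟩ := zmod_four_ne j
  have ev : i + 1 + 2 = i + 3 := by rw [add_assoc]; rfl
  have ej1 : j + 1 + 1 = j + 2 := by rw [add_assoc]; rfl
  have ej2 : j + 1 + 2 = j + 3 := by rw [add_assoc]; rfl
  have ej3 : j + 1 + 3 = j := by rw [add_assoc]; exact add_zero j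
  constructor
  · intro hD f' hf'
    have hopp : ∀ u ∈ ({v, w} : Set D.shadow.V), ∀ l,
        f' (Quot.mk _ (D.shadow.att u (l + 2))) = f' (Quot.mk _ (D.shadow.att u l)) :=
      fun u hu l => congrArg f' (Quot.sound ⟨u, hu, l, rfl, rfl⟩).symm
    have hv := hopp v (Or.inl rfl)
    have hw' := hopp w (Or.inr rfl)
    set c := f' (Quot.mk _ (D.shadow.att v i)) with hc
    set b := f' (Quot.mk _ y) with hb
    let f : D.shadow.E → A := fun x => if x = y then 2 • c - b else f' (Quot.mk _ x)
    have fy : f y = 2 • c - b := if_pos rfl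
    have fne : ∀ x, x ≠ y → f x = f' (Quot.mk _ x) := fun x hx => if_neg hx
    have hcol : D.IsColoring f := by
      intro u l hl
      by_cases huv : u = v
      · subst huv
        refine IsColoring.at_of htv ⟨?_, ?_⟩ l hl
        · simp only
          rw [fne _ (nv _ i21), fne _ (nv _ i1.symm), hv i]
        · simp only
          rw [fne _ (nv _ i31), fne _ (nv _ i1.symm), ← hydef, fy, ← hc, sub_sub_cancel, ← ev, hv (i + 1)]
      · by_cases huw : u = w
        · subst huw
          refine IsColoring.at_of htw ⟨?_, ?_⟩ l hl
          · simp only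
            rw [ej2, fne _ (nw _ j3), fne _ (nw _ j1), ← ej2, hw' (j + 1)]
          · simp only
            rw [ej1, ej3, fne _ (nw _ j2), fne _ (nw _ j1), ← hy, fy, hw' j, ← hx, ← hy]
        · refine isColoring_update_of_notMem (f := fun x => f' (Quot.mk _ x)) (fun l => fne _ fun h => ?_)
            (hf' ⟨u, by rintro (h | h) <;> contradiction⟩ l hl)
          rcases hend u l h with h | h
          · exact huv h.1
          · exact huw h.1
    have hconst := hD f hcol
    have hfx : f (D.shadow.att v i) = c := fne _ (nv _ i1.symm)
    have hbc : b = c := by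
      have := hconst y (D.shadow.att v i)
      rw [fy, hfx, two_smul, sub_eq_iff_eq_add] at this
      exact (add_left_cancel this).symm
    have key : ∀ x, f' (Quot.mk _ x) = c := by
      intro x
      by_cases h : x = y
      · rw [h, ← hb, hbc]
      · rw [← fne x h, hconst x (D.shadow.att v i), hfx]
    rintro ⟨x⟩ ⟨z⟩
    exact (key x).trans (key z).symm
  · intro hD f hf
    set c := f (D.shadow.att v i) with hc
    let g : D.shadow.E → A := fun x => if x = y then 2 • c - f y else f x
    have gy : g y = 2 • c - f y := if_pos rfl
    have gne : ∀ x, x ≠ y → g x = f x := fun x hx => if_neg hx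
    obtain ⟨v1, v2⟩ := hf v i htv
    obtain ⟨w1, w2⟩ := hf w (j + 1) htw
    simp only [ej1, ej2, ej3, ← hx, ← hy] at w1 w2
    simp only [← hydef, ← hc] at v1 v2 w1 w2
    obtain ⟨f', h1, h2⟩ := exists_isColoring_erase (D := D) (B := {v, w}) (f := g)
      (by
        intro u hu l hl
        refine isColoring_update_of_notMem (f := f) (fun l => gne _ fun h => ?_) (hf u l hl)
        rcases hend u l h with h | h
        · exact hu (Or.inl h.1)
        · exact hu (Or.inr h.1))
      (by
        rintro u (rfl | rfl)
        · refine forall_of_two (f := fun j => g (D.shadow.att u j)) (i := i) ?_ ?_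
          · rw [gne _ (nv _ i21), gne _ (nv _ i1.symm), v1]
          · rw [gne _ (nv _ i31), ← hydef, gy, v2]
        · refine forall_of_two (f := fun j => g (D.shadow.att u j)) (i := j) ?_ ?_
          · rw [gne _ (nw _ j2), ← hy, gy, w2, sub_sub_cancel]
          · rw [gne _ (nw _ j3), gne _ (nw _ j1), w1, ← hx])
    have hconst : ∀ x z, g x = g z := fun x z => by
      rw [← h2, ← h2]; exact hD f' h1 _ _
    have hgx : g (D.shadow.att v i) = c := gne _ (nv _ i1.symm)
    have key : ∀ x, f x = c := by
      intro x
      by_cases h : x = y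
      · have := hconst y (D.shadow.att v i)
        rw [gy, hgx, two_smul, sub_eq_iff_eq_add] at this
        rw [h]
        exact (add_left_cancel this).symm
      · rw [← gne x h, hconst x (D.shadow.att v i), hgx]
    exact fun x z => (key x).trans (key z).symm

theorem ne_strand_iff {i : ZMod 4} {a : ZMod 2} : a ≠ strand i ↔ strand (i + 1) = a := by
  rw [strand_add_one]
  generalize strand i = b
  revert a b; decide

/-- If the other side of the bigon is on top, the two corners exchange roles. -/
theorem rigid_erase_bigon {D : Diagram} [Finite D.shadow.V] (hw : D.shadow.WellFormed)
    {v w : D.shadow.V} {i j : ZMod 4} (hvw : v ≠ w)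
    (hx : D.shadow.att v i = D.shadow.att w (j + 1))
    (hy : D.shadow.att v (i + 1) = D.shadow.att w j)
    (ht : D.top v = strand i ↔ D.top w = strand (j + 1)) :
    D.Rigid A ↔ (D.erase {v, w}).Rigid A := by
  by_cases h : D.top v = strand i
  · exact rigid_erase_bigon_aux hw hvw hx hy h.symm (ht.mp h).symm
  · have h1 := ne_strand_iff.mp h
    have h2 : D.top w = strand j := by
      have := ne_strand_iff.mp (fun h' => h (ht.mpr h'))
      rw [strand_add_one, strand_add_one, add_assoc, show (1 + 1 : ZMod 2) = 0 from rfl, add_zero] at this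
      exact this.symm
    rw [Set.pair_comm]
    exact rigid_erase_bigon_aux hw hvw.symm hy.symm hx.symm h2.symm h1

end Diagram

/-! ### Colourings and the third Reidemeister move -/

namespace Diagram

variable {A : Type} [AddCommGroup A]

/-- Two diagrams differ by sliding the strand through `p` and `q` over `r`. -/
structure Slide {V E : Type} (att att' : V → ZMod 4 → E) (p q r : V) (i j k : ZMod 4) : Prop where
  pq : att p i = att q (j + 1)
  qr : att q j = att r (k + 1)
  rp : att r k = att p (i + 1)
  p2 : att' p (i + 2) = att q (j + 1)
  p0 : att' p i = att q (j + 3)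
  q1 : att' q (j + 1) = att p (i + 2)
  q3 : att' q (j + 3) = att p i
  q2 : att' q (j + 2) = att r (k + 1)
  q0 : att' q j = att r (k + 3)
  r1 : att' r (k + 1) = att q (j + 2)
  r3 : att' r (k + 3) = att q j
  r2 : att' r (k + 2) = att p (i + 1)
  r0 : att' r k = att p (i + 3)
  p1 : att' p (i + 1) = att r (k + 2)
  p3 : att' p (i + 3) = att r k
  rest : ∀ v, v ≠ p → v ≠ q → v ≠ r → att' v = att v

/-- Sliding the strand back is again a slide, with the triangle now at the opposite half-edges, so
one direction of invariance suffices. -/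
theorem Slide.symm {V E : Type} {att att' : V → ZMod 4 → E} {p q r : V} {i j k : ZMod 4}
    (h : Slide att att' p q r i j k) : Slide att' att p q r (i + 2) (j + 2) (k + 2) := by
  have a1 : ∀ i : ZMod 4, i + 2 + 1 = i + 3 := fun i => by rw [add_assoc]; rfl
  have a2 : ∀ i : ZMod 4, i + 2 + 2 = i := fun i => by rw [add_assoc]; exact add_zero i
  have a3 : ∀ i : ZMod 4, i + 2 + 3 = i + 1 := fun i => by rw [add_assoc]; rfl
  constructor <;> try simp only [a1, a2, a3]
  · rw [h.p2, h.q3, h.pq]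
  · rw [h.q2, h.r3, h.qr]
  · rw [h.r2, h.p3, h.rp]
  · rw [h.q3]
  · rw [h.q1]
  · rw [h.p0]
  · rw [h.p2]
  · rw [h.r3]
  · rw [h.r1]
  · rw [h.q0]
  · rw [h.q2]
  · rw [h.p3]
  · rw [h.p1]
  · rw [h.r0]
  · rw [h.r2, ← h.rp]
  · exact fun v h1 h2 h3 => (h.rest v h1 h2 h3).symm

-- Only the two sides of the triangle that meet at `r` are recoloured. The new colour of each is
-- obtained from its continuation beyond `r` by reflection in the colour `c` of the moving strand.
open Classical in
theorem Slide.rigid {V E : Type} [Finite V] {att att' : V → ZMod 4 → E} {p q r : V}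
    {i j k : ZMod 4} (h : Slide att att' p q r i j k) {o : V → ZMod 2} (hpq : p ≠ q) (hqr : q ≠ r)
    (hrp : r ≠ p) (hop : strand i = o p) (hoq : strand (j + 1) = o q)
    (hw : Shadow.WellFormed ⟨V, E, att⟩) (hD' : Rigid ⟨⟨V, E, att'⟩, o⟩ A) :
    Rigid ⟨⟨V, E, att⟩, o⟩ A := by
  intro f hf
  have end2 : ∀ u l, att u l = att q j → u = q ∧ l = j ∨ u = r ∧ l = k + 1 := by
    intro u l hu
    rcases hw.end_eq (a := (q, j)) (b := (r, k + 1)) (fun h => hqr (Prod.ext_iff.mp h).1) h.qr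
      (c := (u, l)) hu with h | h
    · exact Or.inl (Prod.ext_iff.mp h)
    · exact Or.inr (Prod.ext_iff.mp h)
  have end3 : ∀ u l, att u l = att r k → u = r ∧ l = k ∨ u = p ∧ l = i + 1 := by
    intro u l hu
    rcases hw.end_eq (a := (r, k)) (b := (p, i + 1)) (fun h => hrp (Prod.ext_iff.mp h).1) h.rp
      (c := (u, l)) hu with h | h
    · exact Or.inl (Prod.ext_iff.mp h)
    · exact Or.inr (Prod.ext_iff.mp h)
  obtain ⟨i1, i2, i3, i21, i31, i32⟩ := zmod_four_ne i
  obtain ⟨j1, j2, j3, j21, j31, j32⟩ := zmod_four_ne j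
  obtain ⟨k1, k2, k3, k21, k31, k32⟩ := zmod_four_ne k
  have a1 : ∀ i : ZMod 4, i + 1 + 1 = i + 2 := fun i => by rw [add_assoc]; rfl
  have a2 : ∀ i : ZMod 4, i + 1 + 2 = i + 3 := fun i => by rw [add_assoc]; rfl
  have a3 : ∀ i : ZMod 4, i + 1 + 3 = i := fun i => by rw [add_assoc]; exact add_zero i
  obtain ⟨hp1, hp2⟩ := hf p i hop
  obtain ⟨hq1, hq2⟩ := hf q (j + 1) hoq
  simp only [a1, a2, a3] at hp1 hp2 hq1 hq2
  rw [← h.pq] at hq1 hq2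
  set c := f (att p i)
  let g : E → A := fun x => if x = att q j then 2 • c - f (att r (k + 3)) else
    if x = att r k then 2 • c - f (att r (k + 2)) else f x
  have ge2 : g (att q j) = 2 • c - f (att r (k + 3)) := if_pos rfl
  have ge3 : g (att r k) = 2 • c - f (att r (k + 2)) := by
    have : att r k ≠ att q j := fun h => by
      rcases end2 r k h with h | h
      · exact hqr h.1.symm
      · exact k1 h.2.symm
    simp only [g, if_neg this, if_true]
  have gne : ∀ u l, ¬ (u = q ∧ l = j ∨ u = r ∧ l = k + 1) → ¬ (u = r ∧ l = k ∨ u = p ∧ l = i + 1) →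
      g (att u l) = f (att u l) := by
    intro u l h1 h2
    have e1 : att u l ≠ att q j := fun h => h1 (end2 u l h)
    have e2 : att u l ≠ att r k := fun h => h2 (end3 u l h)
    simp only [g, if_neg e1, if_neg e2]
  have gp : ∀ l, l ≠ i + 1 → g (att p l) = f (att p l) := fun l hl => gne p l
    (by rintro (⟨h, -⟩ | ⟨h, -⟩); exacts [hpq h, hrp h.symm])
    (by rintro (⟨h, -⟩ | ⟨-, h⟩); exacts [hrp h.symm, hl h])
  have gq : ∀ l, l ≠ j → g (att q l) = f (att q l) := fun l hl => gne q l
    (by rintro (⟨-, h⟩ | ⟨h, -⟩); exacts [hl h, hqr h])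
    (by rintro (⟨h, -⟩ | ⟨h, -⟩); exacts [hqr h, hpq h.symm])
  have gr : ∀ l, l ≠ k → l ≠ k + 1 → g (att r l) = f (att r l) := fun l hl hl' => gne r l
    (by rintro (⟨h, -⟩ | ⟨-, h⟩); exacts [hqr h.symm, hl' h])
    (by rintro (⟨-, h⟩ | ⟨h, -⟩); exacts [hl h, hrp h])
  have hg : IsColoring ⟨⟨V, E, att'⟩, o⟩ g := by
    intro u l hl
    by_cases hup : u = p
    · subst hup
      refine IsColoring.at_of (D := ⟨⟨V, E, att'⟩, o⟩) hop ⟨?_, ?_⟩ l hl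
      · simp only
        rw [h.p2, h.p0, gq _ j1, gq _ j3, hq1, ← h.pq]
      · simp only
        rw [h.p3, h.p1, h.p0, ge3, gr _ k2 k21, gq _ j3, hq1]
    by_cases huq : u = q
    · subst huq
      refine IsColoring.at_of (D := ⟨⟨V, E, att'⟩, o⟩) hoq ⟨?_, ?_⟩ l hl
      · simp only [a2]
        rw [h.q3, h.q1, gp _ i1.symm, gp _ i21, hp1]
      · simp only [a1, a3]
        rw [h.q0, h.q1, h.q2, ← h.qr, ge2, gr _ k3 k31, gp _ i21, hp1, sub_sub_cancel]
    by_cases hur : u = r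
    · subst hur
      rcases strand_eq_or k (o u) with hk | hk
      · obtain ⟨h1, h2⟩ := hf u k hk
        simp only at h1 h2
        refine IsColoring.at_of (D := ⟨⟨V, E, att'⟩, o⟩) hk ⟨?_, ?_⟩ l hl
        · simp only
          rw [h.r2, h.r0, ← h.rp, ge3, gp _ i31, hp2, h1, h.rp]
        · simp only
          rw [h.r3, h.r0, h.r1, ge2, gp _ i31, gq _ j2, hp2, h2, ← h.rp]
          rw [← h.qr, hq2]
          abel
      · obtain ⟨h1, h2⟩ := hf u (k + 1) hk
        simp only [a1, a2, a3] at h1 h2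
        refine IsColoring.at_of (D := ⟨⟨V, E, att'⟩, o⟩) hk ⟨?_, ?_⟩ l hl
        · simp only [a2]
          rw [h.r3, h.r1, ge2, gq _ j2, h1, ← h.qr, hq2, sub_sub_cancel]
        · simp only [a1, a3]
          rw [h.r0, h.r1, h.r2, ← h.rp, gp _ i31, gq _ j2, hp2, ge3, ← h.rp, h2, ← h.qr, hq2]
          abel
    · have e := h.rest u hup huq hur
      have : ∀ l, g (att' u l) = f (att u l) := fun l => by
        rw [e]
        exact gne u l (by rintro (⟨h, -⟩ | ⟨h, -⟩) <;> contradiction)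
          (by rintro (⟨h, -⟩ | ⟨h, -⟩) <;> contradiction)
      have h1 := hf u l hl
      simpa only [ColorAt, this] using h1
  have hconst := hD' g hg
  have hgx : g (att p i) = c := gp _ i1.symm
  have key : ∀ x, f x = c := by
    intro x
    by_cases h2 : x = att q j
    · have h3 : f (att q (j + 2)) = c := by rw [← gq _ j2, ← hgx]; exact hconst _ _
      rw [h3, two_smul] at hq2
      rw [h2, hq2, add_sub_cancel_right]
    by_cases h3 : x = att r k
    · have h4 : f (att p (i + 3)) = c := by rw [← gp _ i31, ← hgx]; exact hconst _ _
      rw [h4, eq_comm, two_smul, sub_eq_iff_eq_add] at hp2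
      rw [h3, h.rp]
      exact (add_left_cancel hp2).symm
    · rw [← hgx, ← hconst x (att p i)]
      simp only [g, if_neg h2, if_neg h3]
  exact fun x y => (key x).trans (key y).symm

theorem Move.rigid_iff {D D' : Diagram} (h : D.Move D') : D.Rigid A ↔ D'.Rigid A := by
  obtain ⟨hD, hD', h | ⟨v, hv, h⟩ | ⟨v, w, i, j, hvw, hx, hy, ht, h⟩ |
    ⟨p, q, r, i, j, k, att', hpq, hqr, hrp, h1, h2, h3, hp, hq, p2, p0, q1, q3, q2, q0, r1, r3, r2,
      r0, p1, p3, rest, h⟩⟩ := h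
  · exact h.rigid_iff
  · exact (rigid_erase_loop hv).trans h.rigid_iff
  · have := hD.finite
    exact (rigid_erase_bigon hD.wellFormed hvw hx hy ht).trans h.rigid_iff
  · have hs : Slide D.shadow.att att' p q r i j k :=
      ⟨h1, h2, h3, p2, p0, q1, q3, q2, q0, r1, r3, r2, r0, p1, p3, rest⟩
    have := hD.finite
    obtain ⟨e⟩ := Shadow.Erasure.nonempty_of_iso h.symm.shadow
    rw [← h.rigid_iff]
    constructor
    · refine hs.symm.rigid hpq hqr hrp ?_ ?_ (e.isKnotShadow hD').wellFormed
      · rw [strand_add_two, hp]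
      · rw [add_right_comm, strand_add_two, hq]
    · exact hs.rigid hpq hqr hrp hp.symm hq.symm hD.wellFormed

/-- Every colouring of a diagram of the unknot is constant. -/
theorem IsUnknot.rigid {D : Diagram} (h : D.IsUnknot) : D.Rigid A := by
  have key : ∀ D D', Relation.EqvGen Move D D' → (D.Rigid A ↔ D'.Rigid A) := by
    intro D D' h
    induction h with
    | rel _ _ h => exact h.rigid_iff
    | refl _ => rfl
    | symm _ _ _ ih => exact ih.symm
    | trans _ _ _ _ _ ih1 ih2 => exact ih1.trans ih2
  exact (key _ _ h).mpr fun _ _ _ _ => rfl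

end Diagram

/-! The colouring of a rational tangle. -/

/-- The sign by which the choice of an upper strand acts on colour differences. -/
def sgn (a : ZMod 2) : ℤ := if a = 0 then 1 else -1

namespace TangleShadow

/-- The horizontal and vertical differences of colours in a tangle with resolved crossings. -/
def slope : (w : List Bool) → ((build w).V → ZMod 2) → ℤ × ℤ
  | [], _ => (1, 0)
  | true :: w, o =>
    let s := slope w (fun v => o (some v))
    (s.1 + sgn (o none) * s.2, s.2)
  | false :: w, o => (slope w o).swap

theorem slope_isCoprime : ∀ w o, IsCoprime (slope w o).1 (slope w o).2
  | [], _ => isCoprime_one_left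
  | true :: w, o => by
    have := slope_isCoprime w (fun v => o (some v))
    exact IsCoprime.add_mul_right_left this _
  | false :: w, o => (slope_isCoprime w o).symm

/-- The four ends carry the colours `0`, `p`, `q`, `p + q`. A crossing on the right reflects one of
the two right-hand colours in the other, which changes `p` by `q` or `-q`. -/
theorem exists_coloring : ∀ w (o : (build w).V → ZMod 2), ∃ f : (build w).E → ℤ,
    (∀ v i, strand i = o v → ColorAt (fun j => f ((build w).att v j)) i) ∧
    f (build w).nw = 0 ∧ f (build w).ne = (slope w o).1 ∧ f (build w).sw = (slope w o).2 ∧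
    f (build w).se = (slope w o).1 + (slope w o).2
  | [], _ => ⟨fun b : Bool => if b then 1 else 0, fun v => v.elim, rfl, rfl, rfl, rfl⟩
  | true :: w, o => by
    obtain ⟨f, hf, hnw, hne, hsw, hse⟩ := exists_coloring w (fun v => o (some v))
    set s := slope w (fun v => o (some v)) with hs
    let f' : (build w).E ⊕ Bool → ℤ := Sum.elim f fun b =>
      if b then s.1 + sgn (o none) * s.2 else s.1 + sgn (o none) * s.2 + s.2
    refine ⟨f', ?_, hnw, rfl, hsw, rfl⟩
    rintro (_ | v) i hi
    · have e0 : f' ((build w).twist.att none 0) = s.1 + sgn (o none) * s.2 := rfl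
      have e1 : f' ((build w).twist.att none 1) = s.1 := hne
      have e2 : f' ((build w).twist.att none 2) = s.1 + s.2 := hse
      have e3 : f' ((build w).twist.att none 3) = s.1 + sgn (o none) * s.2 + s.2 := rfl
      have ho : o none = 0 ∨ o none = 1 := by generalize o none = a; revert a; decide
      rcases ho with ho | ho
      · have hs1 : sgn (o none) = 1 := by rw [ho]; rfl
        have : ColorAt (fun j => f' ((build w).twist.att none j)) 0 := by
          constructor
          · exact e2.trans (by simp only [e0, hs1]; ring)
          · refine e3.trans ?_
            change _ = 2 • f' ((build w).twist.att none 0) - f' ((build w).twist.att none 1)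
            rw [e0, e1, hs1]; simp; ring
        exact this.of_strand_eq (hi.trans ho)
      · have hs1 : sgn (o none) = -1 := by rw [ho]; rfl
        have : ColorAt (fun j => f' ((build w).twist.att none j)) 1 := by
          constructor
          · exact e3.trans (by simp only [e1, hs1]; ring)
          · refine e0.trans ?_
            change _ = 2 • f' ((build w).twist.att none 1) - f' ((build w).twist.att none 2)
            rw [e1, e2, hs1]; simp; ring
        exact this.of_strand_eq (hi.trans ho)
    · exact hf v i hi
  | false :: w, o => by
    obtain ⟨f, hf, hnw, hne, hsw, hse⟩ := exists_coloring w o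
    refine ⟨f, ?_, hnw, hsw, hne, hse.trans (add_comm _ _)⟩
    intro v i hi
    obtain ⟨h1, h2⟩ := hf v (-i) ((strand_neg i).trans hi)
    have e : ∀ i : ZMod 4, -(i + 2) = -i + 2 ∧ -(i + 3) = -i + 1 ∧ -(i + 1) = -i + 3 := by decide
    obtain ⟨e2, e3, e1⟩ := e i
    constructor
    · change f ((build w).att v (-(i + 2))) = f ((build w).att v (-i))
      rw [e2]; exact h1
    · change f ((build w).att v (-(i + 3))) =
        2 • f ((build w).att v (-i)) - f ((build w).att v (-(i + 1)))
      simp only at h2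
      rw [e1, e3, h2]; abel

/-- The colouring of the tangle descends to its closure modulo the horizontal difference. -/
theorem exists_coloring_close (w : List Bool) (o : (build w).V → ZMod 2) (m : ℕ)
    (hm : (m : ℤ) ∣ (slope w o).1) : ∃ f : (build w).close.E → ZMod m,
    Diagram.IsColoring ⟨(build w).close, o⟩ f ∧
    f (Quot.mk _ (build w).nw) = 0 ∧ f (Quot.mk _ (build w).sw) = (slope w o).2 := by
  obtain ⟨f, hf, hnw, hne, hsw, hse⟩ := exists_coloring w o
  have hp : (((slope w o).1 : ℤ) : ZMod m) = 0 := (ZMod.intCast_zmod_eq_zero_iff_dvd _ _).mpr hm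
  refine ⟨Quot.lift (fun x => ((f x : ℤ) : ZMod m)) ?_, ?_, ?_, ?_⟩
  · rintro x y (⟨rfl, rfl⟩ | ⟨rfl, rfl⟩)
    · rw [hnw, hne, hp, Int.cast_zero]
    · rw [hsw, hse, Int.cast_add, hp, zero_add]
  · intro v i hi
    obtain ⟨h1, h2⟩ := hf v i hi
    simp only at h1 h2
    constructor
    · exact congrArg _ h1
    · refine (congrArg (Int.cast : ℤ → ZMod m) h2).trans ?_
      rw [Int.cast_sub, two_smul, Int.cast_add, two_smul]
      rfl
  · exact (congrArg (Int.cast : ℤ → ZMod m) hnw).trans Int.cast_zero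
  · exact congrArg (Int.cast : ℤ → ZMod m) hsw

/-- If the closure is an unknot then the horizontal difference is `1` or `-1`. -/
theorem natAbs_slope_eq_one {w : List Bool} {o : (build w).V → ZMod 2}
    (h : Diagram.IsUnknot ⟨(build w).close, o⟩) : (slope w o).1.natAbs = 1 := by
  -- If the horizontal difference vanishes, the modulus is `0` and the colours are integers; the
  -- argument still applies.
  obtain ⟨f, hf, h1, h2⟩ := exists_coloring_close w o (slope w o).1.natAbs
    (Int.natAbs_dvd.mpr dvd_rfl)
  have h3 := h.rigid f hf (Quot.mk _ (build w).sw) (Quot.mk _ (build w).nw)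
  rw [h1, h2, ZMod.intCast_zmod_eq_zero_iff_dvd, Int.natAbs_dvd] at h3
  exact Int.isUnit_iff_natAbs_eq.mp ((slope_isCoprime w o).isUnit_of_dvd' dvd_rfl h3)

/-- Modulo `2` the crossing relation says that colours do not change along a strand, so on a knot
they are constant. An even horizontal difference would then make the vertical one even too, against
coprimality. -/
theorem odd_slope {w : List Bool} (h : (build w).close.SingleComponent)
    (o : (build w).V → ZMod 2) : Odd (slope w o).1 := by
  by_contra heven
  rw [Int.not_odd_iff_even] at heven
  obtain ⟨f, hf, h1, h2⟩ := exists_coloring_close w o 2 (even_iff_two_dvd.mp heven)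
  have hopp : ∀ v i, f ((build w).close.att v (i + 2)) = f ((build w).close.att v i) := by
    intro v i
    rcases strand_eq_or i (o v) with hi | hi
    · exact (hf v i hi).1
    · have := (hf v (i + 1) hi).2
      have e : i + 1 + 3 = i := by rw [add_assoc]; exact add_zero i
      have e' : i + 1 + 1 = i + 2 := by rw [add_assoc]; rfl
      simp only [e, e'] at this
      rw [this, two_smul]
      generalize f ((build w).close.att v (i + 1)) = a
      generalize f ((build w).close.att v (i + 2)) = b
      revert a b; decide
  have key : ∀ x y, Relation.EqvGen ((build w).close.Opposite Set.univ) x y → f x = f y := by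
    intro x y h
    induction h with
    | rel x y h => obtain ⟨v, -, i, rfl, rfl⟩ := h; exact (hopp v i).symm
    | refl x => rfl
    | symm x y _ ih => exact ih.symm
    | trans x y z _ _ ih1 ih2 => exact ih1.trans ih2
  have h3 := key _ _ (h.2 (Quot.mk _ (build w).sw) (Quot.mk _ (build w).nw))
  rw [h1, h2] at h3
  have h4 : (2 : ℤ) ∣ (slope w o).2 := by
    have := (ZMod.intCast_zmod_eq_zero_iff_dvd _ 2).mp h3
    exact_mod_cast this
  have := (slope_isCoprime w o).isUnit_of_dvd' (even_iff_two_dvd.mp heven) h4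
  exact absurd this (by decide)

end TangleShadow

/-! ### Loops and bigons in the Unknotter's game -/

open ResolvingGame

namespace Shadow

/-- `v` and `w` are the corners of a bigon face, and its sides lie on different strands at `v` and
`w` in the numbering of the half-edges. -/
def Bigon (S : Shadow) (v w : S.V) : Prop :=
  ∃ i j : ZMod 4, S.att v i = S.att w (j + 1) ∧ S.att v (i + 1) = S.att w j ∧
    strand i + strand (j + 1) = 1

theorem Bigon.symm {S : Shadow} {v w : S.V} (h : S.Bigon v w) : S.Bigon w v := by
  obtain ⟨i, j, h1, h2, h3⟩ := h
  refine ⟨j, i, h2.symm, h1.symm, ?_⟩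
  rw [strand_add_one] at h3 ⊢
  linear_combination h3

theorem IsLoop.mirror {S : Shadow} {v : S.V} (h : S.IsLoop v) : S.mirror.IsLoop v := by
  obtain ⟨i, h⟩ := h
  refine ⟨-(i + 1), ?_⟩
  change S.att v (- -(i + 1)) = S.att v (-(-(i + 1) + 1))
  rw [neg_neg, show -(-(i + 1) + 1) = i by ring, h]

theorem Bigon.mirror {S : Shadow} {v w : S.V} (h : S.Bigon v w) : S.mirror.Bigon v w := by
  obtain ⟨i, j, h1, h2, h3⟩ := h
  refine ⟨-(i + 1), -(j + 1), ?_, ?_, ?_⟩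
  · change S.att v (- -(i + 1)) = S.att w (-(-(j + 1) + 1))
    rw [neg_neg, show -(-(j + 1) + 1) = j by ring, h2]
  · change S.att v (-(-(i + 1) + 1)) = S.att w (- -(j + 1))
    rw [neg_neg, show -(-(i + 1) + 1) = i by ring, h1]
  · rw [show -(j + 1) + 1 = -j by ring, strand_neg, strand_neg, ← h3, strand_add_one, strand_add_one]
    ring

/-- The Unknotter can win on `S` with any number of additional irrelevant crossings, moving last if
`ε = 0` and not moving last if `ε = 1`. -/
def Unknottable (ε : ℕ) (S : Shadow) : Prop :=
  WinAll ε S.V fun o => Diagram.IsUnknot ⟨S, o⟩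

variable {S S' : Shadow}

theorem Erasure.diagram_iso (e : Erasure S ∅ S') (o : S.V → ZMod 2) :
    Diagram.Iso ⟨S, o⟩ (e.diagram o) := by
  let f := Equiv.ofBijective e.k e.k_bijective
  refine ⟨f.symm, Equiv.ofBijective e.g ⟨e.g_injective, e.g_surjective⟩, fun v => e.r (f.symm v),
    fun v i => ?_, fun v => ?_⟩
  · have h := e.att_eq (f.symm v) i
    rw [show e.k (f.symm v) = v from f.apply_symm_apply v] at h
    exact h.symm
  · change o (e.k (f.symm v)) + _ = _
    rw [show e.k (f.symm v) = v from f.apply_symm_apply v]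
    rfl

theorem isUnknot_of_move {D D' : Diagram} (h : D.Move D') (h' : D'.IsUnknot) : D.IsUnknot :=
  .trans _ _ _ (.rel _ _ h) h'

theorem Erasure.isUnknot (e : Erasure S ∅ S') (h : S.IsKnotShadow) {o : S.V → ZMod 2}
    (h' : (e.diagram o).IsUnknot) : Diagram.IsUnknot ⟨S, o⟩ :=
  isUnknot_of_move ⟨h, e.isKnotShadow h, Or.inl (e.diagram_iso o)⟩ h'

theorem Erasure.isUnknot_of_isLoop {v : S.V} (e : Erasure S {v} S') (h : S.IsKnotShadow)
    (hS' : S'.IsKnotShadow) (hv : S.IsLoop v) {o : S.V → ZMod 2} (h' : (e.diagram o).IsUnknot) :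
    Diagram.IsUnknot ⟨S, o⟩ :=
  isUnknot_of_move ⟨h, hS', Or.inr (Or.inl ⟨v, hv, e.erase_diagram_iso o⟩)⟩ h'

/-- The condition on strands in `Bigon` turns different values at the two corners into one side of
the bigon being on top at both. -/
theorem Erasure.isUnknot_of_bigon {v w : S.V} (e : Erasure S {v, w} S') (h : S.IsKnotShadow)
    (hS' : S'.IsKnotShadow) (hvw : v ≠ w) (hb : S.Bigon v w) {o : S.V → ZMod 2} (ho : o v ≠ o w)
    (h' : (e.diagram o).IsUnknot) : Diagram.IsUnknot ⟨S, o⟩ := by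
  obtain ⟨i, j, h1, h2, h3⟩ := hb
  refine isUnknot_of_move ⟨h, hS', Or.inr (Or.inr (Or.inl
    ⟨v, w, i, j, hvw, h1, h2, ?_, e.erase_diagram_iso o⟩))⟩ h'
  revert ho h3
  change o v ≠ o w → _ → (o v = _ ↔ o w = _)
  generalize o v = a
  generalize o w = b
  generalize strand i = c
  generalize strand (j + 1) = d
  revert a b c d
  decide

theorem Erasure.unknottable {ε : ℕ} (e : Erasure S ∅ S') (h : S.IsKnotShadow)
    (h' : S'.Unknottable ε) : S.Unknottable ε :=
  WinAll.transport e.k_bijective (fun v => strand (e.r v)) (fun _ ho => e.isUnknot h ho) h'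

/-- However a loop is resolved, Reidemeister I removes it, so its crossing is irrelevant for the
game. -/
theorem Erasure.unknottable_of_isLoop {ε : ℕ} {v : S.V} (e : Erasure S {v} S') (h : S.IsKnotShadow)
    (hS' : S'.IsKnotShadow) (hv : S.IsLoop v) (h' : S'.Unknottable ε) : S.Unknottable ε :=
  have := h.finite
  WinAll.dummy e.k_injective e.range_k (fun v => strand (e.r v))
    (fun _ ho => e.isUnknot_of_isLoop h hS' hv ho) h'

/-- A move at one corner is answered by the opposite value at the other; then Reidemeister II
removes both. -/
theorem Erasure.unknottable_of_bigon {v w : S.V} (e : Erasure S {v, w} S') (h : S.IsKnotShadow)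
    (hS' : S'.IsKnotShadow) (hvw : v ≠ w) (hb : S.Bigon v w) (h' : S'.Unknottable 0) :
    S.Unknottable 0 :=
  have := h.finite
  WinAll.pair e.k_injective hvw e.range_k (fun v => strand (e.r v))
    (fun _ hne ho => e.isUnknot_of_bigon h hS' hvw hb hne ho) h'

end Shadow

/-! ### The Unknotter wins when moving last -/

namespace TangleShadow

/-- Apply operations to a tangle, the last one coming first. -/
def ops : List Bool → TangleShadow → TangleShadow
  | [], t => t
  | true :: u, t => (ops u t).twist
  | false :: u, t => (ops u t).reflect

theorem build_append : ∀ u v, build (u ++ v) = ops u (build v)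
  | [], _ => rfl
  | true :: u, v => congrArg twist (build_append u v)
  | false :: u, v => congrArg reflect (build_append u v)

/-- The crossings of the inner tangle. -/
def inner {t : TangleShadow} : (u : List Bool) → t.V → (ops u t).V
  | [] => id
  | true :: u => fun v => some (inner u v)
  | false :: u => fun v => inner u v

theorem inner_injective {t : TangleShadow} : ∀ u, Function.Injective (inner (t := t) u)
  | [] => Function.injective_id
  | true :: u => fun _ _ h => inner_injective u (Option.some.inj h)
  | false :: u => inner_injective u

/-- Operations applied after removing crossings. -/
def Erasure.ops {t t' : TangleShadow} {A : Set t.V} (e : Erasure t A t') :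
    (u : List Bool) → Erasure (ops u t) (inner u '' A) (ops u t')
  | [] => cast (by rw [show inner (t := t) [] '' A = A from Set.image_id A]; rfl) e
  | true :: u => cast (by
      rw [show inner (t := t) (true :: u) '' A = some '' (inner u '' A) by
        rw [Set.image_image]; rfl]
      rfl) (e.ops u).twist
  | false :: u => (e.ops u).reflect

theorem isLoop_inner {t : TangleShadow} {v : t.V} (h : t.toShadow.IsLoop v) :
    ∀ u, (ops u t).toShadow.IsLoop (inner u v)
  | [] => h
  | true :: u => (isLoop_inner h u).imp fun _ h => congrArg Sum.inl h
  | false :: u => (isLoop_inner h u).mirror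

theorem bigon_twist {t : TangleShadow} {v w : t.V} (h : t.toShadow.Bigon v w) :
    t.twist.toShadow.Bigon (some v) (some w) := by
  obtain ⟨i, j, h1, h2, h3⟩ := h
  exact ⟨i, j, congrArg Sum.inl h1, congrArg Sum.inl h2, h3⟩

theorem bigon_inner {t : TangleShadow} {v w : t.V} (h : t.toShadow.Bigon v w) :
    ∀ u, (ops u t).toShadow.Bigon (inner u v) (inner u w)
  | [] => h
  | true :: u => bigon_twist (bigon_inner h u)
  | false :: u => (bigon_inner h u).mirror

theorem isLoop_close {t : TangleShadow} {v : t.V} (h : t.toShadow.IsLoop v) : t.close.IsLoop v := by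
  obtain ⟨i, h⟩ := h
  exact ⟨i, congrArg (Quot.mk _) h⟩

theorem bigon_close {t : TangleShadow} {v w : t.V} (h : t.toShadow.Bigon v w) :
    t.close.Bigon v w := by
  obtain ⟨i, j, h1, h2, h3⟩ := h
  exact ⟨i, j, congrArg (Quot.mk _) h1, congrArg (Quot.mk _) h2, h3⟩

theorem bigon_twist_twist (t : TangleShadow) :
    t.twist.twist.toShadow.Bigon none (some none) :=
  ⟨1, 3, rfl, rfl, by decide⟩

theorem isLoop_curl : base.twist.toShadow.IsLoop none := ⟨1, rfl⟩

theorem isUnknot_of_isEmpty {D : Diagram} (h : D.shadow.IsKnotShadow) [IsEmpty D.shadow.V] :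
    D.IsUnknot := by
  have heq : ∀ x y : D.shadow.E, x = y := by
    intro x y
    induction h.singleComponent.2 x y with
    | rel x y h => exact (IsEmpty.false h.choose).elim
    | refl x => rfl
    | symm x y _ ih => exact ih.symm
    | trans x y z _ _ ih1 ih2 => exact ih1.trans ih2
  have : Unique D.shadow.E :=
    { default := h.singleComponent.1.some, uniq := fun x => heq _ _ }
  refine .rel _ _ ⟨h, ?_, Or.inl ⟨Equiv.equivOfIsEmpty _ Empty, Equiv.ofUnique _ Unit,
    fun v => isEmptyElim v, fun v => isEmptyElim v, fun v => isEmptyElim v⟩⟩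
  refine ⟨inferInstanceAs (Finite Empty), fun x => Or.inr ?_,
    ⟨⟨()⟩, fun x y => .refl _⟩, Or.inl (inferInstanceAs (IsEmpty Empty))⟩
  have : IsEmpty {d : Diagram.circle.shadow.V × ZMod 4 // Diagram.circle.shadow.att d.1 d.2 = x} :=
    ⟨fun d => Empty.elim d.1.1⟩
  exact Nat.card_of_isEmpty

theorem unknottable_of_isEmpty {ε : ℕ} {S : Shadow} (h : S.IsKnotShadow) [IsEmpty S.V] :
    S.Unknottable ε :=
  WinAll.of_forall fun o => isUnknot_of_isEmpty (D := ⟨S, o⟩) h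

/-- Removing the only crossing of the closure. -/
def capCrossing : Shadow.Erasure base.reflect.cap {none} base.close :=
  .ofSection (fun v => v.elim) (Quot.mk _) (fun v => v.elim)
    (fun _ => true) (fun v => v.elim)
    (fun v => match v with
      | none => ⟨fun ⟨v, _⟩ => v.elim, fun h => (h rfl).elim⟩
      | some v => v.elim)
    (by
      have : Quot.mk base.Joined false = Quot.mk _ true := Quot.sound (Or.inl ⟨rfl, rfl⟩)
      rintro ⟨_ | _⟩
      · exact this.symm
      · rfl)
    (by
      have : Quot.mk base.Joined false = Quot.mk _ true := Quot.sound (Or.inl ⟨rfl, rfl⟩)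
      rintro v rfl
      exact forall_zmod_four this this this.symm this.symm)
    (fun x => match x with
      | false => .rel _ _ ⟨none, rfl, 0, rfl, rfl⟩
      | true => .refl _)
    (fun v => v.elim)

/-- The closure is a capped tangle whose only crossing, the capping one, is a loop; removing it
leaves the circle. -/
theorem unknottable_crossing {ε : ℕ} (h : base.reflect.twist.close.SingleComponent) :
    base.reflect.twist.close.Unknottable ε := by
  have h1 := close_isKnotShadow [true, false] h
  have e := closeTwist base.reflect
  have h2 := e.isKnotShadow h1
  have h3 := close_isKnotShadow [] (capCrossing.singleComponent h2.singleComponent)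
  have : IsEmpty (build []).close.V := inferInstanceAs (IsEmpty Empty)
  exact e.unknottable h1 (capCrossing.unknottable_of_isLoop h2 h3 ⟨0, rfl⟩
    (unknottable_of_isEmpty (S := (build []).close) h3))

variable {t t' : TangleShadow} {ε : ℕ}

/-- Lets a rewriting of the inner tangle take effect underneath the later operations `u`. -/
theorem Erasure.unknottable_ops {v v' : List Bool} (e : Erasure (build v) ∅ (build v'))
    (u : List Bool) (h : (build (u ++ v)).close.SingleComponent)
    (h' : (build (u ++ v')).close.SingleComponent → (build (u ++ v')).close.Unknottable ε) :
    (build (u ++ v)).close.Unknottable ε := by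
  have hk := close_isKnotShadow _ h
  rw [build_append] at h hk h' ⊢
  have e' : Shadow.Erasure (TangleShadow.ops u (build v)).close ∅ (TangleShadow.ops u (build v')).close :=
    cast (by rw [Set.image_empty]; rfl) (e.ops u).close
  exact e'.unknottable hk (h' (e'.singleComponent h))

theorem Erasure.unknottable_ops_of_isLoop {v v' : List Bool} {x : (build v).V}
    (e : Erasure (build v) {x} (build v')) (hx : (build v).toShadow.IsLoop x)
    (u : List Bool) (h : (build (u ++ v)).close.SingleComponent)
    (h' : (build (u ++ v')).close.SingleComponent → (build (u ++ v')).close.Unknottable ε) :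
    (build (u ++ v)).close.Unknottable ε := by
  have hk := close_isKnotShadow _ h
  have hk' := close_isKnotShadow (u ++ v')
  rw [build_append] at h hk h' hk' ⊢
  have e' : Shadow.Erasure (TangleShadow.ops u (build v)).close {inner u x}
      (TangleShadow.ops u (build v')).close :=
    cast (by rw [Set.image_singleton]; rfl) (e.ops u).close
  have hc := e'.singleComponent h
  exact e'.unknottable_of_isLoop hk (hk' hc) (isLoop_close (isLoop_inner hx u)) (h' hc)

theorem Erasure.unknottable_ops_of_bigon {v v' : List Bool} {x y : (build v).V}
    (e : Erasure (build v) {x, y} (build v')) (hxy : x ≠ y) (hx : (build v).toShadow.Bigon x y)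
    (u : List Bool) (h : (build (u ++ v)).close.SingleComponent)
    (h' : (build (u ++ v')).close.SingleComponent → (build (u ++ v')).close.Unknottable 0) :
    (build (u ++ v)).close.Unknottable 0 := by
  have hk := close_isKnotShadow _ h
  have hk' := close_isKnotShadow (u ++ v')
  rw [build_append] at h hk h' hk' ⊢
  have e' : Shadow.Erasure (TangleShadow.ops u (build v)).close {inner u x, inner u y}
      (TangleShadow.ops u (build v')).close :=
    cast (by rw [Set.image_pair]; rfl) (e.ops u).close
  have hc := e'.singleComponent h
  exact e'.unknottable_of_bigon hk (hk' hc) (fun h => hxy (inner_injective u h))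
    (bigon_close (bigon_inner hx u)) (h' hc)

/-- The Unknotter wins when moving last. -/
theorem unknottable_last (w : List Bool) (h : (build w).close.SingleComponent) :
    (build w).close.Unknottable 0 := by
  induction hn : w.length using Nat.strong_induction_on generalizing w with | _ n ih
  -- The word is consumed from its right end, that is, from the innermost operations.
  obtain rfl | ⟨u, x, rfl⟩ := w.eq_nil_or_concat'
  · have : IsEmpty (build []).close.V := inferInstanceAs (IsEmpty Empty)
    exact unknottable_of_isEmpty (close_isKnotShadow [] h)
  simp only [List.length_append, List.length_singleton] at hn
  cases x
  · obtain rfl | ⟨u, x, rfl⟩ := u.eq_nil_or_concat'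
    · exact (not_singleComponent_base_reflect h).elim
    simp only [List.length_append, List.length_singleton] at hn
    cases x
    · have e : build (u ++ [false] ++ [false]) = build u := by
        rw [List.append_assoc, build_append]
        change TangleShadow.ops u base.reflect.reflect = _
        rw [reflect_reflect, ← List.append_nil u, build_append, List.append_nil]
        rfl
      rw [e] at h ⊢
      exact ih _ (by omega) u h rfl
    · obtain rfl | ⟨u, x, rfl⟩ := u.eq_nil_or_concat'
      · exact unknottable_crossing h
      simp only [List.length_append, List.length_singleton] at hn
      cases x
      · rw [List.append_assoc, List.append_assoc] at h ⊢
        exact reflectCrossing.unknottable_ops (v := [false, true, false]) (v' := [true, false]) u h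
          fun h' => ih _ (by simp; omega) _ h' rfl
      · rw [List.append_assoc, List.append_assoc] at h ⊢
        exact (untwistTwice base.reflect).unknottable_ops_of_bigon (v := [true, true, false])
          (v' := [false]) (fun h => by cases h) (bigon_twist_twist _) u h
          fun h' => ih _ (by simp; omega) _ h' rfl
  -- A twist applied directly to the starting tangle is a loop.
  · exact curlBase.unknottable_ops_of_isLoop (v := [true]) (v' := []) isLoop_curl u h
      fun h' => ih _ (by simp; omega) _ h' rfl

end TangleShadow

/-! ### The Unknotter on odd-even shadows -/

open ResolvingGame

namespace TangleShadow

/-- Rewriting the set of removed crossings. -/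
def Erasure.congr {t t' : TangleShadow} {A B : Set t.V} (e : Erasure t A t') (h : A = B) :
    Erasure t B t' := h ▸ e

/-- `x` together with another crossing can be removed from a bigon, leaving `t'`. -/
def Cancels (t : TangleShadow) (x : t.V) (t' : TangleShadow) : Prop :=
  ∃ y, x ≠ y ∧ t.toShadow.Bigon x y ∧ Nonempty (Erasure t {x, y} t')

theorem Cancels.twist {t t' : TangleShadow} {x : t.V} (h : t.Cancels x t') :
    t.twist.Cancels (some x) t'.twist := by
  obtain ⟨y, hxy, hb, ⟨e⟩⟩ := h
  exact ⟨some y, fun h => hxy (Option.some.inj h), bigon_twist hb,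
    ⟨e.twist.congr (Set.image_pair _ _ _)⟩⟩

theorem Cancels.reflect {t t' : TangleShadow} {x : t.V} (h : t.Cancels x t') :
    t.reflect.Cancels x t'.reflect := by
  obtain ⟨y, hxy, hb, ⟨e⟩⟩ := h
  exact ⟨y, hxy, hb.mirror, ⟨e.reflect⟩⟩

theorem Cancels.ops {t t' : TangleShadow} {x : t.V} (h : t.Cancels x t') :
    ∀ u, (ops u t).Cancels (inner u x) (ops u t')
  | [] => h
  | true :: u => (h.ops u).twist
  | false :: u => (h.ops u).reflect

theorem cancels_none (t : TangleShadow) : t.twist.twist.Cancels none t :=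
  ⟨some none, fun h => (by cases h), bigon_twist_twist t, ⟨t.untwistTwice⟩⟩

theorem cancels_some_none (t : TangleShadow) : t.twist.twist.Cancels (some none) t :=
  ⟨none, fun h => (by cases h), (bigon_twist_twist t).symm,
    ⟨t.untwistTwice.congr (Set.pair_comm _ _)⟩⟩

/-- The operations building a rational tangle from its numbers of twists, the last coming first. -/
def word : List ℕ → List Bool
  | [] => []
  | k :: α => List.replicate k true ++ false :: word α

theorem ops_replicate (t : TangleShadow) : ∀ k, ops (List.replicate k true) t = twist^[k] t
  | 0 => rfl
  | k + 1 => by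
    rw [Function.iterate_succ_apply', ← ops_replicate t k]
    rfl

/-- `word` lists the rows from the outside inwards, hence the reversal. -/
theorem rational_eq (a : List ℕ) : rational a = build (word a.reverse) := by
  induction a using List.reverseRecOn with
  | nil => rfl
  | append_singleton a k ih =>
    rw [List.reverse_append, rational, List.foldl_append]
    change twist^[k] (rational a).reflect = build (List.replicate k true ++ false :: word a.reverse)
    rw [build_append, ops_replicate, ih]
    rfl

theorem word_append : ∀ α β, word (α ++ β) = word α ++ word β
  | [], _ => rfl
  | k :: α, β => by simp [word, word_append α β]

theorem card_build : ∀ w, Nat.card (build w).V = w.count true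
  | [] => Nat.card_of_isEmpty (α := Empty)
  | true :: w => by
    rw [List.count_cons_self, ← card_build w]
    exact Finite.card_option (α := (build w).V)
  | false :: w => by
    rw [List.count_cons_of_ne (by decide), ← card_build w]
    rfl

theorem count_word : ∀ α, (word α).count true = α.sum
  | [] => rfl
  | k :: α => by simp [word, count_word α]

/-- Each crossing of a row of at least two crossings has a neighbour in the row. -/
theorem cancels_replicate (t : TangleShadow) : ∀ (k : ℕ) (x : (ops (List.replicate k true) t).V),
    (∃ z, x = inner _ z) ∨ k = 1 ∨
      ∃ l, k = l + 2 ∧ (ops (List.replicate k true) t).Cancels x (ops (List.replicate l true) t)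
  | 0, x => Or.inl ⟨x, rfl⟩
  | 1, _ => Or.inr (Or.inl rfl)
  | k + 2, none => Or.inr (Or.inr ⟨k, rfl, cancels_none _⟩)
  | k + 2, some x => by
    rcases cancels_replicate t (k + 1) x with ⟨z, rfl⟩ | h | ⟨l, hl, h⟩
    · exact Or.inl ⟨z, rfl⟩
    · obtain rfl : k = 0 := by omega
      cases x with
      | none => exact Or.inr (Or.inr ⟨0, rfl, cancels_some_none t⟩)
      | some z => exact Or.inl ⟨z, rfl⟩
    · obtain rfl : k = l + 1 := by omega
      exact Or.inr (Or.inr ⟨l + 1, rfl, h.twist⟩)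

/-- If no row of crossings has length one, then every crossing has a neighbour in its row. -/
theorem cancels_of_one_notMem : ∀ (α : List ℕ), 1 ∉ α → ∀ x : (build (word α)).V,
    ∃ β k γ, α = β ++ (k + 2) :: γ ∧ (build (word α)).Cancels x (build (word (β ++ k :: γ)))
  | [], _, x => Empty.elim x
  | k :: α, hα, x => by
    have hk : k ≠ 1 := fun h => hα (h ▸ List.mem_cons_self)
    have e : ∀ k, build (word (k :: α)) = ops (List.replicate k true) (build (word α)).reflect :=
      fun k => build_append _ _
    have key : ∀ (x : (ops (List.replicate k true) (build (word α)).reflect).V),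
        ∃ β l γ, k :: α = β ++ (l + 2) :: γ ∧
          (ops (List.replicate k true) (build (word α)).reflect).Cancels x
            (build (word (β ++ l :: γ))) := by
      intro x
      rcases cancels_replicate _ k x with ⟨z, rfl⟩ | h | ⟨l, rfl, h⟩
      · obtain ⟨β, l, γ, rfl, h⟩ :=
          cancels_of_one_notMem α (fun h => hα (List.mem_cons_of_mem _ h)) z
        refine ⟨k :: β, l, γ, rfl, ?_⟩
        have := h.reflect.ops (List.replicate k true)
        rw [List.cons_append, show build (word (k :: (β ++ l :: γ))) =
          ops (List.replicate k true) (build (word (β ++ l :: γ))).reflect from build_append _ _]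
        exact this
      · exact (hk h).elim
      · refine ⟨[], l, α, rfl, ?_⟩
        rw [List.nil_append, e]
        exact h
    revert x
    rw [e k]
    exact key

/-- Exactly one number is odd, and it is the first or the last one. -/
def OddEven (α : List ℕ) : Prop :=
  ∃ n, α.map (· % 2) = 1 :: List.replicate n 0 ∨ α.map (· % 2) = List.replicate n 0 ++ [1]

theorem OddEven.odd_sum {α : List ℕ} (h : OddEven α) : Odd α.sum := by
  have key : ∀ α : List ℕ, α.sum % 2 = (α.map (· % 2)).sum % 2 := by
    intro α
    induction α with
    | nil => rfl
    | cons k α ih => simp only [List.sum_cons, List.map_cons]; omega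
  rw [Nat.odd_iff, key]
  obtain ⟨n, h | h⟩ := h <;> simp [h]

/-- The answer to the value `a` at `x` is `a + 1` at the other corner of the bigon; Reidemeister II
then leads to `S'`. -/
theorem _root_.ResolvingGame.answer_of_erasure {S S' : Shadow} {x y : S.V}
    (e : Shadow.Erasure S {x, y} S') (hS : S.IsKnotShadow) (hS' : S'.IsKnotShadow) (hxy : x ≠ y)
    (hb : S.Bigon x y) (h' : S'.Unknottable 1) (a : ZMod 2) :
    ∃ (y : S.V) (c : ZMod 2) (V' : Type) (G' : (V' → ZMod 2) → Prop)
      (k : V' → S.V) (s : V' → ZMod 2), x ≠ y ∧ Function.Injective k ∧ Set.range k = {x, y}ᶜ ∧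
      WinAll 1 V' G' ∧
      ∀ o : S.V → ZMod 2, o x = a → o y = c → G' (fun v => o (k v) + s v) →
        Diagram.IsUnknot ⟨S, o⟩ := by
  refine ⟨y, a + 1, S'.V, _, e.k, fun v => strand (e.r v), hxy, e.k_injective, e.range_k, h', ?_⟩
  intro o hx hy ho
  refine e.isUnknot_of_bigon hS hS' hxy hb ?_ ho
  rw [hx, hy]
  exact (by decide : ∀ a : ZMod 2, a ≠ a + 1) a

theorem answer_of_cancels {w w' : List Bool} (h : (build w).close.SingleComponent) {x : (build w).V}
    (hx : (build w).Cancels x (build w'))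
    (h' : (build w').close.SingleComponent → (build w').close.Unknottable 1) (a : ZMod 2) :
    ∃ (y : (build w).close.V) (c : ZMod 2) (V' : Type) (G' : (V' → ZMod 2) → Prop)
      (k : V' → (build w).close.V) (s : V' → ZMod 2), x ≠ y ∧ Function.Injective k ∧
      Set.range k = {x, y}ᶜ ∧ WinAll 1 V' G' ∧
      ∀ o : (build w).close.V → ZMod 2, o x = a → o y = c → G' (fun v => o (k v) + s v) →
        Diagram.IsUnknot ⟨(build w).close, o⟩ := by
  obtain ⟨y, hxy, hb, ⟨e⟩⟩ := hx
  have hc := e.close.singleComponent h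
  exact answer_of_erasure e.close (close_isKnotShadow _ h) (close_isKnotShadow _ hc) hxy
    (bigon_close hb) (h' hc) a

/-- Capping commutes with reflection. -/
def capReflect (t : TangleShadow) : Shadow.Erasure t.reflect.cap ∅ t.cap.mirror :=
  .ofEquiv (Equiv.refl (Option t.V)) (Equiv.refl t.E) (fun _ => 0)
    (fun v => match v with
      | none => forall_zmod_four rfl rfl rfl rfl
      | some v => fun i => congrArg (fun i => t.att v (-i)) (add_zero i).symm)

/-- The last crossing can be cancelled with a neighbouring crossing in the previous row. -/
noncomputable def closeCancel (t : TangleShadow) :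
    Shadow.Erasure t.twist.twist.reflect.twist.close {none, some none} t.reflect.twist.close :=
  -- Closing after a twist is capping, and capping a reflected tangle is mirroring the capped one,
  -- so the cancellation is that of `capTwistTwice`.
  (((closeTwist _).trans (capReflect _)).comp t.capTwistTwice.mirror _ (by
    rw [Set.empty_union]
    exact (Set.image_id _).symm)).trans ((capReflect t).symm.trans (closeTwist _).symm)

theorem bigon_closeCancel (t : TangleShadow) :
    t.twist.twist.reflect.twist.close.Bigon none (some none) :=
  ⟨2, 0, rfl, (Quot.sound (Or.inr ⟨rfl, rfl⟩) :
    Quot.mk t.twist.twist.reflect.twist.Joined (Sum.inl (Sum.inr true)) =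
      Quot.mk _ (Sum.inr false)).symm, by decide⟩

/-- The Unknotter wins on an odd-even shadow even when not moving last. -/
theorem unknottable_of_oddEven (α : List ℕ) (hα : OddEven α)
    (h : (build (word α)).close.SingleComponent) : (build (word α)).close.Unknottable 1 := by
  induction hn : α.sum + α.length using Nat.strong_induction_on generalizing α with | _ n ih
  have hodd : Odd (Nat.card (build (word α)).close.V) := by
    have : Nat.card (build (word α)).close.V = α.sum := (card_build _).trans (count_word α)
    rw [this]; exact hα.odd_sum
  -- Taking two crossings from one row keeps all parities, so the list stays odd-even.
  have hsub : ∀ β k γ, α = β ++ (k + 2) :: γ →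
      (build (word (β ++ k :: γ))).close.SingleComponent →
      (build (word (β ++ k :: γ))).close.Unknottable 1 := by
    rintro β k γ rfl h'
    refine ih _ ?_ _ ?_ h' rfl
    · simp at hn ⊢; omega
    · simpa [OddEven] using hα
  -- The only obstacle to a partner within the row is a row of length one. In an odd-even list it
  -- must be the odd row, at one of the ends.
  by_cases h1 : 1 ∈ α
  · have hα' := hα
    obtain ⟨n, hh | hl⟩ := hα
    · obtain ⟨k, β, rfl⟩ : ∃ k β, α = k :: β := by
        cases α with
        | nil => simp at hh
        | cons k β => exact ⟨k, β, rfl⟩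
      simp only [List.map_cons, List.cons.injEq] at hh
      have hβ : 1 ∉ β := fun h => by
        have : (1 : ℕ) ∈ β.map (· % 2) := List.mem_map.mpr ⟨1, h, rfl⟩
        rw [hh.2] at this
        simp at this
      obtain rfl : k = 1 := by
        rcases List.mem_cons.mp h1 with h | h
        · exact h.symm
        · exact (hβ h).elim
      rcases β with _ | ⟨_ | _ | k, γ⟩
      · exact unknottable_crossing h
      -- An empty second row makes the outermost crossing part of the third row.
      · have e : build (word (1 :: 0 :: γ)) = (build (word γ)).twist := congrArg twist (reflect_reflect _)
        rw [e] at h ⊢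
        cases γ with
        | nil =>
          exact curlBase.unknottable_ops_of_isLoop (v := [true]) (v' := []) isLoop_curl [] h
            fun h' => by
              have : IsEmpty (build []).close.V := inferInstanceAs (IsEmpty Empty)
              exact unknottable_of_isEmpty (S := (build []).close) (close_isKnotShadow [] h')
        | cons k γ =>
          refine ih (k + 1 + γ.sum + (γ.length + 1)) ?_ ((k + 1) :: γ) ?_ h ?_
          · simp at hn; omega
          · have h2 := hh.2
            rcases n with _ | _ | n
            · simp at h2
            · simp at h2
            · refine ⟨n, Or.inl ?_⟩
              simp only [List.map_cons, List.replicate_succ, List.cons.injEq] at h2 ⊢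
              exact ⟨by omega, h2.2.2⟩
          · simp
      · simp at hβ
      · refine WinAll.answer hodd ?_
        -- The outermost crossing finds its partner in the next row through the closing arcs; every
        -- other crossing has one in its own row.
        rintro (_ | x) a
        · have hc := (closeCancel (build (List.replicate k true ++ false :: word γ))).singleComponent h
          refine answer_of_erasure (closeCancel (build (List.replicate k true ++ false :: word γ)))
            (close_isKnotShadow _ h)
            (close_isKnotShadow (word (1 :: k :: γ)) hc)
            (fun h => by cases h) (bigon_closeCancel _) (hsub [1] k γ rfl hc) a
        · obtain ⟨β, l, δ, h3, h4⟩ := cancels_of_one_notMem _ hβ x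
          have h5 : (build (word (1 :: (k + 2) :: γ))).Cancels (some x)
              (build (word ((1 :: β) ++ l :: δ))) := h4.reflect.twist
          exact answer_of_cancels h h5 (hsub (1 :: β) l δ (by rw [h3]; rfl)) a
    · obtain rfl | ⟨β, k, rfl⟩ := α.eq_nil_or_concat'
      · simp at h1
      simp only [List.map_append, List.map_cons, List.map_nil] at hl
      obtain ⟨hl1, hl2⟩ := List.append_inj' hl rfl
      have hβ : 1 ∉ β := fun h => by
        have : (1 : ℕ) ∈ β.map (· % 2) := List.mem_map.mpr ⟨1, h, rfl⟩
        rw [hl1] at this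
        simp at this
      obtain rfl : k = 1 := by
        rcases List.mem_append.mp h1 with h | h
        · exact (hβ h).elim
        · exact (List.mem_singleton.mp h).symm
      obtain rfl | ⟨β, k, rfl⟩ := β.eq_nil_or_concat'
      · exact unknottable_crossing h
      -- A single innermost crossing is symmetric under reflection, so it joins the neighbouring
      -- row.
      have e1 : word (β ++ [k] ++ [1]) = (word β ++ List.replicate k true) ++ [false, true, false] := by
        simp [word_append, word]
      have e2 : word (β ++ [k + 1]) = (word β ++ List.replicate k true) ++ [true, false] := by
        simp [word_append, word, List.replicate_succ']
      rw [e1] at h ⊢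
      refine reflectCrossing.unknottable_ops (v := [false, true, false]) (v' := [true, false]) _ h
        fun h' => ?_
      rw [← e2] at h' ⊢
      refine ih _ ?_ _ ?_ h' rfl
      · simp at hn ⊢; omega
      · rcases n with _ | n
        · simp at hl1
        rw [List.map_append, List.replicate_succ'] at hl1
        obtain ⟨h2, h3⟩ := List.append_inj' hl1 rfl
        refine ⟨n, Or.inr ?_⟩
        rw [List.map_append, h2]
        simp at h3
        simp; omega
  · refine WinAll.answer hodd ?_
    intro x a
    obtain ⟨β, k, γ, h2, h3⟩ := cancels_of_one_notMem α h1 x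
    exact answer_of_cancels h h3 (hsub β k γ h2) a

end TangleShadow

/-- Removing crossings, as an erasure. -/
def Shadow.ofErase (S : Shadow) (A : Set S.V) : Shadow.Erasure S A (S.erase A) where
  k := Subtype.val
  g := Quot.mk _
  r _ := 0
  k_injective := Subtype.val_injective
  range_k := Subtype.range_coe
  g_surjective := Quot.exists_rep
  g_eq_of_opposite _ _ h := Quot.sound h
  eqvGen_of_g_eq _ _ h := Quot.eqvGen_exact h
  att_eq v i := congrArg (fun i => Quot.mk _ (S.att v.1 i)) (add_zero i).symm

/-- Each pseudo Reidemeister I move deletes an irrelevant crossing, and these are allowed in any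
number. -/
theorem Shadow.ReducesR1.unknottable {S O : Shadow} (h : S.ReducesR1 O) (hS : S.IsKnotShadow)
    (hO : O.IsKnotShadow → O.Unknottable 1) : S.Unknottable 1 := by
  induction h using Relation.ReflTransGen.head_induction_on with
  | refl => exact hO hS
  | head h _ ih =>
    rcases h with ⟨h1, h2, v, hv, h3⟩ | h
    · obtain ⟨e⟩ := Erasure.nonempty_of_iso h3
      exact ((ofErase _ {v}).trans e).unknottable_of_isLoop h1 h2 hv (ih h2)
    · obtain ⟨e⟩ := Erasure.nonempty_of_iso h
      exact e.unknottable hS (ih (e.isKnotShadow hS))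

namespace TangleShadow

/-! Reversing the order of the numbers of twists. -/

/-- Corresponding ends of two tangles. -/
inductive Glued (t s : TangleShadow) : t.E ⊕ s.E → t.E ⊕ s.E → Prop
  | nw : Glued t s (Sum.inl t.nw) (Sum.inr s.nw)
  | ne : Glued t s (Sum.inl t.ne) (Sum.inr s.ne)
  | sw : Glued t s (Sum.inl t.sw) (Sum.inr s.sw)
  | se : Glued t s (Sum.inl t.se) (Sum.inr s.se)

/-- Two tangles glued along the boundary circle, the second one lying outside. -/
def glue (t s : TangleShadow) : Shadow where
  V := t.V ⊕ s.V
  E := Quot (Glued t s)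
  att
    | Sum.inl v, i => Quot.mk _ (Sum.inl (t.att v i))
    | Sum.inr v, i => Quot.mk _ (Sum.inr (s.att v (-i)))

/-- The shadow of a tangle closed up by an outer tangle without crossings. -/
def closeGlue (t : TangleShadow) : Shadow.Erasure t.close ∅ (glue t base.reflect) :=
  .ofSection (fun v => match v with
      | Sum.inl v => v
      | Sum.inr v => v.elim)
    (Quot.lift (fun x => Quot.mk _ (Sum.inl x)) (by
      rintro x y (⟨rfl, rfl⟩ | ⟨rfl, rfl⟩)
      · exact (Quot.sound (Glued.nw (t := t) (s := base.reflect))).trans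
          (Quot.sound (Glued.ne (t := t) (s := base.reflect))).symm
      · exact (Quot.sound (Glued.sw (t := t) (s := base.reflect))).trans
          (Quot.sound (Glued.se (t := t) (s := base.reflect))).symm))
    (fun _ => 0)
    (Quot.lift (Sum.elim (Quot.mk _) fun b : Bool =>
        if b then Quot.mk t.Joined t.se else Quot.mk t.Joined t.nw) (by
      rintro x y (_ | _ | _ | _)
      · rfl
      · exact (Quot.sound (r := t.Joined) (Or.inl ⟨rfl, rfl⟩)).symm
      · exact Quot.sound (r := t.Joined) (Or.inr ⟨rfl, rfl⟩)
      · rfl))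
    (by
      rintro (v | v) (w | w) h
      · exact congrArg _ h
      · exact w.elim
      · exact v.elim
      · exact v.elim)
    (fun v => ⟨fun _ h => h, fun _ => ⟨Sum.inl v, rfl⟩⟩)
    (by
      rintro ⟨x | _ | _⟩
      · rfl
      · exact Quot.sound (Glued.nw (t := t) (s := base.reflect))
      · exact Quot.sound (Glued.se (t := t) (s := base.reflect)))
    (fun _ h => h.elim)
    (by rintro ⟨x⟩; exact .refl _)
    (by
      rintro (v | v) i
      · exact congrArg (fun i => Quot.mk _ (Sum.inl (t.att v i))) (add_zero i).symm
      · exact v.elim)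

/-- A crossing can be moved from the inner to the outer tangle. -/
def glueTwist (t s : TangleShadow) : Shadow.Erasure (glue t.twist s) ∅ (glue t s.twist) :=
  .ofSection (fun v => match v with
      | Sum.inl v => Sum.inl (some v)
      | Sum.inr none => Sum.inl none
      | Sum.inr (some v) => Sum.inr v)
    (Quot.lift (fun x => match x with
      | Sum.inl (Sum.inl x) => Quot.mk _ (Sum.inl x)
      | Sum.inl (Sum.inr b) => Quot.mk _ (Sum.inr (Sum.inl (if b then s.ne else s.se)))
      | Sum.inr x => Quot.mk _ (Sum.inr (Sum.inl x))) (by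
      rintro x y (_ | _ | _ | _)
      · exact Quot.sound (Glued.nw (t := t) (s := s.twist))
      · rfl
      · exact Quot.sound (Glued.sw (t := t) (s := s.twist))
      · rfl))
    -- In the outer tangle the half-edges are numbered backwards and the sides facing inwards and
    -- outwards are exchanged; the rotation by `3` makes up for both.
    (fun v => match v with
      | Sum.inl _ => 0
      | Sum.inr none => 3
      | Sum.inr (some _) => 0)
    (Quot.lift (fun x => match x with
      | Sum.inl x => Quot.mk _ (Sum.inl (Sum.inl x))
      | Sum.inr (Sum.inl x) => Quot.mk _ (Sum.inr x)
      | Sum.inr (Sum.inr b) => Quot.mk _ (Sum.inl (Sum.inl (if b then t.ne else t.se)))) (by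
      rintro x y (_ | _ | _ | _)
      · exact Quot.sound (Glued.nw (t := t.twist) (s := s))
      · rfl
      · exact Quot.sound (Glued.sw (t := t.twist) (s := s))
      · rfl))
    (by
      rintro (v | _ | v) (w | _ | w) h <;> cases h <;> rfl)
    (by
      rintro ((_ | v) | v)
      · exact ⟨fun _ h => h, fun _ => ⟨Sum.inr none, rfl⟩⟩
      · exact ⟨fun _ h => h, fun _ => ⟨Sum.inl v, rfl⟩⟩
      · exact ⟨fun _ h => h, fun _ => ⟨Sum.inr (some v), rfl⟩⟩)
    (by
      rintro ⟨x | x | _ | _⟩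
      · rfl
      · rfl
      · exact Quot.sound (Glued.se (t := t) (s := s.twist))
      · exact Quot.sound (Glued.ne (t := t) (s := s.twist)))
    (fun _ h => h.elim)
    (by
      have h1 : Quot.mk (Glued t.twist s) (Sum.inl (Sum.inr true)) = Quot.mk _ (Sum.inr s.ne) :=
        Quot.sound Glued.ne
      have h2 : Quot.mk (Glued t.twist s) (Sum.inl (Sum.inr false)) = Quot.mk _ (Sum.inr s.se) :=
        Quot.sound Glued.se
      rintro ⟨(x | _ | _) | x⟩
      · exact .refl _
      · exact h2 ▸ .refl _
      · exact h1 ▸ .refl _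
      · exact .refl _)
    (by
      rintro (v | _ | v) i
      · exact congrArg (fun i => Quot.mk _ (Sum.inl (t.att v i))) (add_zero i).symm
      · revert i
        refine forall_zmod_four rfl ?_ ?_ rfl
        · exact (Quot.sound (Glued.ne (t := t) (s := s.twist))).trans
            (congrArg (fun i => Quot.mk (Glued t s.twist) (Sum.inr (s.twist.att none i)))
              (by decide : (0 : ZMod 4) = -(1 + 3)))
        · exact Quot.sound (Glued.se (t := t) (s := s.twist))
      · exact congrArg (fun i => Quot.mk _ (Sum.inr (Sum.inl (s.att v (-i))))) (add_zero i).symm)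

/-- Reflecting the inner tangle amounts to reflecting the outer one and taking the mirror image. -/
def glueReflect (t s : TangleShadow) :
    Shadow.Erasure (glue t.reflect s) ∅ (glue t s.reflect).mirror :=
  .ofSection id
    (Quot.lift (Quot.mk _) (by
      rintro x y (_ | _ | _ | _)
      · exact Quot.sound (Glued.nw (t := t) (s := s.reflect))
      · exact Quot.sound (Glued.sw (t := t) (s := s.reflect))
      · exact Quot.sound (Glued.ne (t := t) (s := s.reflect))
      · exact Quot.sound (Glued.se (t := t) (s := s.reflect))))
    (fun _ => 0)
    (Quot.lift (Quot.mk _) (by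
      rintro x y (_ | _ | _ | _)
      · exact Quot.sound (Glued.nw (t := t.reflect) (s := s))
      · exact Quot.sound (Glued.sw (t := t.reflect) (s := s))
      · exact Quot.sound (Glued.ne (t := t.reflect) (s := s))
      · exact Quot.sound (Glued.se (t := t.reflect) (s := s))))
    Function.injective_id (fun v => ⟨fun _ h => h, fun _ => ⟨v, rfl⟩⟩)
    (by rintro ⟨x⟩; rfl) (fun _ h => h.elim) (by rintro ⟨x⟩; exact .refl _)
    (by
      rintro (v | v) i
      · exact congrArg (fun i => Quot.mk _ (Sum.inl (t.att v (-i)))) (add_zero i).symm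
      · exact congrArg (fun i => Quot.mk (Glued t s.reflect) (Sum.inr (s.att v i)))
          (show -i = -(-(-(i + 0))) by ring))

/-- Exchanging the inner and the outer tangle. -/
def glueSwap (t s : TangleShadow) : Shadow.Erasure (glue t s) ∅ (glue s t).mirror :=
  .ofSection (Sum.swap)
    (Quot.lift (fun x => Quot.mk _ x.swap) (by
      rintro x y (_ | _ | _ | _)
      · exact (Quot.sound (Glued.nw (t := s) (s := t))).symm
      · exact (Quot.sound (Glued.ne (t := s) (s := t))).symm
      · exact (Quot.sound (Glued.sw (t := s) (s := t))).symm
      · exact (Quot.sound (Glued.se (t := s) (s := t))).symm))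
    (fun _ => 0)
    (Quot.lift (fun x => Quot.mk _ x.swap) (by
      rintro x y (_ | _ | _ | _)
      · exact (Quot.sound (Glued.nw (t := t) (s := s))).symm
      · exact (Quot.sound (Glued.ne (t := t) (s := s))).symm
      · exact (Quot.sound (Glued.sw (t := t) (s := s))).symm
      · exact (Quot.sound (Glued.se (t := t) (s := s))).symm))
    (Function.LeftInverse.injective Sum.swap_swap)
    (fun v => ⟨fun _ h => h, fun _ => ⟨v.swap, Sum.swap_swap v⟩⟩)
    (by rintro ⟨x | x⟩ <;> rfl) (fun _ h => h.elim) (by rintro ⟨x | x⟩ <;> exact .refl _)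
    (by
      rintro (v | v) i
      · exact congrArg (fun i => Quot.mk (Glued s t) (Sum.inl (s.att v i)))
          (show -i = -(i + 0) by ring)
      · exact congrArg (fun i => Quot.mk (Glued s t) (Sum.inr (t.att v i)))
          (show i = -(-(i + 0)) by ring))

theorem iterate_mirror_mirror (S : Shadow) (n : ℕ) :
    Shadow.mirror^[n + 2] S = Shadow.mirror^[n] S := by
  rw [Function.iterate_add_apply]
  exact congrArg _ (Shadow.mirror_mirror S)

theorem nonempty_iterate_mirror {S S' : Shadow} (e : Shadow.Erasure S ∅ S') (n : ℕ) :
    Nonempty (Shadow.Erasure (Shadow.mirror^[n] S) ∅ (Shadow.mirror^[n] S')) := by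
  induction n with
  | zero => exact ⟨e⟩
  | succ n ih =>
    obtain ⟨e⟩ := ih
    rw [Function.iterate_succ_apply', Function.iterate_succ_apply']
    exact ⟨e.mirror⟩

/-- All operations can be moved from the inner to the outer tangle. -/
theorem nonempty_glue_build : ∀ (w : List Bool) (s : TangleShadow), Nonempty (Shadow.Erasure
    (glue (build w) s) ∅ (Shadow.mirror^[w.count false] (glue base (ops w.reverse s))))
  | [], s => ⟨.refl _⟩
  | true :: w, s => by
    obtain ⟨e⟩ := nonempty_glue_build w s.twist
    have h : ops (true :: w).reverse s = ops w.reverse s.twist := by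
      rw [List.reverse_cons]
      induction w.reverse with
      | nil => rfl
      | cons x u ih => cases x <;> simp only [List.cons_append, ops, ih]
    rw [h, List.count_cons_of_ne (by decide)]
    exact ⟨(glueTwist _ _).trans e⟩
  | false :: w, s => by
    obtain ⟨e⟩ := nonempty_glue_build w s.reflect
    have h : ops (false :: w).reverse s = ops w.reverse s.reflect := by
      rw [List.reverse_cons]
      induction w.reverse with
      | nil => rfl
      | cons x u ih => cases x <;> simp only [List.cons_append, ops, ih]
    rw [h, List.count_cons_self, Function.iterate_succ_apply']
    exact ⟨(glueReflect _ _).trans e.mirror⟩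

/-- In `word` each row is followed by its reflection; reversal puts the reflection first, which the
additional letter on either side corrects. -/
theorem reverse_word : ∀ α, (word α).reverse ++ [false] = false :: word α.reverse
  | [] => rfl
  | k :: α => by
    simp [word, word_append, ← List.append_assoc]
    rw [reverse_word α]
    simp

theorem count_false_word : ∀ α, (word α).count false = α.length
  | [] => rfl
  | k :: α => by simp [word, count_false_word α, List.count_replicate]

/-- Reversing the numbers of twists yields the same shadow, up to taking the mirror image. -/
theorem nonempty_reverse (α : List ℕ) : Nonempty (Shadow.Erasure (build (word α)).close ∅
    (Shadow.mirror^[α.length] (build (word α.reverse)).close)) := by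
  obtain ⟨e⟩ := nonempty_glue_build (word α) base.reflect
  have h : ops (word α).reverse base.reflect = (build (word α.reverse)).reflect := by
    change ops (word α).reverse (build [false]) = _
    rw [← build_append, reverse_word]
    rfl
  -- All operations are now outside. Exchanging the two sides gives a closure again.
  rw [h, count_false_word] at e
  have e1 := (glueSwap base (build (word α.reverse)).reflect).trans
    (((glueReflect (build (word α.reverse)) base).trans (closeGlue _).symm.mirror).mirror)
  rw [Shadow.mirror_mirror] at e1
  obtain ⟨e2⟩ := nonempty_iterate_mirror e1 α.length
  exact ⟨((closeGlue _).trans e).trans e2⟩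

/-- The mirror image of a closed rational shadow. -/
theorem nonempty_mirror (k : ℕ) (α : List ℕ) : Nonempty (Shadow.Erasure
    (build (word ((k + 1) :: α))).close.mirror ∅ (build (word (1 :: k :: α))).close) := by
  -- Both sides come from capping the same tangle, and reflecting a capped tangle gives its mirror
  -- image.
  have e : Shadow.Erasure (build (List.replicate k true ++ false :: word α)).twist.close.mirror ∅
      (build (List.replicate k true ++ false :: word α)).reflect.twist.close :=
    (closeTwist _).mirror.trans ((capReflect _).symm.trans (closeTwist _).symm)
  exact ⟨e⟩

/-- Shadows whose mirror image is odd-even. -/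
theorem nonempty_oddEven (k : ℕ) (n : ℕ) (α : List ℕ) (hk : Odd k)
    (hα : α.map (· % 2) = List.replicate n 0 ++ [1]) : ∃ β, OddEven β ∧ Nonempty
    (Shadow.Erasure (build (word (1 :: k :: α))).close ∅ (build (word β)).close) := by
  obtain ⟨e1⟩ := nonempty_mirror k α
  obtain ⟨e2⟩ := nonempty_reverse ((k + 1) :: α)
  obtain rfl | ⟨γ, l, rfl⟩ := α.eq_nil_or_concat'
  · simp at hα
  rw [List.map_append] at hα
  obtain ⟨h1, h2⟩ := List.append_inj' hα rfl
  simp only [List.map_cons, List.map_nil, List.cons.injEq, and_true] at h2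
  have e := e1.symm.trans e2.mirror
  rw [← Function.iterate_succ_apply' Shadow.mirror] at e
  have hrev : ((k + 1) :: (γ ++ [l])).reverse = l :: (γ.reverse ++ [k + 1]) := by simp
  have hγ : γ.reverse.map (· % 2) = List.replicate n 0 := by
    rw [List.map_reverse, h1, List.reverse_replicate]
  have hit : ∀ (m : ℕ) (S : Shadow), Shadow.mirror^[2 * m] S = S := by
    intro m S
    induction m with
    | zero => rfl
    | succ m ih => rw [Nat.mul_succ, iterate_mirror_mirror, ih]
  have hk' : (k + 1) % 2 = 0 := by rcases hk with ⟨m, rfl⟩; omega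
  -- Reversal costs one mirror image per row, and there is one more from the start. If a single one
  -- is left over, `nonempty_mirror` absorbs it at the outer row.
  rcases Nat.even_or_odd' (((k + 1) :: (γ ++ [l])).length) with ⟨m, hm | hm⟩
  · rw [hm, Function.iterate_succ_apply', hit, hrev] at e
    obtain ⟨l, rfl⟩ : ∃ j, l = j + 1 := ⟨l - 1, by omega⟩
    obtain ⟨e3⟩ := nonempty_mirror l (γ.reverse ++ [k + 1])
    refine ⟨_, ⟨n + 2, Or.inl ?_⟩, ⟨e.trans e3⟩⟩
    simp only [List.map_cons, List.map_append, hγ, List.map_nil, hk']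
    rw [show l % 2 = 0 by omega, ← List.replicate_succ', ← List.replicate_succ]
  · rw [hm, show (2 * m + 1).succ = 2 * (m + 1) by omega, hit, hrev] at e
    refine ⟨_, ⟨n + 1, Or.inl ?_⟩, ⟨e⟩⟩
    simp only [List.map_cons, List.map_append, hγ, List.map_nil, hk']
    rw [h2, ← List.replicate_succ']

end TangleShadow

open ResolvingGame

/-! The game on words of operations, in which the Knotter tries to avoid the values `1` and `-1`. -/

theorem ResolvingGame.Win.mono {V : Type} {G G' : (V → ZMod 2) → Prop} (h : ∀ o, G' o → G o)
    {b : Bool} {σ : Pos V} (hw : Win G' b σ) : Win G b σ := by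
  induction hw with
  | done b σ o ho hG => exact .done b σ o ho (h o hG)
  | own σ τ hr _ ih => exact .own σ τ hr ih
  | opp σ hσ _ ih => exact .opp σ hσ ih

namespace Labelled

variable {V : Type}

/-- Apply labelled operations to a pair of differences. -/
def act (o : V → ZMod 2) : List (Option V) → ℤ × ℤ → ℤ × ℤ
  | [], s => s
  | none :: L, s => (act o L s).swap
  | some v :: L, s => ((act o L s).1 + sgn (o v) * (act o L s).2, (act o L s).2)

theorem act_append (o : V → ZMod 2) : ∀ (L M : List (Option V)) (s : ℤ × ℤ),
    act o (L ++ M) s = act o L (act o M s)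
  | [], _, _ => rfl
  | none :: L, M, s => by simp only [List.cons_append, act, act_append o L]
  | some v :: L, M, s => by simp only [List.cons_append, act, act_append o L]

theorem act_neg (o : V → ZMod 2) : ∀ (L : List (Option V)) (s : ℤ × ℤ), act o L (-s) = -act o L s
  | [], _ => rfl
  | none :: L, s => by simp only [act, act_neg o L]; rfl
  | some v :: L, s => by
    simp only [act, act_neg o L]
    ext
    · simp; ring
    · simp

theorem act_map {V' : Type} (f : V' → V) (o : V → ZMod 2) : ∀ (L : List (Option V')) (s : ℤ × ℤ),
    act o (L.map (Option.map f)) s = act (fun v => o (f v)) L s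
  | [], _ => rfl
  | none :: L, s => by simp only [List.map_cons, Option.map_none, act, act_map f o L]
  | some v :: L, s => by simp only [List.map_cons, Option.map_some, act, act_map f o L]

/-- The goal of the Knotter. -/
def Goal (L : List (Option V)) (o : V → ZMod 2) : Prop := (act o L (1, 0)).1.natAbs ≠ 1

/-- The labels occurring in a list. -/
abbrev labels (L : List (Option V)) : List V := L.filterMap id

theorem labels_map {V' : Type} (f : V' → V) (L : List (Option V')) :
    labels (L.map (Option.map f)) = (labels L).map f := by
  induction L with
  | nil => rfl
  | cons x L ih => cases x <;> simp_all [labels]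

theorem exists_lift {p : V → Prop} : ∀ L : List (Option V), (∀ v, some v ∈ L → p v) →
    ∃ L' : List (Option {v // p v}), L'.map (Option.map Subtype.val) = L
  | [], _ => ⟨[], rfl⟩
  | none :: L, h => by
    obtain ⟨L', rfl⟩ := exists_lift L fun v hv => h v (List.mem_cons_of_mem _ hv)
    exact ⟨none :: L', rfl⟩
  | some v :: L, h => by
    obtain ⟨L', rfl⟩ := exists_lift L fun v hv => h v (List.mem_cons_of_mem _ hv)
    exact ⟨some ⟨v, h v List.mem_cons_self⟩ :: L', rfl⟩

theorem sgn_add_one (a : ZMod 2) : sgn (a + 1) = -sgn a := by revert a; decide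

theorem sgn_mul_self (a : ZMod 2) : sgn a * sgn a = 1 := by revert a; decide

theorem natAbs_sgn_mul (a : ZMod 2) (n : ℤ) : (sgn a * n).natAbs = n.natAbs := by
  rw [Int.natAbs_mul, show (sgn a).natAbs = 1 by revert a; decide, one_mul]

/-- Two neighbouring crossings may be ignored: when the opponent resolves one of them, the player
resolves the other one the opposite way. -/
theorem win_pair [Finite V] (L M : List (Option V)) (x y : V)
    (hn : (labels (L ++ some x :: some y :: M)).Nodup)
    (h : ∀ (V' : Type) [Finite V'] (f : V' → V) (N : List (Option V')) (b : Bool),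
      Function.Injective f → N.map (Option.map f) = L ++ M → Nat.card V = Nat.card V' + 2 →
      Set.range f = {x, y}ᶜ → (b = true ↔ Odd (Nat.card V')) → Win (Goal N) b fun _ => none)
    (b : Bool) (hb : b = true ↔ Odd (Nat.card V)) :
    Win (Goal (L ++ some x :: some y :: M)) b fun _ => none := by
  simp only [labels, List.filterMap_append, List.filterMap_cons, id] at hn
  have hn' := (List.perm_middle.trans (List.perm_middle.cons x)).nodup_iff.mp hn
  simp only [List.nodup_cons, List.mem_cons, not_or] at hn'
  obtain ⟨⟨hxy, hx⟩, hy, -⟩ := hn'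
  have hmem : ∀ v, some v ∈ L ++ M → v ≠ x ∧ v ≠ y := by
    intro v hv
    have : v ∈ L.filterMap id ++ M.filterMap id := by
      rw [← List.filterMap_append]
      exact List.mem_filterMap.mpr ⟨some v, hv, rfl⟩
    exact ⟨fun h => hx (h ▸ this), fun h => hy (h ▸ this)⟩
  obtain ⟨N, hN⟩ := exists_lift (L ++ M) hmem
  have hr : Set.range (Subtype.val : {v // v ≠ x ∧ v ≠ y} → V) = {x, y}ᶜ := by
    ext v
    refine ⟨?_, fun h => ⟨⟨v, by simpa using h⟩, rfl⟩⟩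
    rintro ⟨⟨v, h⟩, rfl⟩
    simpa using h
  have hcard : Nat.card V = Nat.card {v // v ≠ x ∧ v ≠ y} + 2 := by
    rw [card_eq_of_range_compl Subtype.val_injective hr, Set.ncard_pair hxy]
  have hb' : b = true ↔ Odd (Nat.card {v // v ≠ x ∧ v ≠ y}) := by
    rw [hb, hcard, Nat.odd_add]; simp
  -- Adjacent twists with opposite signs cancel in `act`.
  have key : ∀ o : V → ZMod 2, o x ≠ o y → Goal N (fun v => o v.1 + 0) →
      Goal (L ++ some x :: some y :: M) o := by
    intro o ho hg
    simp only [Goal, add_zero] at hg ⊢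
    rw [← act_map Subtype.val o N, hN, act_append] at hg
    rw [act_append]
    have e : o x = o y + 1 := by
      revert ho; generalize o x = a; generalize o y = c; revert a c; decide
    simpa [act, e, sgn_add_one] using hg
  refine Win.pair Subtype.val_injective (fun _ => 0) hxy hr
    (fun a => ⟨a + 1, fun o h1 h2 => key o ?_⟩) (fun a => ⟨a + 1, fun o h1 h2 => key o ?_⟩)
    (h _ _ N b Subtype.val_injective hN hcard hr hb') ?_ _ (fun _ => rfl) rfl rfl
  · rw [h1, h2]; exact (by decide : ∀ a : ZMod 2, a ≠ a + 1) a
  · rw [h1, h2]; exact (by decide : ∀ a : ZMod 2, a + 1 ≠ a) a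
  · rw [hb']
    simp [Set.ncard_univ]

end Labelled

open Labelled

/-- For every labelling of the crossings of `w`, with additional irrelevant crossings allowed, the
Knotter wins when moving last. -/
def Knottable (w : List Bool) : Prop :=
  ∀ (V : Type) [Finite V] (L : List (Option V)), L.map Option.isSome = w → (labels L).Nodup →
    ∀ b, (b = true ↔ Odd (Nat.card V)) → Win (Goal L) b fun _ => none

namespace Knottable

/-- The only simplification that relies on the Knotter's answers. The others preserve the absolute
value of the outcome and at most make crossings irrelevant. -/
theorem cancel {u v : List Bool} (h : Knottable (u ++ v)) :
    Knottable (u ++ true :: true :: v) := by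
  intro V _ L hL hn b hb
  obtain ⟨L1, L2, rfl, h1, h2⟩ := List.map_eq_append_iff.mp hL
  obtain ⟨x, L3, rfl, hx, h3⟩ := List.map_eq_cons_iff.mp h2
  obtain ⟨y, L4, rfl, hy, h4⟩ := List.map_eq_cons_iff.mp h3
  obtain ⟨x, rfl⟩ := Option.isSome_iff_exists.mp hx
  obtain ⟨y, rfl⟩ := Option.isSome_iff_exists.mp hy
  refine win_pair L1 L4 x y hn ?_ b hb
  intro V' _ f N b' hf hN _ _ hb'
  refine h V' N ?_ ?_ b' hb'
  · have : (N.map (Option.map f)).map Option.isSome = u ++ v := by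
      rw [hN, List.map_append, h1, h4]
    rw [← this, List.map_map]
    exact List.map_congr_left fun x _ => by cases x <;> rfl
  · refine List.Nodup.of_map f ?_
    rw [← labels_map, hN]
    refine hn.sublist (List.Sublist.filterMap _ ?_)
    exact List.Sublist.append_left ((List.sublist_cons_self _ _).trans (List.sublist_cons_self _ _)) _

/-- Labels that disappear from the list stay in `V` as irrelevant crossings. -/
theorem of_sublist {w w' : List Bool} (h : Knottable w')
    (hw : ∀ (V : Type) (L : List (Option V)), L.map Option.isSome = w →
      ∃ L' : List (Option V), L'.map Option.isSome = w' ∧ L'.Sublist L ∧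
        ∀ o, (act o L' (1, 0)).1.natAbs = (act o L (1, 0)).1.natAbs) : Knottable w := by
  intro V _ L hL hn b hb
  obtain ⟨L', h1, h2, h3⟩ := hw V L hL
  refine (h V L' h1 (hn.sublist (h2.filterMap _)) b hb).mono fun o ho => ?_
  rw [Goal, ← h3]; exact ho

theorem reflect_reflect {u v : List Bool} (h : Knottable (u ++ v)) :
    Knottable (u ++ false :: false :: v) := by
  refine h.of_sublist fun V L hL => ?_
  obtain ⟨L1, L2, rfl, h1, h2⟩ := List.map_eq_append_iff.mp hL
  obtain ⟨x, L3, rfl, hx, h3⟩ := List.map_eq_cons_iff.mp h2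
  obtain ⟨y, L4, rfl, hy, h4⟩ := List.map_eq_cons_iff.mp h3
  obtain rfl := Option.not_isSome_iff_eq_none.mp (by simpa using hx)
  obtain rfl := Option.not_isSome_iff_eq_none.mp (by simpa using hy)
  refine ⟨L1 ++ L4, by rw [List.map_append, h1, h4], List.Sublist.append_left
    ((List.sublist_cons_self _ _).trans (List.sublist_cons_self _ _)) _, fun o => ?_⟩
  simp only [act_append, act, Prod.swap_swap]

/-- A twist acts trivially on the initial pair `(1, 0)`. -/
theorem curl {u : List Bool} (h : Knottable u) : Knottable (u ++ [true]) := by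
  refine h.of_sublist fun V L hL => ?_
  obtain ⟨L1, L2, rfl, h1, h2⟩ := List.map_eq_append_iff.mp hL
  obtain ⟨x, L3, rfl, hx, h3⟩ := List.map_eq_cons_iff.mp h2
  obtain rfl := List.map_eq_nil_iff.mp h3
  obtain ⟨x, rfl⟩ := Option.isSome_iff_exists.mp hx
  refine ⟨L1, h1, List.sublist_append_left _ _, fun o => ?_⟩
  simp [act_append, act]

/-- From `(1, 0)` the two inner words lead to `(s, 1)` and `(1, s)` with `s = ±1`, which agree up to
a common sign. -/
theorem base {u : List Bool} (h : Knottable (u ++ [true, false])) :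
    Knottable (u ++ [false, true, false]) := by
  refine h.of_sublist fun V L hL => ?_
  obtain ⟨L1, L2, rfl, h1, h2⟩ := List.map_eq_append_iff.mp hL
  obtain ⟨x, L3, rfl, hx, h3⟩ := List.map_eq_cons_iff.mp h2
  obtain rfl := Option.not_isSome_iff_eq_none.mp (by simpa using hx)
  refine ⟨L1 ++ L3, by rw [List.map_append, h1, h3], List.Sublist.append_left
    (List.sublist_cons_self _ _) _, fun o => ?_⟩
  obtain ⟨y, L4, rfl, hy, h4⟩ := List.map_eq_cons_iff.mp h3
  obtain ⟨z, L5, rfl, hz, h5⟩ := List.map_eq_cons_iff.mp h4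
  obtain rfl := List.map_eq_nil_iff.mp h5
  obtain rfl := Option.not_isSome_iff_eq_none.mp (by simpa using hz)
  obtain ⟨y, rfl⟩ := Option.isSome_iff_exists.mp hy
  simp only [act_append]
  have h1 : act o [some y, none] (1, 0) = (sgn (o y), 1) := by simp [act]
  have h2 : act o [none, some y, none] (1, 0) = (1, sgn (o y)) := by simp [act]
  rw [h1, h2]
  have : sgn (o y) = 1 ∨ sgn (o y) = -1 := by generalize o y = a; revert a; decide
  rcases this with h | h
  · rw [h]
  · rw [h, show ((-1, 1) : ℤ × ℤ) = -(1, -1) from rfl, act_neg]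
    exact Int.natAbs_neg _

/-- For `s = ±1` the numbers `p + s q` and `q + s p` have the same absolute value. -/
theorem closing {v : List Bool} (h : Knottable (true :: v)) : Knottable (true :: false :: v) := by
  refine h.of_sublist fun V L hL => ?_
  obtain ⟨x, L3, rfl, hx, h3⟩ := List.map_eq_cons_iff.mp hL
  obtain ⟨y, L4, rfl, hy, h4⟩ := List.map_eq_cons_iff.mp h3
  obtain ⟨x, rfl⟩ := Option.isSome_iff_exists.mp hx
  obtain rfl := Option.not_isSome_iff_eq_none.mp (by simpa using hy)
  refine ⟨some x :: L4, by rw [List.map_cons, h4]; rfl, (List.sublist_cons_self _ _).cons_cons _,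
    fun o => ?_⟩
  simp only [act, Prod.fst_swap, Prod.snd_swap]
  rw [← natAbs_sgn_mul (o x), mul_add, ← mul_assoc, sgn_mul_self, one_mul, add_comm]

/-- A twist leaves the second component alone, and that is the one which the reflection brings to
the front. -/
theorem closing_curl {v : List Bool} (h : Knottable (false :: v)) :
    Knottable (false :: true :: v) := by
  refine h.of_sublist fun V L hL => ?_
  obtain ⟨x, L3, rfl, hx, h3⟩ := List.map_eq_cons_iff.mp hL
  obtain ⟨y, L4, rfl, hy, h4⟩ := List.map_eq_cons_iff.mp h3
  refine ⟨x :: L4, by rw [List.map_cons, h4, hx], (List.sublist_cons_self _ _).cons_cons _, fun o => ?_⟩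
  obtain rfl := Option.not_isSome_iff_eq_none.mp (by simpa using hx)
  obtain ⟨y, rfl⟩ := Option.isSome_iff_exists.mp hy
  simp [act]

end Knottable

namespace TangleShadow

/-- The operations of a word, labelled by the crossings they create. -/
def labelling : (w : List Bool) → List (Option (build w).V)
  | [] => []
  | true :: w => some (none : Option (build w).V) :: (labelling w).map (Option.map some)
  | false :: w => (none : Option (build w).V) :: labelling w

theorem map_labelling : ∀ w, (labelling w).map Option.isSome = w
  | [] => rfl
  | true :: w => congrArg (List.cons true) (by
    conv_rhs => rw [← map_labelling w]
    rw [List.map_map]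
    exact List.map_congr_left fun x _ => by cases x <;> rfl)
  | false :: w => congrArg (List.cons false) (map_labelling w)

theorem nodup_labelling : ∀ w, (labels (labelling w)).Nodup
  | [] => List.nodup_nil
  | true :: w => by
    have h : labels (labelling (true :: w)) =
      (none : Option (build w).V) :: labels ((labelling w).map (Option.map some)) := rfl
    rw [h, labels_map]
    exact List.nodup_cons.mpr ⟨fun h => (by
      obtain ⟨_, -, h⟩ := List.mem_map.mp h
      cases h), (nodup_labelling w).map (Option.some_injective _)⟩
  | false :: w => nodup_labelling w

theorem slope_eq_act : ∀ w (o : (build w).V → ZMod 2), slope w o = act o (labelling w) (1, 0)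
  | [], _ => rfl
  | true :: w, o => by
    have h := slope_eq_act w (fun v => o (some v))
    have h2 : act o (labelling (true :: w)) (1, 0) =
      ((act o ((labelling w).map (Option.map some)) (1, 0)).1 +
        sgn (o none) * (act o ((labelling w).map (Option.map some)) (1, 0)).2,
        (act o ((labelling w).map (Option.map some)) (1, 0)).2) := rfl
    have h3 : act o ((labelling w).map (Option.map some)) (1, 0) = slope w fun v => o (some v) :=
      (act_map some o (labelling w) (1, 0)).trans h.symm
    exact (h2.trans (congrArg (fun s => (s.1 + sgn (o none) * s.2, s.2)) h3)).symm
  | false :: w, o => congrArg Prod.swap (slope_eq_act w o)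

/-- By the colouring obstruction `natAbs_slope_eq_one`, avoiding `1` and `-1` is enough to knot the
closure. -/
theorem win_of_knottable {w : List Bool} (h : Knottable w) (b : Bool)
    (hb : b = true ↔ Odd (Nat.card (build w).close.V)) :
    Win (fun o => ¬ Diagram.IsUnknot ⟨(build w).close, o⟩) b fun _ => none := by
  refine (h (build w).V (labelling w) (map_labelling w) (nodup_labelling w) b hb).mono
    fun o ho hu => ho ?_
  rw [← slope_eq_act]
  exact natAbs_slope_eq_one hu

end TangleShadow

open ResolvingGame Labelled

/-! Solving the game on words when few crossings are left. -/

namespace BlockGame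

/-- The value of rows of crossings with given sums of signs. -/
def value : List ℤ → ℤ × ℤ
  | [] => (1, 0)
  | c :: l => ((value l).2 + c * (value l).1, (value l).1)

/-- The positions arising by resolving one crossing. In a position each row is recorded by its sum
of signs and the number of its unresolved crossings. -/
def moves : List (ℤ × ℕ) → List (List (ℤ × ℕ))
  | [] => []
  | (c, n) :: s => (match n with
      | 0 => []
      | n + 1 => [(c + 1, n) :: s, (c - 1, n) :: s]) ++ (moves s).map ((c, n) :: ·)

/-- Moves completing a row of two crossings with equal signs. -/
def pairMoves : List (ℤ × ℕ) → List (List (ℤ × ℕ))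
  | [] => []
  | (c, n) :: s => (match c, n with
      | 1, 1 => [(1 + 1, 0) :: s]
      | -1, 1 => [(-1 - 1, 0) :: s]
      | _, _ => []) ++ (pairMoves s).map ((c, n) :: ·)

/-- Moves resolving the last crossing of a row with sum of signs zero. -/
def singleMoves : List (ℤ × ℕ) → List (List (ℤ × ℕ))
  | [] => []
  | (c, n) :: s => (match c, n with
      | 0, 1 => [(0 + 1, 0) :: s, (0 - 1, 0) :: s]
      | _, _ => []) ++ (singleMoves s).map ((c, n) :: ·)

/-- The moves of the Knotter, the promising ones coming first. -/
def replies (s : List (ℤ × ℕ)) : List (List (ℤ × ℕ)) := pairMoves s ++ (singleMoves s ++ moves s)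

/-- Decides whether the Knotter wins; `n` is the number of unresolved crossings, and the flag says
whether it is the Knotter's turn. -/
def solve : ℕ → Bool → List (ℤ × ℕ) → Bool
  | 0, _, s => (value (s.map Prod.fst)).1.natAbs != 1
  | n + 1, true, s => (replies s).any (solve n false)
  | n + 1, false, s => (moves s).all (solve n true)

theorem mem_moves_cons {c : ℤ} {n : ℕ} {s s' : List (ℤ × ℕ)} : s' ∈ moves ((c, n) :: s) ↔
    (∃ m, n = m + 1 ∧ (s' = (c + 1, m) :: s ∨ s' = (c - 1, m) :: s)) ∨
      ∃ r ∈ moves s, (c, n) :: r = s' := by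
  cases n <;> simp [moves, or_assoc]

/-- The promising moves only affect the order of the search; its soundness requires merely that they
are legal. -/
theorem pairMoves_subset : ∀ s, pairMoves s ⊆ moves s
  | [] => fun _ h => h
  | (c, n) :: s => by
    intro s' h
    rw [mem_moves_cons]
    simp only [pairMoves, List.mem_append] at h
    refine h.imp (fun h => ?_) fun h => ?_
    · split at h <;> simp_all
    · obtain ⟨s'', h1, rfl⟩ := List.mem_map.mp h
      exact ⟨s'', pairMoves_subset s h1, rfl⟩

theorem singleMoves_subset : ∀ s, singleMoves s ⊆ moves s
  | [] => fun _ h => h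
  | (c, n) :: s => by
    intro s' h
    rw [mem_moves_cons]
    simp only [singleMoves, List.mem_append] at h
    refine h.imp (fun h => ?_) fun h => ?_
    · split at h <;> simp_all
    · obtain ⟨s'', h1, rfl⟩ := List.mem_map.mp h
      exact ⟨s'', singleMoves_subset s h1, rfl⟩

theorem mem_moves_of_mem_replies {s s' : List (ℤ × ℕ)} (h : s' ∈ replies s) : s' ∈ moves s := by
  simp only [replies, List.mem_append] at h
  exact h.elim (fun h => pairMoves_subset s h) fun h => h.elim (fun h => singleMoves_subset s h) id

variable {V : Type}

/-- The labelled word consisting of the given rows. -/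
def wordOf (B : List (List V)) : List (Option V) := B.flatMap fun l => l.map some ++ [none]

/-- The twists of one row add up, so only the sum of their signs matters. -/
theorem act_wordOf (o : V → ZMod 2) : ∀ B : List (List V),
    act o (wordOf B) (1, 0) = value (B.map fun l => (l.map fun v => sgn (o v)).sum)
  | [] => rfl
  | l :: B => by
    have h : ∀ (l : List V) (s : ℤ × ℤ),
        act o (l.map some) s = (s.1 + (l.map fun v => sgn (o v)).sum * s.2, s.2) := by
      intro l s
      induction l with
      | nil => simp [act]
      | cons v l ih =>
        simp only [List.map_cons, act, ih, List.sum_cons]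
        ext
        · simp; ring
        · rfl
    rw [wordOf, List.flatMap_cons, List.append_assoc, act_append, h]
    change _ = ((value _).2 + _ * (value _).1, (value _).1)
    rw [← act_wordOf o B]
    rfl

theorem labels_wordOf (B : List (List V)) : labels (wordOf B) = B.flatten := by
  induction B with
  | nil => rfl
  | cons l B ih =>
    rw [wordOf, List.flatMap_cons, labels, List.filterMap_append, List.filterMap_append]
    rw [wordOf, labels] at ih
    rw [ih]
    have : (l.map some).filterMap id = l := by
      rw [List.filterMap_map]; exact List.filterMap_some
    rw [this]
    simp

theorem exists_wordOf : ∀ (α : List ℕ) (L : List (Option V)),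
    L.map Option.isSome = TangleShadow.word α → ∃ B : List (List V), L = wordOf B ∧ B.map List.length = α
  | [], L, h => ⟨[], List.map_eq_nil_iff.mp h, rfl⟩
  | k :: α, L, h => by
    obtain ⟨L1, L2, rfl, h1, h2⟩ := List.map_eq_append_iff.mp h
    obtain ⟨x, L3, rfl, hx, h3⟩ := List.map_eq_cons_iff.mp h2
    obtain rfl := Option.not_isSome_iff_eq_none.mp (by simpa using hx)
    obtain ⟨B, rfl, rfl⟩ := exists_wordOf α L3 h3
    have key : ∀ (k : ℕ) (L : List (Option V)), L.map Option.isSome = List.replicate k true →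
        ∃ l : List V, l.map some = L ∧ l.length = k := by
      intro k
      induction k with
      | zero => exact fun L h => ⟨[], by simpa using (List.map_eq_nil_iff.mp h).symm, rfl⟩
      | succ k ih =>
        intro L h
        rw [List.replicate_succ] at h
        obtain ⟨x, L3, rfl, hx, h3⟩ := List.map_eq_cons_iff.mp h
        obtain ⟨x, rfl⟩ := Option.isSome_iff_exists.mp hx
        obtain ⟨l, rfl, rfl⟩ := ih L3 h3
        exact ⟨x :: l, rfl, rfl⟩
    obtain ⟨l, rfl, rfl⟩ := key k L1 h1
    exact ⟨l :: B, by simp [wordOf], rfl⟩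

/-- The sum of signs and the number of unresolved crossings of a row. -/
def row (σ : Pos V) (l : List V) : ℤ × ℕ :=
  ((l.map fun v => (σ v).elim 0 sgn).sum, l.countP fun v => (σ v).isNone)

theorem row_update_of_notMem [DecidableEq V] (σ : Pos V) (v : V) (a : Option (ZMod 2)) (l : List V)
    (h : v ∉ l) : row (Function.update σ v a) l = row σ l := by
  have hne : ∀ w ∈ l, Function.update σ v a w = σ w := fun w hw =>
    Function.update_of_ne (fun e : w = v => h (e ▸ hw)) _ _
  refine Prod.ext ?_ ?_
  · exact congrArg List.sum (List.map_congr_left fun w hw => by rw [hne w hw])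
  · exact List.countP_congr fun w hw => by rw [hne w hw]

theorem row_update [DecidableEq V] {σ : Pos V} {v : V} (hσ : σ v = none) (a : ZMod 2) (l : List V)
    (hl : l.Nodup) (h : v ∈ l) : ∃ n, (row σ l).2 = n + 1 ∧
      row (Function.update σ v (some a)) l = ((row σ l).1 + sgn a, n) := by
  obtain ⟨l1, l2, rfl⟩ := List.append_of_mem h
  have hp : (v :: (l1 ++ l2)).Nodup := List.perm_middle.nodup_iff.mp hl
  have hv := (List.nodup_cons.mp hp).1
  have h1 := row_update_of_notMem σ v (some a) l1 fun h => hv (List.mem_append_left _ h)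
  have h2 := row_update_of_notMem σ v (some a) l2 fun h => hv (List.mem_append_right _ h)
  simp only [row, Prod.mk.injEq] at h1 h2
  refine ⟨(row σ l1).2 + (row σ l2).2, ?_, ?_⟩
  · simp [row, hσ]; omega
  · simp [row, h1, h2, hσ]; ring

/-- Covers the opponent: no actual move escapes the recorded ones. -/
theorem mem_moves [DecidableEq V] {σ : Pos V} {v : V} (hσ : σ v = none) (a : ZMod 2) :
    ∀ B : List (List V), B.flatten.Nodup → v ∈ B.flatten →
      B.map (row (Function.update σ v (some a))) ∈ moves (B.map (row σ))
  | [], _, h => by simp at h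
  | l :: B, hn, h => by
    rw [List.flatten_cons] at hn h
    rw [List.map_cons, List.map_cons, show row σ l = ((row σ l).1, (row σ l).2) from rfl,
      mem_moves_cons]
    by_cases hl : v ∈ l
    · left
      obtain ⟨n, h1, h2⟩ := row_update hσ a l (List.Nodup.of_append_left hn) hl
      have hB : B.map (row (Function.update σ v (some a))) = B.map (row σ) :=
        List.map_congr_left fun l' hl' => row_update_of_notMem _ _ _ _ fun h' =>
          List.disjoint_of_nodup_append hn hl (List.mem_flatten.mpr ⟨l', hl', h'⟩)
      rw [h1, h2, hB]
      have : sgn a = 1 ∨ sgn a = -1 := (by decide : ∀ a, sgn a = 1 ∨ sgn a = -1) a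
      refine ⟨n, rfl, ?_⟩
      rcases this with h | h <;> simp [h, sub_eq_add_neg]
    · right
      rw [row_update_of_notMem σ v _ l hl]
      exact ⟨_, mem_moves hσ a B (List.Nodup.of_append_right hn)
        ((List.mem_append.mp h).resolve_left hl), rfl⟩

/-- Covers the Knotter: a recorded move can be played at any unresolved crossing of its row. -/
theorem exists_of_mem_moves [DecidableEq V] {σ : Pos V} : ∀ B : List (List V), B.flatten.Nodup →
    ∀ s ∈ moves (B.map (row σ)), ∃ v a, σ v = none ∧ v ∈ B.flatten ∧
      B.map (row (Function.update σ v (some a))) = s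
  | [], _, s, h => by simp [moves] at h
  | l :: B, hn, s, h => by
    rw [List.flatten_cons] at hn
    rw [List.map_cons, show row σ l = ((row σ l).1, (row σ l).2) from rfl, mem_moves_cons] at h
    rcases h with ⟨n, hc, h⟩ | ⟨s', h', rfl⟩
    · obtain ⟨v, hv, hσ⟩ : ∃ v ∈ l, (σ v).isNone = true := by
        rw [← List.countP_pos_iff]
        have : l.countP (fun v => (σ v).isNone) = n + 1 := hc
        omega
      have hσ : σ v = none := by simpa using hσ
      have hB : ∀ a, B.map (row (Function.update σ v (some a))) = B.map (row σ) := fun a =>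
        List.map_congr_left fun l' hl' => row_update_of_notMem _ _ _ _ fun h' =>
          List.disjoint_of_nodup_append hn hv (List.mem_flatten.mpr ⟨l', hl', h'⟩)
      have key : ∀ a, row (Function.update σ v (some a)) l = ((row σ l).1 + sgn a, n) := by
        intro a
        obtain ⟨m, h1, h2⟩ := row_update hσ a l (List.Nodup.of_append_left hn) hv
        obtain rfl : m = n := by omega
        exact h2
      rcases h with h | h
      · refine ⟨v, 0, hσ, List.mem_append_left _ hv, ?_⟩
        rw [List.map_cons, hB, key, h]; rfl
      · refine ⟨v, 1, hσ, List.mem_append_left _ hv, ?_⟩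
        rw [List.map_cons, hB, key, h]; rfl
    · obtain ⟨v, a, h1, h2, h3⟩ := exists_of_mem_moves B (List.Nodup.of_append_right hn) s' h'
      refine ⟨v, a, h1, List.mem_append_right _ h2, ?_⟩
      rw [List.map_cons, h3, row_update_of_notMem σ v _ l fun hl =>
        List.disjoint_of_nodup_append hn hl h2]

/-- Every crossing has to occur in some row, because irrelevant crossings are not recorded. -/
theorem win_of_solve [Finite V] (B : List (List V)) (hn : B.flatten.Nodup)
    (hB : ∀ v, v ∈ B.flatten) : ∀ (n : ℕ) (b : Bool) (σ : Pos V), {v | σ v = none}.ncard = n →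
    solve n b (B.map (row σ)) = true → Win (Goal (wordOf B)) b σ := by
  classical
  intro n
  induction n with
  | zero =>
    intro b σ hσ h
    have hsome : ∀ v, ∃ a, σ v = some a := fun v => by
      rw [Set.ncard_eq_zero (Set.toFinite _)] at hσ
      exact Option.ne_none_iff_exists'.mp fun hv => by
        have : v ∈ ({v | σ v = none} : Set V) := hv
        rw [hσ] at this
        exact this
    choose o ho using hsome
    refine .done b σ o ho ?_
    rw [Goal, act_wordOf]
    simp only [solve, List.map_map, bne_iff_ne] at h
    have : (Prod.fst ∘ row σ) = fun l => (l.map fun v => sgn (o v)).sum := by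
      funext l
      simp [row, ho]
    rwa [this] at h
  | succ n ih =>
    intro b σ hσ h
    cases b with
    | true =>
      obtain ⟨s, hs, h⟩ := List.any_eq_true.mp h
      have hs : s ∈ moves (B.map (row σ)) := mem_moves_of_mem_replies hs
      obtain ⟨v, a, h1, -, rfl⟩ := exists_of_mem_moves B hn s hs
      have hr := resolves_update h1 a
      have := hr.ncard
      exact .own _ _ hr (ih _ _ (by omega) h)
    | false =>
      refine .opp _ ?_ ?_
      · by_contra! hne
        have : {v | σ v = none} = ∅ := by ext v; simpa using hne v
        rw [this] at hσ
        simp at hσ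
      · intro τ hτ
        have := hτ.ncard
        obtain ⟨v, a, h1, rfl⟩ := hτ.eq_update
        exact ih _ _ (by omega) (List.all_eq_true.mp h _ (mem_moves h1 a B hn (hB v)))

/-- The starting position. -/
def start (α : List ℕ) : List (ℤ × ℕ) := α.map fun n => (0, n)

/-- Solving the game with no irrelevant crossing and with one of them suffices. -/
theorem knottable_of_solve (α : List ℕ) (n : ℕ) (b : Bool) (hα : α.sum = n)
    (hb : b = true ↔ Odd n) (h0 : solve n b (start α) = true)
    (h1 : solve (n + 1) (!b) (start (α ++ [1, 0])) = true) : Knottable (TangleShadow.word α) := by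
  have full : ∀ (α : List ℕ) (V : Type) [Finite V] (L : List (Option V)),
      L.map Option.isSome = TangleShadow.word α → (labels L).Nodup → (∀ v, v ∈ labels L) →
      ∀ b, solve (Nat.card V) b (start α) = true → Win (Goal L) b fun _ => none := by
    intro α V _ L hL hn hv b hs
    obtain ⟨B, rfl, rfl⟩ := exists_wordOf α L hL
    rw [labels_wordOf] at hn hv
    refine win_of_solve B hn hv (Nat.card V) b _ (by simp [Set.ncard_univ]) ?_
    convert hs using 1
    rw [start, List.map_map]
    exact congrArg _ (List.map_congr_left fun l _ => by simp [row])
  have card_of : ∀ (V : Type) [Finite V] (l : List V), l.Nodup → (∀ v, v ∈ l) →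
      Nat.card V = l.length := by
    intro V _ l hl hv
    have := Fintype.ofFinite V
    classical
    have hu : l.toFinset = Finset.univ := Finset.eq_univ_of_forall fun v => by simpa using hv v
    rw [Nat.card_eq_fintype_card, ← Finset.card_univ, ← hu, List.toFinset_card_of_nodup hl]
  have length_labels : ∀ (V : Type) (L : List (Option V)),
      (labels L).length = (L.map Option.isSome).count true := by
    intro V L
    induction L with
    | nil => rfl
    | cons x L ih => cases x <;> simp_all [labels]
  intro V _ L hL hn b' hb'
  have hlen : (labels L).length = n := by
    rw [length_labels, hL, TangleShadow.count_word, hα]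
  induction hm : Nat.card V using Nat.strong_induction_on generalizing V L b' with | _ m ih
  by_cases hu : ∀ v, v ∈ labels L
  · have hc := (card_of V _ hn hu).trans hlen
    refine full α V L hL hn hu b' ?_
    rw [hc]
    rw [hc, ← hb, Bool.eq_iff_iff.symm] at hb'
    rw [hb', h0]
  push Not at hu
  obtain ⟨x, hx⟩ := hu
  by_cases hu : ∀ v, v ∈ labels L ++ [x]
  -- Exactly one irrelevant crossing. It is modelled by an innermost twist, which acts trivially on
  -- `(1, 0)`; the rows `1, 0` in `h1` encode it.
  · have hl : labels (L ++ [some x, none, none]) = labels L ++ [x] := by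
      simp [labels, List.filterMap_append]
    have hn' : (labels L ++ [x]).Nodup :=
      List.nodup_append.mpr ⟨hn, List.nodup_singleton x, fun a ha b hb h => by
        rw [List.mem_singleton] at hb
        exact hx (hb ▸ h ▸ ha)⟩
    have hc := card_of V _ hn' hu
    rw [List.length_append, hlen] at hc
    have := full (α ++ [1, 0]) V (L ++ [some x, none, none])
      (by rw [List.map_append, hL, TangleShadow.word_append]; rfl) (by rw [hl]; exact hn')
      (by rw [hl]; exact hu) b' (by
        rw [hc]
        have : b' = !b := by
          rw [Bool.eq_iff_iff, hb', hc, Bool.not_eq_true', ← Bool.not_eq_true, hb]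
          simp [Nat.odd_add]
        rw [this]; exact h1)
    refine this.mono fun o ho => ?_
    simpa [Goal, act_append, act] using ho
  -- At least two irrelevant crossings. As adjacent innermost twists they do not affect the outcome,
  -- and `win_pair` removes them.
  · push Not at hu
    obtain ⟨y, hy⟩ := hu
    rw [List.mem_append, not_or, List.mem_singleton] at hy
    have hn' : (labels (L ++ [some x, some y])).Nodup := by
      have : labels (L ++ [some x, some y]) = labels L ++ [x, y] := by
        simp [labels, List.filterMap_append]
      rw [this]
      refine List.nodup_append.mpr ⟨hn, by simpa using fun h => hy.2 h.symm, fun a ha b hb h => ?_⟩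
      subst h
      rcases List.mem_cons.mp hb with rfl | hb
      · exact hx ha
      · rw [List.mem_singleton] at hb
        exact hy.1 (hb ▸ ha)
    refine (win_pair L [] x y hn' ?_ b' hb').mono fun o ho => ?_
    · intro V' _ f N b'' hf hN hcard _ hb''
      rw [List.append_nil] at hN
      have h2 : N.map Option.isSome = TangleShadow.word α := by
        rw [← hL, ← hN, List.map_map]
        exact List.map_congr_left fun x _ => by cases x <;> rfl
      refine ih (Nat.card V') (by omega) V' N h2 ?_ b'' hb'' ?_ rfl
      · refine List.Nodup.of_map f ?_
        rw [← labels_map, hN]; exact hn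
      · rw [length_labels, h2, TangleShadow.count_word, hα]
    · simpa [Goal, act_append, act] using ho

end BlockGame

/-! ### Four games solved by computation -/

section
set_option maxRecDepth 100000

/-- This list and the next three are the exceptions in `Twists.simplifies`, where the induction on
normal forms ends. -/
theorem knottable_two_two : Knottable (TangleShadow.word [2, 2]) :=
  BlockGame.knottable_of_solve _ 4 false rfl (by decide) (by decide +kernel) (by decide +kernel)

theorem knottable_three_one_three : Knottable (TangleShadow.word [3, 1, 3]) :=
  BlockGame.knottable_of_solve _ 7 true rfl (by decide) (by decide +kernel) (by decide +kernel)

theorem knottable_two_one_one_two : Knottable (TangleShadow.word [2, 1, 1, 2]) :=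
  BlockGame.knottable_of_solve _ 6 false rfl (by decide) (by decide +kernel) (by decide +kernel)

theorem knottable_two_two_one_two_two : Knottable (TangleShadow.word [2, 2, 1, 2, 2]) :=
  BlockGame.knottable_of_solve _ 9 true rfl (by decide) (by decide +kernel) (by decide +kernel)

end

open TangleShadow

/-! The Knotter wins on words in normal form that are not odd-even. -/

namespace Twists

/-- The parities of the horizontal and vertical differences of a rational tangle. -/
def par : List ℕ → Bool × Bool
  | [] => (true, false)
  | k :: l => (xor (par l).2 ((k % 2 == 1) && (par l).1), (par l).1)

/-- Simplify the outer end. -/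
def hd : List ℕ → List ℕ
  | 0 :: _ :: 1 :: k :: l => (k + 1) :: l
  | 0 :: _ :: l => l
  | 1 :: k :: l => (k + 1) :: l
  | l => l

/-- Merge the neighbours of an empty row. -/
def mid : List ℕ → List ℕ
  | x :: 0 :: y :: l => (x + y) :: l
  | x :: l => x :: mid l
  | [] => []

/-- Simplify the inner end. -/
def tl (l : List ℕ) : List ℕ := (hd l.reverse).reverse

/-- Remove two crossings from one row. -/
def dec : List ℕ → List (List ℕ)
  | [] => []
  | k :: l => (match k with
    | k + 2 => [k :: l]
    | _ => []) ++ (dec l).map (k :: ·)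

/-- All simplifications after removing two crossings from one row. -/
def results (l : List ℕ) : List (List ℕ) := (dec l).map fun l => tl (hd (mid l))

/-- If the outermost row is empty, the crossings of the next one are irrelevant and the two
reflections cancel. An outermost single crossing joins the next row by `Knottable.closing`. -/
theorem knottable_hd : ∀ l, Knottable (word (hd l)) → Knottable (word l) := by
  have h0 : ∀ k l, Knottable (word l) → Knottable (word (0 :: k :: l)) := by
    intro k l h
    induction k with
    | zero => exact h.reflect_reflect (u := [])
    | succ k ih => exact ih.closing_curl
  have h1 : ∀ k l, Knottable (word ((k + 1) :: l)) → Knottable (word (1 :: k :: l)) :=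
    fun k l h => Knottable.closing h
  intro l h
  unfold hd at h
  split at h
  · exact h0 _ _ (h1 _ _ h)
  · exact h0 _ _ h
  · exact h1 _ _ h
  · exact h

theorem knottable_mid : ∀ l u, Knottable (u ++ word (mid l)) → Knottable (u ++ word l)
  | [], _, h => h
  | [x], _, h => h
  | [x, k], u, h => by
    have : mid [x, k] = [x, k] := by cases k <;> simp [mid]
    rwa [this] at h
  | x :: 0 :: y :: l, u, h => by
    have e1 : u ++ word (mid (x :: 0 :: y :: l)) =
        (u ++ List.replicate x true) ++ (List.replicate y true ++ false :: word l) := by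
      simp only [mid, word, List.replicate_add, List.append_assoc]
    have e2 : u ++ word (x :: 0 :: y :: l) =
        (u ++ List.replicate x true) ++ false :: false :: (List.replicate y true ++ false :: word l) := by
      simp [word]
    rw [e1] at h
    rw [e2]
    exact h.reflect_reflect
  | x :: (k + 1) :: y :: l, u, h => by
    have e : ∀ r, u ++ word (x :: r) = (u ++ List.replicate x true ++ [false]) ++ word r := by
      intro r; simp [word]
    have e1 : mid (x :: (k + 1) :: y :: l) = x :: mid ((k + 1) :: y :: l) := by simp [mid]
    rw [e1, e] at h
    rw [e]
    exact knottable_mid _ _ h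

theorem knottable_dec : ∀ l u, ∀ l' ∈ dec l, Knottable (u ++ word l') → Knottable (u ++ word l)
  | [], _, l', hl', _ => by simp [dec] at hl'
  | k :: l, u, l', hl', h => by
    simp only [dec, List.mem_append, List.mem_map] at hl'
    rcases hl' with hl' | ⟨l'', hl'', rfl⟩
    · match k, hl' with
      | k + 2, hl' =>
        rw [List.mem_singleton] at hl'
        subst hl'
        exact h.cancel
    · have e : ∀ r, u ++ word (k :: r) = (u ++ List.replicate k true ++ [false]) ++ word r := by
        intro r; simp [word]
      rw [e] at h ⊢
      exact knottable_dec l _ l'' hl'' h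

/-- As at the outer end, with `Knottable.curl` and `Knottable.base` in place of
`Knottable.closing_curl` and `Knottable.closing`. -/
theorem knottable_tl (l : List ℕ) (h : Knottable (word (tl l))) : Knottable (word l) := by
  have h0 : ∀ k l, Knottable (word l) → Knottable (word (l ++ [k, 0])) := by
    intro k l h
    have e : word (l ++ [k, 0]) = (word l ++ List.replicate k true) ++ false :: false :: [] := by
      simp [word_append, word]
    rw [e]
    refine Knottable.reflect_reflect ?_
    rw [List.append_nil]
    induction k with
    | zero => simpa using h
    | succ k ih =>
      rw [List.replicate_succ', ← List.append_assoc]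
      exact (ih (by simp [word_append, word])).curl
  have h1 : ∀ k l, Knottable (word (l ++ [k + 1])) → Knottable (word (l ++ [k, 1])) := by
    intro k l h
    have e1 : word (l ++ [k, 1]) = (word l ++ List.replicate k true) ++ [false, true, false] := by
      simp [word_append, word]
    have e2 : word (l ++ [k + 1]) = (word l ++ List.replicate k true) ++ [true, false] := by
      simp [word_append, word, List.replicate_succ']
    rw [e2] at h
    rw [e1]
    exact h.base
  rw [← l.reverse_reverse]
  unfold tl at h
  generalize l.reverse = r at h ⊢
  unfold hd at h
  split at h
  · simp only [List.reverse_cons, List.append_assoc, List.cons_append, List.nil_append] at h ⊢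
    rename_i j _ _
    have := h0 j _ (h1 _ _ h)
    simpa using this
  · simp only [List.reverse_cons, List.append_assoc, List.cons_append, List.nil_append] at h ⊢
    exact h0 _ _ h
  · simp only [List.reverse_cons, List.append_assoc, List.cons_append, List.nil_append] at h ⊢
    exact h1 _ _ h
  · exact h

theorem knottable_of_mem_results {l l' : List ℕ} (h : l' ∈ results l) (h' : Knottable (word l')) :
    Knottable (word l) := by
  obtain ⟨r, hr, rfl⟩ := List.mem_map.mp h
  exact knottable_dec l [] r hr (knottable_mid r [] (knottable_hd _ (knottable_tl _ h')))

theorem oddEven_iff {x y : ℕ} {m : List ℕ} : OddEven (x :: (m ++ [y])) ↔ (∀ k ∈ m, k % 2 = 0) ∧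
    (x % 2 = 1 ∧ y % 2 = 0 ∨ x % 2 = 0 ∧ y % 2 = 1) := by
  have hm : m.map (· % 2) = List.replicate m.length 0 ↔ ∀ k ∈ m, k % 2 = 0 := by
    simp [List.eq_replicate_iff]
  have key : OddEven (x :: (m ++ [y])) ↔
      (x % 2 = 1 ∧ m.map (· % 2) = List.replicate m.length 0 ∧ y % 2 = 0) ∨
      (x % 2 = 0 ∧ m.map (· % 2) = List.replicate m.length 0 ∧ y % 2 = 1) := by
    constructor
    · rintro ⟨n, h | h⟩
      · left
        have hl := congrArg List.length h
        simp only [List.map_cons, List.map_append, List.map_nil, List.length_cons, List.length_append,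
          List.length_map, List.length_nil, List.length_replicate] at hl
        obtain rfl : n = m.length + 1 := by omega
        simp only [List.map_cons, List.map_append, List.map_nil, List.cons.injEq,
          List.replicate_succ'] at h
        obtain ⟨h1, h2⟩ := List.append_inj' h.2 rfl
        exact ⟨h.1, h1, by simpa using h2⟩
      · right
        have hl := congrArg List.length h
        simp only [List.map_cons, List.map_append, List.map_nil, List.length_cons, List.length_append,
          List.length_map, List.length_nil, List.length_replicate] at hl
        obtain rfl : n = m.length + 1 := by omega
        simp only [List.map_cons, List.map_append, List.map_nil, List.replicate_succ,
          List.cons_append, List.cons.injEq] at h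
        obtain ⟨h1, h2⟩ := List.append_inj' h.2 rfl
        exact ⟨h.1, h1, by simpa using h2⟩
    · rintro (⟨h1, h2, h3⟩ | ⟨h1, h2, h3⟩)
      · refine ⟨m.length + 1, Or.inl ?_⟩
        simp [h1, h2, h3, List.replicate_succ']
      · refine ⟨m.length + 1, Or.inr ?_⟩
        simp [h1, h2, h3, List.replicate_succ]
  rw [key, hm]
  tauto

/-- A decidable form of being odd-even. -/
def isOddEven (l : List ℕ) : Bool :=
  l.map (· % 2) = 1 :: List.replicate (l.length - 1) 0 ∨
    l.map (· % 2) = List.replicate (l.length - 1) 0 ++ [1]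

theorem isOddEven_of_oddEven {l : List ℕ} (h : OddEven l) : isOddEven l = true := by
  obtain ⟨n, h⟩ := h
  have hl : l.length = n + 1 := by
    rcases h with h | h <;> simpa using congrArg List.length h
  simpa [isOddEven, hl] using h

/-- No further simplification is possible at the ends, the closure is a knot, and the numbers of
twists are not odd-even. -/
def good (l : List ℕ) : Bool :=
  2 ≤ l.length && l.all (1 ≤ ·) && 2 ≤ l.headD 0 && 2 ≤ l.getLastD 0 && (par l).1 && !isOddEven l

/-- The lists of given length with entries `1` and `2`. -/
def lists : ℕ → List (List ℕ)
  | 0 => [[]]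
  | n + 1 => (lists n).flatMap fun l => [1 :: l, 2 :: l]

theorem mem_lists : ∀ l : List ℕ, (∀ k ∈ l, k = 1 ∨ k = 2) → l ∈ lists l.length
  | [], _ => by simp [lists]
  | k :: l, h => by
    rw [List.length_cons, lists, List.mem_flatMap]
    refine ⟨l, mem_lists l fun k hk => h k (List.mem_cons_of_mem _ hk), ?_⟩
    rcases h k List.mem_cons_self with rfl | rfl <;> simp

/-- Short lists with small entries can be simplified or have been solved. -/
def simplifies (l : List ℕ) : Bool :=
  !good l || l == [2, 2] || l == [3, 1, 3] || l == [2, 1, 1, 2] || l == [2, 2, 1, 2, 2] ||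
    (results l).any fun l' => good l' && l'.sum < l.sum

/-- A finite check: each such list in normal form is one of the four solved games or simplifies to a
normal form with a smaller sum. -/
theorem simplifies_of_length_le {m : List ℕ} (hm : m.length < 6) (hm' : ∀ k ∈ m, k = 1 ∨ k = 2)
    {x y : ℕ} (hx : x = 2 ∨ x = 3) (hy : y = 2 ∨ y = 3) : simplifies (x :: (m ++ [y])) = true := by
  have h : ((((List.range 6).flatMap lists).flatMap fun m =>
      [2 :: (m ++ [2]), 2 :: (m ++ [3]), 3 :: (m ++ [2]), 3 :: (m ++ [3])]).all simplifies) = true := by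
    decide +kernel
  refine List.all_eq_true.mp h _ (List.mem_flatMap.mpr ⟨m, List.mem_flatMap.mpr
    ⟨_, List.mem_range.mpr hm, mem_lists m hm'⟩, ?_⟩)
  rcases hx with rfl | rfl <;> rcases hy with rfl | rfl <;> simp

theorem par_append {l l' : List ℕ} (h : par l = par l') : ∀ r, par (r ++ l) = par (r ++ l')
  | [] => h
  | k :: r => by simp only [List.cons_append, par, par_append h r]

theorem par_cons_add_two (k : ℕ) (l : List ℕ) : par ((k + 2) :: l) = par (k :: l) := by
  simp [par]

theorem par_two_cons (k : ℕ) (l : List ℕ) : (par (2 :: k :: l)).1 = (par l).1 := by simp [par]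

/-- The parity version of `Knottable.closing`. -/
theorem par_one_cons (k : ℕ) (l : List ℕ) : (par (1 :: k :: l)).1 = (par ((k + 1) :: l)).1 := by
  have : ((k + 1) % 2 == 1) = !(k % 2 == 1) := by
    rcases Nat.mod_two_eq_zero_or_one k with h | h <;> simp [Nat.add_mod, h]
  simp only [par, this]
  generalize (k % 2 == 1) = a
  generalize (par l).1 = b
  generalize (par l).2 = c
  revert a b c
  decide

theorem exists_of_good {l : List ℕ} (h : good l = true) : ∃ x m y, l = x :: (m ++ [y]) ∧ 2 ≤ x ∧
    2 ≤ y ∧ (∀ k ∈ m, 1 ≤ k) ∧ (par l).1 = true ∧ ¬ OddEven l := by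
  simp only [good, Bool.and_eq_true, decide_eq_true_eq, List.all_eq_true, Bool.not_eq_true'] at h
  obtain ⟨⟨⟨⟨⟨h1, h2⟩, h3⟩, h4⟩, h5⟩, h6⟩ := h
  rcases l with _ | ⟨x, l⟩
  · simp at h1
  obtain rfl | ⟨m, y, rfl⟩ := l.eq_nil_or_concat'
  · simp at h1
  refine ⟨x, m, y, rfl, by simpa using h3, ?_, fun k hk => h2 k (by simp [hk]), h5, fun h => ?_⟩
  · rw [List.getLastD_eq_getLast?, ← List.cons_append, List.getLast?_append] at h4
    simpa using h4
  · rw [isOddEven_of_oddEven h] at h6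
    cases h6

theorem good_of {x y : ℕ} {m : List ℕ} (hx : 2 ≤ x) (hy : 2 ≤ y) (hm : ∀ k ∈ m, 1 ≤ k)
    (hp : (par (x :: (m ++ [y]))).1 = true) (ho : ¬ OddEven (x :: (m ++ [y]))) :
    good (x :: (m ++ [y])) = true := by
  have h6 : isOddEven (x :: (m ++ [y])) = false := by
    by_contra h
    rw [Bool.not_eq_false] at h
    simp only [isOddEven, decide_eq_true_eq] at h
    exact ho ⟨_, h⟩
  simp only [good, hp, h6, Bool.and_true, Bool.not_false, Bool.and_eq_true, decide_eq_true_eq,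
    List.all_eq_true]
  refine ⟨⟨⟨by simp, fun k hk => ?_⟩, hx⟩, ?_⟩
  · simp only [List.mem_cons, List.mem_append, List.not_mem_nil, or_false] at hk
    rcases hk with rfl | hk | rfl
    · omega
    · exact hm k hk
    · omega
  · rw [List.getLastD_eq_getLast?, ← List.cons_append, List.getLast?_append]
    simpa using hy

/-- The Knotter wins when moving last on a knot in normal form that is not odd-even. -/
theorem knottable_of_normal (x y : ℕ) (m : List ℕ) (hx : 2 ≤ x) (hy : 2 ≤ y) (hm : ∀ k ∈ m, 1 ≤ k)
    (hp : (par (x :: (m ++ [y]))).1 = true) (ho : ¬ OddEven (x :: (m ++ [y]))) :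
    Knottable (word (x :: (m ++ [y]))) := by
  induction hn : (x :: (m ++ [y])).sum using Nat.strong_induction_on generalizing x y m with | _ n ih
  subst hn
  have dec_head : ∀ k l, Knottable (word (k :: l)) → Knottable (word ((k + 2) :: l)) :=
    fun k l h => Knottable.cancel (u := []) h
  have dec_mid : ∀ r k l, Knottable (word (r ++ k :: l)) → Knottable (word (r ++ (k + 2) :: l)) := by
    intro r k l h
    rw [word_append] at h ⊢
    exact Knottable.cancel h
  -- Long rows are shortened by two as long as the result is still normal; afterwards the ends are
  -- `2` or `3` and the inner rows `1` or `2`.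
  by_cases hx4 : 4 ≤ x
  · obtain ⟨x, rfl⟩ := Nat.exists_eq_add_of_le' (show 2 ≤ x by omega)
    refine dec_head _ _ (ih _ ?_ x y m (by omega) hy hm ?_ ?_ rfl)
    · simp
    · rwa [par_cons_add_two] at hp
    · rw [oddEven_iff] at ho ⊢
      simpa using ho
  by_cases hy4 : 4 ≤ y
  · obtain ⟨y, rfl⟩ := Nat.exists_eq_add_of_le' (show 2 ≤ y by omega)
    rw [← List.cons_append]
    refine dec_mid _ _ _ (ih _ ?_ x y m hx (by omega) hm ?_ ?_ rfl)
    · simp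
    · rw [← List.cons_append, par_append (par_cons_add_two y [])] at hp
      exact hp
    · rw [oddEven_iff] at ho ⊢
      simpa using ho
  by_cases hm3 : ∃ k ∈ m, 3 ≤ k
  · obtain ⟨k, hk, hk3⟩ := hm3
    obtain ⟨m1, m2, rfl⟩ := List.append_of_mem hk
    obtain ⟨k, rfl⟩ := Nat.exists_eq_add_of_le' (show 2 ≤ k by omega)
    have e : ∀ k, x :: (m1 ++ k :: m2 ++ [y]) = (x :: m1) ++ k :: (m2 ++ [y]) := by simp
    rw [e]
    refine dec_mid _ _ _ ?_
    rw [← e]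
    refine ih _ ?_ x y (m1 ++ k :: m2) hx hy ?_ ?_ ?_ rfl
    · simp
    · intro j hj
      simp only [List.mem_append, List.mem_cons] at hj hm
      rcases hj with hj | rfl | hj
      · exact hm j (Or.inl hj)
      · omega
      · exact hm j (Or.inr (Or.inr hj))
    · rw [e, par_append (par_cons_add_two k _)] at hp
      rw [e]; exact hp
    · rw [oddEven_iff] at ho ⊢
      simpa [or_imp, forall_and] using ho
  push Not at hm3
  have hm12 : ∀ k ∈ m, k = 1 ∨ k = 2 := fun k hk => by
    have := hm k hk
    have := hm3 k hk
    omega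
  by_cases hlen : m.length < 6
  · have hs := simplifies_of_length_le hlen hm12 (x := x) (y := y) (by omega) (by omega)
    have hg := good_of hx hy hm hp ho
    simp only [simplifies, hg, Bool.not_true, Bool.false_or, Bool.or_eq_true, beq_iff_eq,
      List.any_eq_true, Bool.and_eq_true, decide_eq_true_eq] at hs
    rcases hs with (((h | h) | h) | h) | ⟨l', h1, h2, h3⟩
    · rw [h]; exact knottable_two_two
    · rw [h]; exact knottable_three_one_three
    · rw [h]; exact knottable_two_one_one_two
    · rw [h]; exact knottable_two_two_one_two_two
    · obtain ⟨x', m', y', rfl, hx', hy', hm', hp', ho'⟩ := exists_of_good h2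
      exact knottable_of_mem_results h1 (ih _ h3 x' y' m' hx' hy' hm' hp' ho' rfl)
  -- Simplifying the outer end uses up at most `a`, `b`, `c`, so `d`, `e`, `f` stay in the interior.
  obtain ⟨a, b, c, d, e, f, m, rfl⟩ : ∃ a b c d e f m', m = a :: b :: c :: d :: e :: f :: m' := by
    match m, hlen with
    | a :: b :: c :: d :: e :: f :: m, _ => exact ⟨a, b, c, d, e, f, m, rfl⟩
    | [], h | [_], h | [_, _], h | [_, _, _], h | [_, _, _, _], h | [_, _, _, _, _], h => simp at h
  simp only [List.mem_cons, forall_eq_or_imp] at hm hm12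
  obtain ⟨ha, hb, hc, hd, he, hf, hm⟩ := hm
  obtain ⟨ha', hb', hc', hd', he', hf', -⟩ := hm12
  -- An odd row in the interior guarantees that the simplified list is not odd-even.
  by_cases hodd : d = 1 ∨ e = 1 ∨ f = 1
  · have hx23 : x = 3 ∨ x = 2 := by omega
    rcases hx23 with rfl | rfl
    -- The outer row `3` becomes `1`, which joins the next row.
    · refine dec_head 1 _ (knottable_hd _ (?_ : Knottable (word ((a + 1) :: _))))
      refine ih _ ?_ (a + 1) y (b :: c :: d :: e :: f :: m) (by omega) hy ?_ ?_ ?_ rfl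
      · simp; omega
      · simp only [List.mem_cons, forall_eq_or_imp]; tauto
      · rw [← par_one_cons]
        rwa [par_cons_add_two 1] at hp
      · rw [oddEven_iff]
        rintro ⟨h, -⟩
        have := h d (by simp)
        have := h e (by simp)
        have := h f (by simp)
        omega
    -- The outer row `2` becomes empty and takes the row `a` with it. Then `b` is the new end,
    -- unless `b = 1`, when it joins `c`.
    · rw [List.cons_append, List.cons_append, par_two_cons] at hp
      rcases hb' with rfl | rfl
      · refine dec_head 0 _ (knottable_hd _ (?_ : Knottable (word ((c + 1) :: _))))
        refine ih _ ?_ (c + 1) y (d :: e :: f :: m) (by omega) hy ?_ ?_ ?_ rfl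
        · simp; omega
        · simp only [List.mem_cons, forall_eq_or_imp]; tauto
        · rw [← par_one_cons]
          exact hp
        · rw [oddEven_iff]
          rintro ⟨h, -⟩
          have := h d (by simp)
          have := h e (by simp)
          have := h f (by simp)
          omega
      · refine dec_head 0 _ (knottable_hd _ (?_ : Knottable (word (2 :: _))))
        refine ih _ ?_ 2 y (c :: d :: e :: f :: m) le_rfl hy ?_ hp ?_ rfl
        · simp; omega
        · simp only [List.mem_cons, forall_eq_or_imp]; tauto
        · rw [oddEven_iff]
          rintro ⟨h, -⟩
          have := h d (by simp)
          have := h e (by simp)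
          have := h f (by simp)
          omega
  -- Otherwise there are three consecutive rows `2, 2, 2`. Emptying the middle one merges its
  -- neighbours into a row `4`; the ends and the other rows remain, so the list stays normal and not
  -- odd-even.
  · obtain rfl : d = 2 := by omega
    obtain rfl : e = 2 := by omega
    obtain rfl : f = 2 := by omega
    have h4 := ih _ ?_ x y (a :: b :: c :: 4 :: m) hx hy ?_ ?_ ?_ rfl
    · refine dec_mid [x, a, b, c, 2] 0 (2 :: (m ++ [y])) ?_
      have := knottable_mid (2 :: 0 :: 2 :: (m ++ [y])) (word [x, a, b, c]) (by
        rw [← word_append]; exact h4)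
      rw [← word_append] at this
      exact this
    · simp; omega
    · simp only [List.mem_cons, forall_eq_or_imp]
      exact ⟨ha, hb, hc, by omega, hm⟩
    · have h := par_append (show par (2 :: 2 :: 2 :: (m ++ [y])) = par (4 :: (m ++ [y])) by
        simp [par]) [x, a, b, c]
      have h' : par (x :: (a :: b :: c :: 2 :: 2 :: 2 :: m ++ [y])) =
        par (x :: (a :: b :: c :: 4 :: m ++ [y])) := h
      rwa [h'] at hp
    · rw [oddEven_iff] at ho ⊢
      simpa using ho

end Twists

/-! ### Parity of the numbers of twists of a knot -/

open TangleShadow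

namespace Twists

open BlockGame Labelled

/-- Signs are odd, so modulo `2` the sum of a row is its length, independently of the resolution. -/
theorem par_eq_true_iff {V : Type} (o : V → ZMod 2) : ∀ B : List (List V),
    ((par (B.map List.length)).1 = true ↔
      Odd (value (B.map fun l => (l.map fun v => sgn (o v)).sum)).1) ∧
    ((par (B.map List.length)).2 = true ↔
      Odd (value (B.map fun l => (l.map fun v => sgn (o v)).sum)).2)
  | [] => by simp [par, value]
  | l :: B => by
    have hl : ∀ l : List V, (l.length % 2 = 1 ↔ Odd (l.map fun v => sgn (o v)).sum) := by
      intro l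
      induction l with
      | nil => simp
      | cons v l ih =>
        have h1 : Odd (sgn (o v)) := by unfold sgn; split <;> decide
        rw [List.map_cons, List.sum_cons, Int.odd_add, ← Int.not_odd_iff_even, ← ih,
          List.length_cons]
        simp only [h1, true_iff]
        omega
    obtain ⟨h1, h2⟩ := par_eq_true_iff o B
    refine ⟨?_, h1⟩
    simp only [List.map_cons, par, value]
    rw [Int.odd_add, ← Int.not_odd_iff_even, Int.odd_mul, ← h2, ← h1, ← hl]
    rcases Nat.mod_two_eq_zero_or_one l.length with h | h <;> rw [h] <;>
      cases (par (B.map List.length)).1 <;> cases (par (B.map List.length)).2 <;> simp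

theorem par_of_singleComponent {α : List ℕ} (h : (build (word α)).close.SingleComponent) :
    (par α).1 = true := by
  obtain ⟨B, hB, hα⟩ := exists_wordOf α (labelling (word α)) (map_labelling _)
  have h1 := odd_slope h fun _ => 0
  rw [slope_eq_act, hB, act_wordOf] at h1
  have h2 := (par_eq_true_iff _ B).1.mpr h1
  rwa [hα] at h2

end Twists

/-! ### Reduction to odd-even shadows or to normal form -/

namespace Shadow

/-- Pseudo Reidemeister I moves lead to an odd-even shadow. -/
def Collapses (S : Shadow) : Prop := ∃ O : Shadow, O.IsOddEven ∧ S.ReducesR1 O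

variable {S S' : Shadow}

theorem Iso.collapses (h : S.Iso S') (h' : S'.Collapses) : S.Collapses := by
  obtain ⟨O, hO, hr⟩ := h'
  exact ⟨O, hO, .head (Or.inr h) hr⟩

theorem Erasure.collapses_of_isLoop {v : S.V} (e : Erasure S {v} S') (h : S.IsKnotShadow)
    (h' : S'.IsKnotShadow) (hv : S.IsLoop v) (hc : S'.Collapses) : S.Collapses := by
  obtain ⟨O, hO, hr⟩ := hc
  exact ⟨O, hO, .head (Or.inl ⟨h, h', v, hv, e.erase_iso⟩) hr⟩

end Shadow

namespace TangleShadow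

theorem collapses_of_oddEven {α : List ℕ} (h : OddEven α) : (build (word α)).close.Collapses := by
  refine ⟨_, ⟨α.reverse, ?_, ?_⟩, .refl⟩
  · have e : rationalShadow α.reverse = (build (word α)).close := by
      rw [rationalShadow, rational_eq, List.reverse_reverse]
    rw [e]
    exact ⟨Equiv.refl _, Equiv.refl _, fun _ => 0, fun v i => by rw [add_zero]; rfl⟩
  · obtain ⟨n, h | h⟩ := h
    · have hl : n + 1 = α.length := by simpa using (congrArg List.length h).symm
      have hr : α.reverse.map (· % 2) = List.replicate n 0 ++ [1] := by
        rw [List.map_reverse, h]; simp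
      have key : ∀ j (hj : j < α.reverse.length), α.reverse[j] % 2 = if j = n then 1 else 0 := by
        intro j hj
        have h3 : (α.reverse.map (· % 2))[j]'(by simpa using hj) = α.reverse[j] % 2 :=
          List.getElem_map ..
        rw [← h3]
        simp only [hr, List.getElem_append, List.length_replicate, List.getElem_replicate,
          List.getElem_singleton]
        rw [List.length_reverse] at hj
        split <;> split <;> first | rfl | omega
      refine ⟨⟨n, by simp; omega⟩, Or.inr (by simp; omega), ?_, fun j hj => ?_⟩
      · rw [Nat.odd_iff, List.get_eq_getElem, key]; simp
      · rw [Nat.even_iff, List.get_eq_getElem, key, if_neg fun h => hj (Fin.ext h)]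
    · have hl : n + 1 = α.length := by simpa using (congrArg List.length h).symm
      have hr : α.reverse.map (· % 2) = 1 :: List.replicate n 0 := by
        rw [List.map_reverse, h]; simp
      have key : ∀ j (hj : j < α.reverse.length), α.reverse[j] % 2 = if j = 0 then 1 else 0 := by
        intro j hj
        have h3 : (α.reverse.map (· % 2))[j]'(by simpa using hj) = α.reverse[j] % 2 :=
          List.getElem_map ..
        rw [← h3]
        simp only [hr, List.getElem_cons, List.getElem_replicate]
        split <;> rfl
      refine ⟨⟨0, by simp; omega⟩, Or.inl rfl, ?_, fun j hj => ?_⟩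
      · rw [Nat.odd_iff, List.get_eq_getElem, key]; simp
      · rw [Nat.even_iff, List.get_eq_getElem, key, if_neg fun h => hj (Fin.ext h)]

theorem exists_of_isOddEven {O : Shadow} (h : O.IsOddEven) :
    ∃ α, OddEven α ∧ (build (word α)).close.Iso O := by
  obtain ⟨a, hi, i, hi', ho, he⟩ := h
  rw [rationalShadow, rational_eq] at hi
  refine ⟨_, ?_, hi⟩
  have key : ∀ j (hj : j < a.length), a[j] % 2 = if j = i.1 then 1 else 0 := by
    intro j hj
    split
    · subst j; exact Nat.odd_iff.mp ho
    · exact Nat.even_iff.mp (he ⟨j, hj⟩ fun h => by subst h; contradiction)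
  have hi2 := i.2
  rcases hi' with h0 | h0
  · refine ⟨a.length - 1, Or.inr ?_⟩
    rw [List.map_reverse, List.reverse_eq_iff]
    refine List.ext_getElem (by simp; omega) fun j h1 h2 => ?_
    rw [List.getElem_map, key, h0]
    simp [List.getElem_cons]
  · refine ⟨a.length - 1, Or.inl ?_⟩
    rw [List.map_reverse, List.reverse_eq_iff]
    refine List.ext_getElem (by simp; omega) fun j h1 h2 => ?_
    rw [List.length_map] at h1
    rw [List.getElem_map, key]
    simp only [List.reverse_cons, List.reverse_replicate, List.getElem_append, List.length_replicate,
      List.getElem_replicate, List.getElem_singleton]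
    split <;> split <;> first | rfl | omega

/-- Used to discard a pair of reflections that only serves to bring a word into the form `word α`.
-/
theorem _root_.Knottable.of_reflect_reflect {u v : List Bool}
    (h : Knottable (u ++ false :: false :: v)) : Knottable (u ++ v) := by
  intro V _ L hL hn b hb
  obtain ⟨L1, L2, rfl, rfl, rfl⟩ := List.map_eq_append_iff.mp hL
  refine (h V (L1 ++ none :: none :: L2) (by simp) ?_ b hb).mono fun o ho => ?_
  · simpa [Labelled.labels] using hn
  · simpa only [Labelled.Goal, Labelled.act_append, Labelled.act, Prod.swap_swap] using ho

/-- Closed rational shadows that become odd-even, or on which the Knotter wins when moving last. -/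
def Settled (w : List Bool) : Prop := (build w).close.Collapses ∨ Knottable w

theorem build_append_reflect_reflect (u v : List Bool) :
    build (u ++ false :: false :: v) = build (u ++ v) := by
  rw [build_append, build_append]
  exact congrArg _ (reflect_reflect _)

theorem settled_reflect_reflect {u v : List Bool} (h : Settled (u ++ v)) :
    Settled (u ++ false :: false :: v) := by
  refine h.imp (fun h => ?_) fun h => h.reflect_reflect
  rwa [build_append_reflect_reflect]

theorem Erasure.collapses_ops {v v' : List Bool} (e : Erasure (build v) ∅ (build v'))
    (u : List Bool) (h : (build (u ++ v')).close.Collapses) : (build (u ++ v)).close.Collapses := by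
  rw [build_append] at h ⊢
  have e' : Shadow.Erasure (TangleShadow.ops u (build v)).close ∅ (TangleShadow.ops u (build v')).close :=
    cast (by rw [Set.image_empty]; rfl) (e.ops u).close
  exact e'.iso.collapses h

theorem Erasure.collapses_ops_of_isLoop {v v' : List Bool} {x : (build v).V}
    (e : Erasure (build v) {x} (build v')) (hx : (build v).toShadow.IsLoop x)
    (u : List Bool) (h : (build (u ++ v)).close.SingleComponent)
    (h' : (build (u ++ v')).close.Collapses) : (build (u ++ v)).close.Collapses := by
  have hk := close_isKnotShadow _ h
  have hk' := close_isKnotShadow (u ++ v')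
  rw [build_append] at h hk h' hk' ⊢
  have e' : Shadow.Erasure (TangleShadow.ops u (build v)).close {inner u x}
      (TangleShadow.ops u (build v')).close :=
    cast (by rw [Set.image_singleton]; rfl) (e.ops u).close
  exact e'.collapses_of_isLoop hk (hk' (e'.singleComponent h)) (isLoop_close (isLoop_inner hx u)) h'

theorem Erasure.singleComponent_ops {v v' : List Bool} {A : Set (build v).V}
    (e : Erasure (build v) A (build v')) (u : List Bool)
    (h : (build (u ++ v)).close.SingleComponent) : (build (u ++ v')).close.SingleComponent := by
  rw [build_append] at h ⊢
  exact (e.ops u).close.singleComponent h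

theorem singleComponent_curl {u : List Bool} (h : (build (u ++ [true])).close.SingleComponent) :
    (build u).close.SingleComponent := by
  have := curlBase.singleComponent_ops (v := [true]) (v' := []) u h
  rwa [List.append_nil] at this

theorem settled_curl {u : List Bool} (h : (build (u ++ [true])).close.SingleComponent)
    (h' : Settled u) : Settled (u ++ [true]) := by
  refine h'.imp (fun hc => ?_) fun h => h.curl
  refine curlBase.collapses_ops_of_isLoop (v := [true]) (v' := []) isLoop_curl u h ?_
  rwa [List.append_nil]

theorem settled_base {u : List Bool} (h : Settled (u ++ [true, false])) :
    Settled (u ++ [false, true, false]) :=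
  h.imp (reflectCrossing.collapses_ops (v := [false, true, false]) (v' := [true, false]) u)
    fun h => h.base

theorem settled_closing_curl {v : List Bool} (h : (build (false :: true :: v)).close.SingleComponent)
    (h' : Settled (false :: v)) : Settled (false :: true :: v) :=
  h'.imp (fun hc => (closeReflectTwist (build v)).collapses_of_isLoop
      (close_isKnotShadow _ h)
      (close_isKnotShadow (false :: v) ((closeReflectTwist (build v)).singleComponent h))
      (isLoop_closeReflectTwist _) hc)
    fun h => h.closing_curl

end TangleShadow

namespace Twists

/-- An empty interior row can be merged away, which leaves only the two ends to be examined. -/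
theorem exists_ends : ∀ α : List ℕ, α = [] ∨ (∃ x, α = [x]) ∨
    (∃ β a b γ, α = β ++ a :: 0 :: b :: γ) ∨ ∃ x m y, α = x :: (m ++ [y]) ∧ ∀ k ∈ m, 1 ≤ k := by
  intro α
  rcases α with _ | ⟨x, α⟩
  · exact Or.inl rfl
  obtain rfl | ⟨m, y, rfl⟩ := α.eq_nil_or_concat'
  · exact Or.inr (Or.inl ⟨x, rfl⟩)
  refine Or.inr (Or.inr ?_)
  by_cases hm : 0 ∈ m
  · left
    obtain ⟨s, t, rfl⟩ := List.append_of_mem hm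
    obtain ⟨β, a, hβ⟩ : ∃ β a, x :: s = β ++ [a] :=
      (List.eq_nil_or_concat' (x :: s)).resolve_left (by simp)
    obtain ⟨b, γ, hγ⟩ : ∃ b γ, t ++ [y] = b :: γ := by cases t <;> simp
    refine ⟨β, a, b, γ, ?_⟩
    calc x :: (s ++ 0 :: t ++ [y]) = (x :: s) ++ 0 :: (t ++ [y]) := by simp
      _ = _ := by rw [hβ, hγ]; simp
  · refine Or.inr ⟨x, m, y, rfl, fun k hk => ?_⟩
    rcases k with _ | k
    · exact (hm hk).elim
    · omega

/-- Every rational knot shadow with a crossing becomes odd-even, or the Knotter wins on it when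
moving last. -/
theorem settled (α : List ℕ) (h : (build (word α)).close.SingleComponent) (hα : 1 ≤ α.sum) :
    Settled (word α) := by
  induction hn : α.sum + α.length using Nat.strong_induction_on generalizing α with | _ n ih
  have hpar := par_of_singleComponent h
  by_cases hoe : OddEven α
  · exact Or.inl (collapses_of_oddEven hoe)
  obtain rfl | ⟨x, rfl⟩ | ⟨β, a, b, γ, rfl⟩ | ⟨x, m, y, rfl, hm⟩ := exists_ends α
  · simp at hα
  -- A single row closes to a knot only if it is odd, and then it is odd-even.
  · have hx : x % 2 = 1 := by simpa [par] using hpar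
    exact (hoe ⟨0, Or.inl (by simp [hx])⟩).elim
  · have e1 : word (β ++ (a + b) :: γ) =
        (word β ++ List.replicate a true) ++ (List.replicate b true ++ false :: word γ) := by
      simp only [word_append, word, List.replicate_add, List.append_assoc]
    have e2 : word (β ++ a :: 0 :: b :: γ) = (word β ++ List.replicate a true) ++
        false :: false :: (List.replicate b true ++ false :: word γ) := by
      simp [word_append, word]
    rw [e2] at h ⊢
    refine settled_reflect_reflect ?_
    rw [build_append_reflect_reflect] at h
    rw [← e1] at h ⊢
    refine ih _ ?_ _ h ?_ rfl
    · simp at hn ⊢; omega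
    · simp at hα ⊢; omega
  rw [oddEven_iff] at hoe
  rcases Nat.eq_zero_or_pos x with rfl | hx
  -- Outer row empty: the last crossing of the next row is a loop. A crossing must remain after its
  -- deletion, because a crossingless circle is not odd-even.
  · obtain ⟨k, γ, hk, hsum⟩ : ∃ k γ, m ++ [y] = (k + 1) :: γ ∧ 1 ≤ k + γ.sum := by
      rcases m with _ | ⟨k, m⟩
      · simp at hα hoe
        exact ⟨y - 1, [], by simp; omega, by simp; omega⟩
      · have hk := hm k List.mem_cons_self
        refine ⟨k - 1, m ++ [y], by simp; omega, ?_⟩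
        rcases m with _ | ⟨l, m⟩
        -- The list `0, 1, 0` is excluded because its closure is not a knot.
        · by_contra hc
          obtain rfl : k = 1 := by simp at hc; omega
          obtain rfl : y = 0 := by simp at hc; omega
          simp [par] at hpar
        · have := hm l (by simp)
          simp; omega
    rw [hk] at h hn ⊢
    refine settled_closing_curl h (ih _ ?_ (0 :: k :: γ) ?_ ?_ rfl)
    · simp at hn ⊢; omega
    · exact (closeReflectTwist (build (List.replicate k true ++ false :: word γ))).singleComponent h
    · simpa using hsum
  rcases Nat.eq_zero_or_pos y with rfl | hy
  -- Inner row empty: its two reflections cancel, and the next row twists the starting tangle, which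
  -- produces loops.
  · obtain ⟨β, k, hk, hsum⟩ : ∃ β k, x :: m = β ++ [k + 1] ∧ 1 ≤ β.sum + k := by
      obtain rfl | ⟨m, k, rfl⟩ := m.eq_nil_or_concat'
      · simp at hoe
        exact ⟨[], x - 1, by simp; omega, by simp; omega⟩
      · have hk := hm k (by simp)
        exact ⟨x :: m, k - 1, by simp; omega, by simp; omega⟩
    rw [← List.cons_append, hk] at h hn ⊢
    have e : ∀ k, word (β ++ [k] ++ [0]) = (word β ++ List.replicate k true) ++ [false, false] := by
      intro k; simp [word_append, word]
    have e' : word β ++ List.replicate (k + 1) true = (word β ++ List.replicate k true) ++ [true] := by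
      simp [List.replicate_succ']
    rw [e] at h ⊢
    refine settled_reflect_reflect ?_
    rw [build_append_reflect_reflect] at h
    rw [List.append_nil, e'] at h ⊢
    refine settled_curl h ?_
    have h1 := singleComponent_curl h
    have h2 := ih _ ?_ (β ++ [k] ++ [0]) ?_ ?_ rfl
    · rw [e] at h2
      refine h2.imp (fun h => ?_) ?_
      · rwa [build_append_reflect_reflect, List.append_nil] at h
      · intro h
        have := h.of_reflect_reflect
        rwa [List.append_nil] at this
    · simp at hn ⊢; omega
    · rw [e, build_append_reflect_reflect, List.append_nil]
      exact h1
    · simp; omega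
  obtain rfl | hy : y = 1 ∨ 2 ≤ y := by omega
  -- A single innermost crossing joins the neighbouring row.
  · obtain ⟨β, k, hk⟩ : ∃ β k, x :: m = β ++ [k] :=
      (List.eq_nil_or_concat' (x :: m)).resolve_left (by simp)
    rw [← List.cons_append, hk] at h hn ⊢
    have e1 : word (β ++ [k] ++ [1]) = (word β ++ List.replicate k true) ++ [false, true, false] := by
      simp [word_append, word]
    have e2 : word (β ++ [k + 1]) = (word β ++ List.replicate k true) ++ [true, false] := by
      simp [word_append, word, List.replicate_succ']
    rw [e1] at h ⊢
    refine settled_base ?_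
    have h1 := reflectCrossing.singleComponent_ops (v := [false, true, false]) (v' := [true, false]) _ h
    rw [← e2] at h1 ⊢
    refine ih _ ?_ _ h1 ?_ rfl
    · simp at hn ⊢; omega
    · simp; omega
  obtain rfl | hx : x = 1 ∨ 2 ≤ x := by omega
  -- Joining the single outermost crossing to the next row gives the mirror image of the shadow. The
  -- Knotter's goal does not notice this, but if the new list is odd-even, an odd-even form of the
  -- shadow itself has to be found.
  · rcases m with _ | ⟨k, m⟩
    · have : ¬ y % 2 = 1 := fun h => by simp [par, h] at hpar
      simp at hoe; omega
    have hk := hm k List.mem_cons_self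
    have hm' : ∀ k ∈ m, 1 ≤ k := fun k hk => hm k (List.mem_cons_of_mem _ hk)
    rw [List.cons_append] at hpar ⊢
    rw [par_one_cons] at hpar
    by_cases ho : OddEven ((k + 1) :: (m ++ [y]))
    · left
      obtain ⟨h1, h2 | h2⟩ := oddEven_iff.mp ho
      -- Here `k` is even, so the original list would already be odd-even.
      · exact (hoe ⟨by simpa using ⟨by omega, h1⟩, Or.inl ⟨rfl, h2.2⟩⟩).elim
      · obtain ⟨β, hβ, ⟨e⟩⟩ := nonempty_oddEven k m.length (m ++ [y]) (Nat.odd_iff.mpr (by omega)) (by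
          rw [List.map_append, List.map_cons, h2.2, List.map_nil]
          congr 1
          exact List.eq_replicate_iff.mpr ⟨by simp, by simpa using h1⟩)
        exact e.iso.collapses (collapses_of_oddEven hβ)
    · exact Or.inr (Knottable.closing (knottable_of_normal (k + 1) y m (by omega) hy hm' hpar ho))
  · exact Or.inr (knottable_of_normal x y m hx hy hm hpar (oddEven_iff.not.mpr hoe))

end Twists

/-! ### Outcomes of the game -/

open TangleShadow ResolvingGame

theorem mainTheorem1 (T : Shadow) (hrat : T.IsRational) (hknot : T.SingleComponent)
    (hne : Nonempty T.V) :
    ((∃ O : Shadow, O.IsOddEven ∧ T.ReducesR1 O) → T.UnknotterWins) ∧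
    ((¬ ∃ O : Shadow, O.IsOddEven ∧ T.ReducesR1 O) →
      (Even (Nat.card T.V) → T.SecondPlayerWins) ∧
      (Odd (Nat.card T.V) → T.FirstPlayerWins)) := by
  obtain ⟨a, ha⟩ := hrat
  rw [rationalShadow, rational_eq] at ha
  generalize a.reverse = α at ha
  obtain ⟨e'⟩ := Shadow.Erasure.nonempty_of_iso ha
  have e := e'.symm
  have hsc := e.singleComponent hknot
  have hS := close_isKnotShadow _ hsc
  have hT := e'.isKnotShadow hS
  have hlast : T.Unknottable 0 := e.unknottable hT (unknottable_last _ hsc)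
  have hcard : Nat.card (build (word α)).close.V = Nat.card T.V :=
    Nat.card_eq_of_bijective _ e.k_bijective
  constructor
  · rintro ⟨O, hO, hr⟩
    have hfree : T.Unknottable 1 := by
      refine hr.unknottable hT fun hk => ?_
      obtain ⟨β, hβ, hi⟩ := exists_of_isOddEven hO
      obtain ⟨f'⟩ := Shadow.Erasure.nonempty_of_iso hi
      have f := f'.symm
      exact f.unknottable hk (unknottable_of_oddEven β hβ (f.singleComponent hk.singleComponent))
    have hwin : ∀ b, Win (fun o => Diagram.IsUnknot ⟨T, o⟩) b fun _ => none := by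
      intro b
      -- The equivalence says that the Unknotter moves last.
      by_cases hb : b = true ↔ Odd (Nat.card T.V)
      · exact hlast.win b hb
      · refine hfree.win b ?_
        rw [Nat.odd_add_one]
        tauto
    rintro (_ | _)
    · exact Shadow.CanWin.of_win (p := .unknotter) (hwin true)
    · exact Shadow.CanWin.of_win (p := .unknotter) (hwin false)
  · intro hno
    have hsum : 1 ≤ α.sum := by
      have : Finite T.V := .of_surjective _ e.k_bijective.2
      have h1 : Nat.card (build (word α)).close.V = α.sum := (card_build _).trans (count_word α)
      have h2 : 0 < Nat.card T.V := Nat.card_pos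
      omega
    have hK : Knottable (word α) := (Twists.settled α hsc hsum).resolve_left fun hc =>
      hno (e.iso.collapses hc)
    have hwin : ∀ (p : Player) b, (b = true ↔ Odd (Nat.card T.V)) →
        Win (fun o => p.WonBy ⟨T, o⟩) b fun _ => none := by
      rintro (_ | _) b hb
      · exact hlast.win b hb
      · rw [← hcard] at hb
        -- The isotopy from `T` to the closure renames the crossings and shifts the values, so the
        -- strategy carries over.
        refine (win_of_knottable hK b hb).sim e.k_injective (fun v => strand (e.r v)) _
          (fun _ => rfl) (fun v hv => (hv (e.k_bijective.2 v)).elim) fun o _ ho hu => ho ?_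
        exact Shadow.isUnknot_of_move ⟨hS, hT, Or.inl (e.diagram_iso o).symm⟩ hu
    refine ⟨fun he p => ?_, fun ho p => ?_⟩
    · exact Shadow.CanWin.of_win (hwin p false (by simpa using he))
    · exact Shadow.CanWin.of_win (hwin p true (by simpa using ho))
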